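/- Let $0<R_1<R_2<R<\rho$ and let $z$ be the coordinate on the disk $\{|z|<\rho\}\subset\mathbb C$. Write $\mathbb D=\{|z|<R\}$, $\mathbb D^\times=\mathbb D\setminus\{0\}$, $\sigma_3=\mathrm{diag}(1,-1)$. On $\{|z|<\rho\}$ consider (near a simple zero of $q_2=-\det\varphi=z\,dz^2$) the $SL(2,\mathbb C)$-Higgs bundle and the singular metric $$\bar\partial_E=\bar\partial,\qquad \varphi=\begin{pmatrix}0&z\\1&0\end{pmatrix}dz,\qquad h_\infty=\begin{pmatrix}|z|^{-1/2}&0\\0&|z|^{1/2}\end{pmatrix}.$$ Let $\chi:\mathbb R\to[0,1]$ be smooth with $\chi(r)=1$ for $r\le R_1$ and $\chi(r)=0$ for $r\ge R_2$. For $t>0$ let $u_t:(0,\infty)\to\mathbb R$ be a solution of $u_t''+\frac1r u_t'=8t^2r\sinh(2u_t)$ with $u_t\sim\frac1\pi K_0(\frac{8t}{3}r^{3/2})$ as $r\to\infty$ and $u_t\sim-\frac12\log r$ as $r\to0$ ($K_0$ the modified Bessel function), and put $$h_t^{\rm app}=\begin{pmatrix}|z|^{-1/2}e^{-u_t(|z|)\chi(|z|)}&0\\0&|z|^{1/2}e^{u_t(|z|)\chi(|z|)}\end{pmatrix}.$$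 For a metric $h$, $\dagger_h$ is the $h$-adjoint and $\partial_E^h$ the $(1,0)$-part of the Chern connection of $(\bar\partial_E,h)$. An infinitesimal Higgs deformation is a pair $(\dot\eta,\dot\varphi)$ of a smooth traceless matrix-valued $(0,1)$-form and $(1,0)$-form with $\bar\partial_E\dot\varphi+[\dot\eta,\varphi]=0$. Two of them are equivalent on a domain if $\dot\eta_2-\dot\eta_1=\bar\partial_E\dot\gamma$, $\dot\varphi_2-\dot\varphi_1=[\varphi,\dot\gamma]$ there for a smooth traceless $\dot\gamma$; such a $\dot\gamma$ carries a traceless metric variation $\dot\nu$ (meaning $h_\epsilon(v,w)=h(e^{\epsilon\dot\nu}v,e^{\epsilon\dot\nu}w)$) to $\dot\nu+\dot\gamma$. A triple $(\dot\eta,\dot\varphi,\dot\nu)$ is in formal Coulomb gauge for $(\bar\partial_E,\varphi,h)$ if $$\partial_E^{h}\bar\partial_E\dot\nu-\partial_E^{h}\dot\eta-[\varphi^{\dagger_{h}},\dot\varphi+[\dot\nu,\varphi]]=0,\tag{1}$$ and for $h=h_\infty$ one also imposes $$[\dot\varphi,\varphi^{\dagger_{h_\infty}}]+[\varphi,\dot\varphi^{\dagger_{h_\infty}}]+[\varphi,[\varphi^{\dagger_{h_\infty}},\dot\nu+\dot\nu^{\dagger_{h_\infty}}]]=0.\tag{2}$$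 The contribution of $\mathbb D$ to the squared norm of the triple is $\|(\dot\eta,\dot\varphi,\dot\nu)\|^2_{h,\mathbb D}=2\int_{\mathbb D}\langle\dot\eta-\bar\partial_E\dot\nu,\dot\eta\rangle_h+\langle\dot\varphi+[\dot\nu,\varphi],\dot\varphi\rangle_h$, with $\langle\alpha,\beta\rangle_h=\mathrm{tr}(\alpha\wedge\bar\star\beta^{\dagger_h})$; it is written $g_{\rm app}(\mathbb D)$ for $h=h^{\rm app}_t$ and $g_{\rm sf}(\mathbb D)$ for $h=h_\infty$. Let $(\dot\eta,\dot\varphi)$ be an infinitesimal Higgs deformation on $\{|z|<\rho\}$. Then: (a) On $\mathbb D$ its class contains exactly one representative with vanishing $(0,1)$-part and strictly upper triangular $(1,0)$-part; it is $\left(0,\begin{pmatrix}0&\dot P\\0&0\end{pmatrix}dz\right)$ with $\dot P$ holomorphic on $\mathbb D$. From now on $\dot\varphi$ denotes the $(1,0)$-part of this representative. (b) Let $\dot\nu_\infty=-\frac{\dot P}{4z}\sigma_3$ on $\mathbb D^\times$. For every $t>0$ the triple $(0,t\dot\varphi,\dot\nu_\infty)$ satisfies (1) and (2) on $\mathbb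 D^\times$ for $(\bar\partial_E,t\varphi,h_\infty)$; in particular it is in formal Coulomb gauge. Moreover, if $\dot\nu$ is any smooth traceless metric variation on $\mathbb D^\times$ that satisfies (1) and (2) for $h_\infty$ together with the original deformation, then there is a unique infinitesimal gauge transformation $\dot\gamma$ on $\mathbb D^\times$ that carries the original deformation to $(0,\dot\varphi)$ and $\dot\nu$ to a $\dot\nu'$ inducing the same first-order variation of $h_\infty$ as $\dot\nu_\infty$, that is, $\dot\nu'+\dot\nu'^{\dagger_{h_\infty}}=\dot\nu_\infty+\dot\nu_\infty^{\dagger_{h_\infty}}$; and $\dot\nu'=\dot\nu_\infty$ if the original deformation has $\dot\eta-\bar\partial_E\dot\nu=0$ on $\mathbb D^\times$. (c) For $t>0$ let $\dot\nu_t^{\rm app}$ be the traceless metric variation that is $C^2$ on $\{|z|\le R_2\}$, satisfies (1) in $\{|z|<R_2\}$ for $(\bar\partial_E,t\varphi,h_t^{\rm app})$ and $(0,t\dot\varphi)$, and agrees with $\dot\nu_\infty$ on $\{R_2\le|z|<R\}$ (where $h_t^{\rm app}=h_\infty$). Then $\dot\nu_t^{\rm app}$ is diagonal on $\mathbb D$.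 (d) Along the ray, both norms below are given by absolutely convergent integrals, and there is a constant $\gamma>0$ such that, as $t\to\infty$, $$\|(0,t\dot\varphi,\dot\nu_t^{\rm app})\|^2_{g_{\rm app}(\mathbb D)}-\|(0,t\dot\varphi,\dot\nu_\infty)\|^2_{g_{\rm sf}(\mathbb D)}=O(e^{-\gamma t}).$$ -/

import Mathlib

open scoped ContDiff Topology
open Set Filter Asymptotics MeasureTheory

noncomputable section

namespace HiggsDisk

/-- Local `End E`-valued quantities in the chosen holomorphic frame. A form `a dz` or `a dz̄` is
represented by its coefficient `a : ℂ → Mat`, and a two-form `a dz ∧ dz̄` by `a : ℂ → Mat`. -/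
abbrev Mat := Matrix (Fin 2) (Fin 2) ℂ

/-! ### Wirtinger derivatives -/

/-- `∂g/∂z = (g_x - i g_y) / 2`. -/
def wirt (g : ℂ → ℂ) (z : ℂ) : ℂ :=
  (fderiv ℝ g z 1 - Complex.I * fderiv ℝ g z Complex.I) / 2

/-- `∂g/∂z̄ = (g_x + i g_y) / 2`. -/
def wirtBar (g : ℂ → ℂ) (z : ℂ) : ℂ :=
  (fderiv ℝ g z 1 + Complex.I * fderiv ℝ g z Complex.I) / 2

/-- Entrywise `∂/∂z`. -/
def matDz (A : ℂ → Mat) (z : ℂ) : Mat := Matrix.of fun i j => wirt (fun w => A w i j) z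

/-- Entrywise `∂/∂z̄`. -/
def matDzBar (A : ℂ → Mat) (z : ℂ) : Mat := Matrix.of fun i j => wirtBar (fun w => A w i j) z

/-- Entrywise (real) `C^n` regularity on a set. -/
def MatContDiffOn (n : WithTop ℕ∞) (A : ℂ → Mat) (s : Set ℂ) : Prop :=
  ∀ i j, ContDiffOn ℝ n (fun z => A z i j) s

def TracelessOn (A : ℂ → Mat) (s : Set ℂ) : Prop := ∀ z ∈ s, (A z).trace = 0

/-! ### The disk -/

/-- The disk of radius `R` in the coordinate `z`. -/
def disk (R : ℝ) : Set ℂ := Metric.ball 0 R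

/-- The punctured disk of radius `R`. -/
def puncturedDisk (R : ℝ) : Set ℂ := Metric.ball 0 R \ {0}

/-! ### Hermitian metrics -/

/-- The adjoint of `B` for the hermitian form `h(v, w) = w^* H v`. -/
def adj (H B : Mat) : Mat := H⁻¹ * B.conjTranspose * H

/-- The `dz ∧ dz̄`-coefficient of `∂_E^h (a dz̄)`, where `∂_E^h = ∂ + [H⁻¹ ∂H, ·]` is the
`(1,0)`-part of the Chern connection of `(∂̄, h)` on endomorphisms. -/
def chernDz (H : ℂ → Mat) (a : ℂ → Mat) (z : ℂ) : Mat :=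
  matDz a z + ⁅(H z)⁻¹ * matDz H z, a z⁆

/-- `diag (|z|^{-1/2} e^{-w(|z|)}, |z|^{1/2} e^{w(|z|)})`. -/
def diagMetric (w : ℝ → ℝ) (z : ℂ) : Mat :=
  !![((‖z‖ ^ (-(1 / 2) : ℝ) * Real.exp (-w ‖z‖) : ℝ) : ℂ), 0;
     0, ((‖z‖ ^ (1 / 2 : ℝ) * Real.exp (w ‖z‖) : ℝ) : ℂ)]

/-- The limiting metric `h_∞`. -/
def hInf : ℂ → Mat := diagMetric fun _ => 0

/-- The approximate metric built from a radial function `u` and a cutoff `χ`. -/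
def hApp (u χ : ℝ → ℝ) : ℂ → Mat := diagMetric fun r => u r * χ r

/-- The modified Bessel function `K₀(x)`, `x > 0`. -/
def besselK0 (x : ℝ) : ℝ := ∫ s in Ioi (0 : ℝ), Real.exp (-x * Real.cosh s)

/-- `u = u_t` is the solution on `(0, ∞)` of `u'' + u'/r = 8 t² r sinh (2u)` with
`u ~ K₀(8t r^{3/2}/3)/π` at infinity and `u ~ -(log r)/2` at zero. -/
structure IsModelSolution (t : ℝ) (u : ℝ → ℝ) : Prop where
  contDiffOn : ContDiffOn ℝ 2 u (Ioi 0)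
  ode : ∀ r > 0, deriv (deriv u) r + (1 / r) * deriv u r
    - 8 * t ^ 2 * r * Real.sinh (2 * u r) = 0
  atTop : u ~[atTop] fun r => (1 / Real.pi) * besselK0 (8 * t / 3 * r ^ (3 / 2 : ℝ))
  atZero : u ~[𝓝[>] 0] fun r => -(1 / 2) * Real.log r

/-- A smooth radial cutoff, equal to `1` for `r ≤ R₁` and to `0` for `r ≥ R₂`. -/
structure IsCutoff (χ : ℝ → ℝ) (R₁ R₂ : ℝ) : Prop where
  contDiff : ContDiff ℝ ∞ χ
  mem_Icc : ∀ r, χ r ∈ Icc (0 : ℝ) 1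
  eq_one : ∀ r ≤ R₁, χ r = 1
  eq_zero : ∀ r ≥ R₂, χ r = 0

/-! ### Higgs bundle deformations -/

/-- The Higgs field `φ = [[0, z], [1, 0]] dz`. -/
def higgs (z : ℂ) : Mat := !![0, z; 1, 0]

/-- `(η̇, φ̇) = (η dz̄, f dz)` is an infinitesimal deformation on `s` of the `SL(2,ℂ)`-Higgs
bundle `(∂̄, M dz)`: it is smooth, traceless, and `∂̄φ̇ + [η̇, φ] = 0`. -/
structure IsHiggsDeformation (s : Set ℂ) (M η f : ℂ → Mat) : Prop where
  smooth_eta : MatContDiffOn ∞ η s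
  smooth_phi : MatContDiffOn ∞ f s
  trace_eta : TracelessOn η s
  trace_phi : TracelessOn f s
  eqn : ∀ z ∈ s, matDzBar f z + ⁅η z, M z⁆ = 0

/-- The infinitesimal gauge transformation `γ` carries `(η₁, f₁)` to `(η₂, f₂)` on `s`:
`η̇₂ - η̇₁ = ∂̄γ` and `φ̇₂ - φ̇₁ = [φ, γ]`. -/
structure IsGauge (s : Set ℂ) (M γ η₁ f₁ η₂ f₂ : ℂ → Mat) : Prop where
  smooth : MatContDiffOn ∞ γ s
  traceless : TracelessOn γ s
  eta : ∀ z ∈ s, η₂ z - η₁ z = matDzBar γ z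
  phi : ∀ z ∈ s, f₂ z - f₁ z = ⁅M z, γ z⁆

/-- Two deformations determine the same class on `s`. -/
def GaugeEquiv (s : Set ℂ) (M η₁ f₁ η₂ f₂ : ℂ → Mat) : Prop :=
  ∃ γ, IsGauge s M γ η₁ f₁ η₂ f₂

/-- The equation `∂_E^h ∂̄_E ν - ∂_E^h η̇ - [φ^†, φ̇ + [ν, φ]] = 0` on `s`, as the vanishing of the
coefficient of `dz ∧ dz̄`. The bracket of the `(0,1)`-form `φ^†` and the `(1,0)`-form
`X dz` is `φ^† ∧ X dz + X dz ∧ φ^†`, whose coefficient is `-[M^†, X]`. -/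
def FormalCoulomb (s : Set ℂ) (H M η f ν : ℂ → Mat) : Prop :=
  ∀ z ∈ s, chernDz H (fun w => matDzBar ν w - η w) z
    + ⁅adj (H z) (M z), f z + ⁅ν z, M z⁆⁆ = 0

/-- The linearization of `[φ, φ^†] = 0`, namely
`[φ̇, φ^†] + [φ, φ̇^†] + [φ, [φ^†, ν + ν^†]] = 0` on `s`. -/
def LinearizedNormal (s : Set ℂ) (H M f ν : ℂ → Mat) : Prop :=
  ∀ z ∈ s, ⁅f z, adj (H z) (M z)⁆ + ⁅M z, adj (H z) (f z)⁆
    + ⁅M z, ⁅adj (H z) (M z), ν z + adj (H z) (ν z)⁆⁆ = 0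

/-- The strictly upper triangular `φ̇ = [[0, P], [0, 0]] dz`. -/
def upper (P : ℂ → ℂ) (z : ℂ) : Mat := !![0, P z; 0, 0]

/-- `ν_∞ = -(P / 4z) σ₃`, on the punctured disk. -/
def nuInf (P : ℂ → ℂ) (z : ℂ) : Mat := (-(P z / (4 * z))) • !![1, 0; 0, -1]

/-- `ν` is the metric variation `ν_t^app` of `h_t^app` for the variation `(0, t φ̇)` of
`(∂̄, t φ)`, with `φ̇ = [[0, P], [0, 0]] dz`: it solves the formal Coulomb equation in the disk of
radius `R₂` outside of which `h_t^app = h_∞` (the equation is written off the origin, across which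
`ν` is `C²`), and it agrees with `ν_∞` from the boundary of that disk on. -/
structure IsAppVariation (t R R₂ : ℝ) (u χ : ℝ → ℝ) (P : ℂ → ℂ) (ν : ℂ → Mat) : Prop where
  contDiffOn : MatContDiffOn 2 ν (Metric.closedBall 0 R₂)
  traceless : TracelessOn ν (disk R)
  coulomb : FormalCoulomb (puncturedDisk R₂) (hApp u χ)
    (fun z => (t : ℂ) • higgs z) (fun _ => 0) (fun z => (t : ℂ) • upper P z) ν
  outer : ∀ z ∈ disk R, R₂ ≤ ‖z‖ → ν z = nuInf P z

/-- The density with respect to `dx dy` of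
`⟨η̇ - ∂̄ν, η̇⟩_h + ⟨φ̇ + [ν, φ], φ̇⟩_h`, where `⟨α, β⟩ = tr (α ∧ ⋆̄ β^†)`; for `α = a dz`, `β = b dz`
(or both of type `dz̄`) this is `i tr (a b^†) dz ∧ dz̄ = 2 tr (a b^†) dx dy`. -/
def normDensity (H M η f ν : ℂ → Mat) (z : ℂ) : ℂ :=
  2 * ((η z - matDzBar ν z) * adj (H z) (η z)).trace
    + 2 * ((f z + ⁅ν z, M z⁆) * adj (H z) (f z)).trace

/-- The contribution of the disk of radius `R` to the squared norm of `(η̇, φ̇, ν)` in the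
`L²`-metric: `2 ∫ ⟨η̇ - ∂̄ν, η̇⟩_h + ⟨φ̇ + [ν, φ], φ̇⟩_h`. -/
def diskNormSq (R : ℝ) (H M η f ν : ℂ → Mat) : ℂ :=
  2 * ∫ z in disk R, normDensity H M η f ν z

/-- The density of `‖(0, t φ̇, ν)‖²` at `(∂̄, t φ)` for `φ̇ = [[0, P], [0, 0]] dz`. -/
def rayDensity (t : ℝ) (H : ℂ → Mat) (P : ℂ → ℂ) (ν : ℂ → Mat) : ℂ → ℂ :=
  normDensity H (fun z => (t : ℂ) • higgs z) (fun _ => 0) (fun z => (t : ℂ) • upper P z) ν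

/-- `‖(0, t φ̇, ν)‖²` on the disk of radius `R`, at `(∂̄, t φ)`, for `φ̇ = [[0, P], [0, 0]] dz`. -/
def rayNormSq (R t : ℝ) (H : ℂ → Mat) (P : ℂ → ℂ) (ν : ℂ → Mat) : ℂ :=
  diskNormSq R H (fun z => (t : ℂ) • higgs z) (fun _ => 0) (fun z => (t : ℂ) • upper P z) ν

end HiggsDisk

end

/-! The class of a deformation is recorded by `P = tr(φ φ̇) = f₀₁ + z f₁₀`, the first variation of
`-det φ`. It is gauge invariant because `tr(φ[φ, γ]) = 0`, and holomorphic because pairing the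
deformation equation with `φ` removes `[η̇, φ]`. Reaching the strictly upper triangular form costs
one inhomogeneous Cauchy-Riemann equation, solved by a Cauchy transform
(`exists_wirtBar_eq_on_disk`); the other entries of the gauge transformation are then algebraic.

For `h_∞` the Higgs field is normal, with `φ† = (|z|/z) φ`, and `φ̇ + [ν_∞, φ] = (P/2z) φ`, so all
brackets in the two gauge equations vanish. The only freedom left is to add `g φ` with `g`
holomorphic. Prescribing the hermitian part makes `√z g` imaginary, hence locally constant; as `√z`
changes sign around the origin, `g = 0` (`eq_zero_of_twisted`). The same monodromy `-1` makes `b' +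
b/2z = k` solvable without a residue obstruction (`exists_twisted_primitive`), which gives
existence.

For `h_t^app` the diagonal and off-diagonal entries of the Coulomb equation decouple. The
off-diagonal entries solve a homogeneous system with zero boundary values, and a weighted energy
identity forces them to vanish (`offDiagonal_eq_zero`).

For the norms, let `ξ` be holomorphic with `2zξ' + ξ = P`, that is, the Lie derivative of `z dz²`
along `ξ ∂_z` is `P dz²`. Moving the radial profile `w = uχ` along this field suggests the diagonal
entry `-P/4z - ξ ∂w`. This ansatz is an exact solution wherever `w` solves the model equation, so
its defect lives on the annulus where `χ` varies. There `u_t` and its derivatives are exponentially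
small, by the maximum principle in `s = log r` (`exists_exp_decay`). An energy estimate carries the
smallness over to the error of the ansatz (`energy_estimate`). With the ansatz inserted, the
difference of the two densities is an exact term `∂V` without boundary contributions
(`exists_primitive`), plus a term linear in the error, which is therefore exponentially small. -/

noncomputable section

namespace HiggsDisk

/-! ### Wirtinger calculus -/

/-- The real-linear form `a dz + b dz̄`. -/
def wirtForm (a b : ℂ) : ℂ →L[ℝ] ℂ :=
  a • ContinuousLinearMap.id ℝ ℂ + b • (Complex.conjCLE : ℂ →L[ℝ] ℂ)

@[simp] lemma wirtForm_apply (a b v : ℂ) :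
    wirtForm a b v = a * v + b * (starRingEnd ℂ) v := by
  simp [wirtForm]

/-- `g` is real differentiable at `z` with `∂g = a` and `∂̄g = b`. -/
def HasWirtAt (g : ℂ → ℂ) (a b z : ℂ) : Prop := HasFDerivAt g (wirtForm a b) z

variable {f g : ℂ → ℂ} {a b c d z : ℂ}

lemma HasWirtAt.wirt (h : HasWirtAt g a b z) : wirt g z = a := by
  have h' : fderiv ℝ g z = wirtForm a b := HasFDerivAt.fderiv h
  simp only [HiggsDisk.wirt, h', wirtForm_apply, map_one, Complex.conj_I]
  linear_combination (a * (-1) / 2 + b / 2) * Complex.I_mul_I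

lemma HasWirtAt.wirtBar (h : HasWirtAt g a b z) : wirtBar g z = b := by
  have h' : fderiv ℝ g z = wirtForm a b := HasFDerivAt.fderiv h
  simp only [HiggsDisk.wirtBar, h', wirtForm_apply, map_one, Complex.conj_I]
  linear_combination (a / 2 - b / 2) * Complex.I_mul_I

lemma eq_wirtForm (L : ℂ →L[ℝ] ℂ) :
    L = wirtForm ((L 1 - Complex.I * L Complex.I) / 2) ((L 1 + Complex.I * L Complex.I) / 2) := by
  ext v
  have hv : v = v.re • (1 : ℂ) + v.im • Complex.I := by simp
  have : L v = v.re * L 1 + v.im * L Complex.I := by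
    conv_lhs => rw [hv, map_add, map_smul, map_smul]
    simp
  have hc : (starRingEnd ℂ) v = v.re - v.im * Complex.I := by
    apply Complex.ext <;> simp
  rw [this, wirtForm_apply, hc]
  conv_rhs => rw [← Complex.re_add_im v]
  simp only [Complex.add_re, Complex.ofReal_re, Complex.mul_re, Complex.I_re, mul_zero,
    Complex.ofReal_im, Complex.I_im, mul_one, sub_self, add_zero, Complex.add_im, Complex.mul_im,
    zero_add]
  linear_combination (v.im * L Complex.I) * Complex.I_mul_I

lemma _root_.DifferentiableAt.hasWirtAt (h : DifferentiableAt ℝ g z) :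
    HasWirtAt g (HiggsDisk.wirt g z) (HiggsDisk.wirtBar g z) z := by
  have := h.hasFDerivAt
  rw [eq_wirtForm (fderiv ℝ g z)] at this
  exact this

lemma HasWirtAt.differentiableAt (h : HasWirtAt g a b z) : DifferentiableAt ℝ g z :=
  HasFDerivAt.differentiableAt h

lemma hasWirtAt_const (c z : ℂ) : HasWirtAt (fun _ => c) 0 0 z := by
  have := hasFDerivAt_const (𝕜 := ℝ) c z
  refine this.congr_fderiv (ContinuousLinearMap.ext fun v => ?_)
  simp

lemma HasWirtAt.congr_coeff (h : HasWirtAt g a b z) (ha : a = c) (hb : b = d) :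
    HasWirtAt g c d z := ha ▸ hb ▸ h

lemma HasWirtAt.congr_of_eventuallyEq (h : HasWirtAt g a b z) (hfg : f =ᶠ[𝓝 z] g) :
    HasWirtAt f a b z := HasFDerivAt.congr_of_eventuallyEq h hfg

lemma HasWirtAt.add (hf : HasWirtAt f a b z) (hg : HasWirtAt g c d z) :
    HasWirtAt (fun w => f w + g w) (a + c) (b + d) z := by
  have := HasFDerivAt.add hf hg
  refine this.congr_fderiv (ContinuousLinearMap.ext fun v => ?_)
  simp
  ring

lemma HasWirtAt.neg (hf : HasWirtAt f a b z) : HasWirtAt (fun w => -f w) (-a) (-b) z := by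
  have := HasFDerivAt.neg hf
  refine this.congr_fderiv (ContinuousLinearMap.ext fun v => ?_)
  simp
  ring

lemma HasWirtAt.sub (hf : HasWirtAt f a b z) (hg : HasWirtAt g c d z) :
    HasWirtAt (fun w => f w - g w) (a - c) (b - d) z := by
  have := HasFDerivAt.sub hf hg
  refine this.congr_fderiv (ContinuousLinearMap.ext fun v => ?_)
  simp
  ring

lemma HasWirtAt.mul (hf : HasWirtAt f a b z) (hg : HasWirtAt g c d z) :
    HasWirtAt (fun w => f w * g w) (a * g z + f z * c) (b * g z + f z * d) z := by
  have := HasFDerivAt.mul hf hg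
  refine this.congr_fderiv (ContinuousLinearMap.ext fun v => ?_)
  simp
  ring

lemma HasWirtAt.const_mul (k : ℂ) (hf : HasWirtAt f a b z) :
    HasWirtAt (fun w => k * f w) (k * a) (k * b) z :=
  ((hasWirtAt_const k z).mul hf).congr_coeff (by simp) (by simp)

lemma HasWirtAt.conj (hf : HasWirtAt f a b z) :
    HasWirtAt (fun w => (starRingEnd ℂ) (f w)) ((starRingEnd ℂ) b) ((starRingEnd ℂ) a) z := by
  have := (Complex.conjCLE : ℂ →L[ℝ] ℂ).hasFDerivAt.comp z
    (show HasFDerivAt f (wirtForm a b) z from hf)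
  refine this.congr_fderiv (ContinuousLinearMap.ext fun v => ?_)
  simp
  ring

lemma _root_.HasDerivAt.hasWirtAt (hf : HasDerivAt f a z) : HasWirtAt f a 0 z := by
  have := hf.hasFDerivAt.restrictScalars ℝ
  refine this.congr_fderiv (ContinuousLinearMap.ext fun v => ?_)
  simp
  ring

lemma hasWirtAt_id (z : ℂ) : HasWirtAt (fun w => w) 1 0 z := (hasDerivAt_id z).hasWirtAt

lemma hasWirtAt_inv (hz : z ≠ 0) : HasWirtAt (fun w => w⁻¹) (-(z ^ 2)⁻¹) 0 z :=
  (hasDerivAt_inv hz).hasWirtAt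

lemma HasWirtAt.hasDerivAt (hf : HasWirtAt f a 0 z) : HasDerivAt f a z := by
  have h1 : DifferentiableAt ℂ f z := by
    rw [differentiableAt_complex_iff_differentiableAt_real]
    refine ⟨hf.differentiableAt, ?_⟩
    have h' : fderiv ℝ f z = wirtForm a 0 := HasFDerivAt.fderiv hf
    simp [h', mul_comm]
  have h2 := h1.hasDerivAt
  rwa [show deriv f z = a by rw [← h2.hasWirtAt.wirt, hf.wirt]] at h2

lemma hasDerivAt_of_wirtBar_eq_zero (hf : DifferentiableAt ℝ f z)
    (h : HiggsDisk.wirtBar f z = 0) : HasDerivAt f (HiggsDisk.wirt f z) z := by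
  have := hf.hasWirtAt
  rw [h] at this
  exact this.hasDerivAt

/-- Chain rule from `∂ log|z| = 1/(2z)` and `∂̄ log|z| = 1/(2z̄)`. All radial data below are written
as functions of `log|z|` for this reason. -/
lemma hasWirtAt_logNorm {φ : ℝ → ℝ} {φ' : ℝ} (hz : z ≠ 0)
    (h : HasDerivAt φ φ' (Real.log ‖z‖)) :
    HasWirtAt (fun w => ((φ (Real.log ‖w‖) : ℝ) : ℂ)) (φ' / (2 * z))
      (φ' / (2 * (starRingEnd ℂ) z)) z := by
  have hn : HasFDerivAt (fun w : ℂ => ‖w‖ ^ 2) (2 • innerSL ℝ z) z :=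
    (hasStrictFDerivAt_norm_sq z).hasFDerivAt
  have hz' : ‖z‖ ≠ 0 := norm_ne_zero_iff.mpr hz
  have h1 := (hn.log (pow_ne_zero 2 hz')).const_smul (1 / 2 : ℝ)
  have h2 : HasFDerivAt (fun w : ℂ => Real.log ‖w‖)
      ((1 / 2 : ℝ) • ((‖z‖ ^ 2)⁻¹ • (2 • innerSL ℝ z))) z := by
    refine h1.congr_of_eventuallyEq (Eventually.of_forall fun w => ?_)
    simp [Real.log_pow]
  have h3 := (Complex.ofRealCLM.hasFDerivAt).comp z (h.comp_hasFDerivAt z h2)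
  unfold HasWirtAt
  have h3' : HasFDerivAt (fun w => ((φ (Real.log ‖w‖) : ℝ) : ℂ)) _ z := h3
  convert h3' using 1
  ext v
  have hzz : z * (starRingEnd ℂ) z = ((‖z‖ ^ 2 : ℝ) : ℂ) := by
    rw [Complex.mul_conj, Complex.normSq_eq_norm_sq]
  have hc : (starRingEnd ℂ) z ≠ 0 := by simpa using hz
  have hin : ((inner ℝ z v : ℝ) : ℂ) = (v * (starRingEnd ℂ) z + z * (starRingEnd ℂ) v) / 2 := by
    rw [Complex.inner]
    apply Complex.ext <;> simp <;> ring
  simp only [wirtForm_apply, ContinuousLinearMap.comp_apply, smul_apply,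
    innerSL_apply_apply, Complex.ofRealCLM_apply, smul_eq_mul, nsmul_eq_mul,
    Complex.ofReal_mul, hin,
    Complex.ofReal_inv, ← hzz]
  push_cast
  field_simp
  
lemma conj_mul_self (z : ℂ) : (starRingEnd ℂ) z * z = (‖z‖ : ℂ) ^ 2 := by
  rw [mul_comm, Complex.mul_conj, Complex.normSq_eq_norm_sq]; push_cast; rfl

/-- `∂|z| = |z| / 2z` and `∂̄|z| = |z| / 2z̄`. -/
lemma hasWirtAt_norm (hz : z ≠ 0) :
    HasWirtAt (fun w => (‖w‖ : ℂ)) (‖z‖ / (2 * z)) (‖z‖ / (2 * (starRingEnd ℂ) z)) z := by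
  have hz' : 0 < ‖z‖ := norm_pos_iff.mpr hz
  have h := hasWirtAt_logNorm hz (Real.hasDerivAt_exp (Real.log ‖z‖))
  rw [Real.exp_log hz'] at h
  refine h.congr_of_eventuallyEq ?_
  filter_upwards [isOpen_ne.mem_nhds hz] with w hw
  rw [Real.exp_log (norm_pos_iff.mpr hw)]

/-! ### Stokes' theorem on the punctured disk -/

lemma ContDiffOn.wirt {g : ℂ → ℂ} {s : Set ℂ} {m n : WithTop ℕ∞} (h : ContDiffOn ℝ n g s)
    (hs : IsOpen s) (hmn : m + 1 ≤ n) : ContDiffOn ℝ m (HiggsDisk.wirt g) s := by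
  have h1 := h.fderiv_of_isOpen hs hmn
  unfold HiggsDisk.wirt
  exact ((h1.clm_apply contDiffOn_const).sub
    (contDiffOn_const.mul (h1.clm_apply contDiffOn_const))).div_const 2

lemma ContDiffOn.wirtBar {g : ℂ → ℂ} {s : Set ℂ} {m n : WithTop ℕ∞} (h : ContDiffOn ℝ n g s)
    (hs : IsOpen s) (hmn : m + 1 ≤ n) : ContDiffOn ℝ m (HiggsDisk.wirtBar g) s := by
  have h1 := h.fderiv_of_isOpen hs hmn
  unfold HiggsDisk.wirtBar
  exact ((h1.clm_apply contDiffOn_const).add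
    (contDiffOn_const.mul (h1.clm_apply contDiffOn_const))).div_const 2

lemma isOpen_disk (R : ℝ) : IsOpen (disk R) := Metric.isOpen_ball

lemma isOpen_puncturedDisk (R : ℝ) : IsOpen (puncturedDisk R) :=
  Metric.isOpen_ball.sdiff isClosed_singleton

lemma mem_disk {R : ℝ} {z : ℂ} : z ∈ disk R ↔ ‖z‖ < R := by simp [disk]

lemma mem_puncturedDisk {R : ℝ} {z : ℂ} : z ∈ puncturedDisk R ↔ ‖z‖ < R ∧ z ≠ 0 := by
  simp [puncturedDisk]

/-- Differentiation under the integral sign for jointly continuous derivatives. -/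
lemma hasDerivAt_intervalIntegral_of_continuousOn {𝕜 : Type*} [RCLike 𝕜] {E : Type*}
    [NormedAddCommGroup E] [NormedSpace ℝ E] [NormedSpace 𝕜 E]
    {F F' : 𝕜 → ℝ → E} {U : Set 𝕜} {x₀ : 𝕜} {a b : ℝ} (hab : a ≤ b)
    (hU : U ∈ 𝓝 x₀) (hF : ∀ x ∈ U, ContinuousOn (F x) (Icc a b))
    (hF' : ContinuousOn (fun p : 𝕜 × ℝ => F' p.1 p.2) (U ×ˢ Icc a b))
    (hd : ∀ x ∈ U, ∀ θ ∈ Icc a b, HasDerivAt (fun y => F y θ) (F' x θ) x) :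
    HasDerivAt (fun x => ∫ θ in a..b, F x θ) (∫ θ in a..b, F' x₀ θ) x₀ := by
  obtain ⟨ε, hε, hεU⟩ := Metric.nhds_basis_closedBall.mem_iff.mp hU
  obtain ⟨C, hC⟩ := ((isCompact_closedBall x₀ ε).prod isCompact_Icc).exists_bound_of_continuousOn
    (hF'.mono (prod_mono hεU le_rfl))
  have hsub : uIoc a b ⊆ Icc a b := by rw [uIoc_of_le hab]; exact Ioc_subset_Icc_self
  have hmeas : ∀ {G : ℝ → E}, ContinuousOn G (Icc a b) →
      AEStronglyMeasurable G (volume.restrict (uIoc a b)) := fun hG =>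
    (hG.mono hsub).aestronglyMeasurable measurableSet_uIoc
  have hx₀ : x₀ ∈ U := mem_of_mem_nhds hU
  refine (intervalIntegral.hasDerivAt_integral_of_dominated_loc_of_deriv_le
    (s := Metric.closedBall x₀ ε) (bound := fun _ => C) (Metric.closedBall_mem_nhds x₀ hε) ?_ ?_ ?_
    ?_ ?_ ?_).2
  · filter_upwards [hU] with x hx using hmeas (hF x hx)
  · exact ContinuousOn.intervalIntegrable (by rw [uIcc_of_le hab]; exact hF x₀ hx₀)
  · refine hmeas ?_
    exact hF'.comp (f := fun θ : ℝ => (x₀, θ)) (by fun_prop) fun θ hθ => ⟨hx₀, hθ⟩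
  · exact Eventually.of_forall fun θ hθ x hx => hC (x, θ) ⟨hx, hsub hθ⟩
  · exact intervalIntegrable_const
  · exact Eventually.of_forall fun θ hθ x hx => hd x (hεU hx) θ (hsub hθ)

/-- The point with polar coordinates `(r, θ)`. -/
def polarPt (r θ : ℝ) : ℂ := r * Complex.exp (θ * Complex.I)

lemma norm_polarPt (r θ : ℝ) : ‖polarPt r θ‖ = |r| := by
  simp [polarPt, Complex.norm_exp_ofReal_mul_I]

lemma continuous_polarPt : Continuous fun p : ℝ × ℝ => polarPt p.1 p.2 := by
  unfold polarPt; fun_prop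

lemma polarPt_mem_puncturedDisk {S r : ℝ} (hr : r ∈ Ioo 0 S) (θ : ℝ) :
    polarPt r θ ∈ puncturedDisk S := by
  rw [mem_puncturedDisk, ← norm_pos_iff, norm_polarPt, abs_of_pos hr.1]
  exact ⟨hr.2, hr.1⟩

/-- The flux `∮ W dz̄`, up to a factor, through the circle of radius `r`. -/
def circleFlux (W : ℂ → ℂ) (r : ℝ) : ℂ :=
  ∫ θ in (-Real.pi)..Real.pi, r * Complex.exp (-(θ * Complex.I)) * W (polarPt r θ)

lemma hasDerivAt_polarPt_left (r θ : ℝ) :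
    HasDerivAt (fun r : ℝ => polarPt r θ) (Complex.exp (θ * Complex.I)) r := by
  simpa [polarPt] using (Complex.ofRealCLM.hasDerivAt (x := r)).mul_const
    (Complex.exp (θ * Complex.I))

lemma hasDerivAt_polarPt_right (r θ : ℝ) :
    HasDerivAt (fun θ : ℝ => polarPt r θ) (Complex.I * polarPt r θ) θ := by
  have h1 : HasDerivAt (fun θ : ℝ => (θ : ℂ) * Complex.I) Complex.I θ := by
    simpa using (Complex.ofRealCLM.hasDerivAt (x := θ)).mul_const Complex.I
  refine (h1.cexp.const_mul (r : ℂ)).congr_deriv ?_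
  simp only [polarPt]; ring

lemma hasDerivAt_exp_neg_mul_I (θ : ℝ) :
    HasDerivAt (fun θ : ℝ => Complex.exp (-(θ * Complex.I)))
      (-Complex.I * Complex.exp (-(θ * Complex.I))) θ := by
  have h1 : HasDerivAt (fun θ : ℝ => -((θ : ℂ) * Complex.I)) (-Complex.I) θ := by
    have h2 : HasDerivAt (fun θ : ℝ => (θ : ℂ) * Complex.I) Complex.I θ := by
      simpa using (Complex.ofRealCLM.hasDerivAt (x := θ)).mul_const Complex.I
    exact h2.neg
  refine h1.cexp.congr_deriv ?_
  ring

lemma HasWirtAt.comp_real {g : ℂ → ℂ} {p : ℝ → ℂ} {a b p' : ℂ} {x : ℝ}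
    (hg : HasWirtAt g a b (p x)) (hp : HasDerivAt p p' x) :
    HasDerivAt (fun x => g (p x)) (a * p' + b * (starRingEnd ℂ) p') x := by
  have : HasDerivAt (fun x => g (p x)) _ x := HasFDerivAt.comp_hasDerivAt x hg hp
  simpa using this

lemma conj_exp_mul_I (θ : ℝ) : (starRingEnd ℂ) (Complex.exp (θ * Complex.I)) =
    Complex.exp (-(θ * Complex.I)) := by
  rw [← Complex.exp_conj]; simp

lemma hasDerivAt_circleFlux {W : ℂ → ℂ} {S r : ℝ} (hW : ContDiffOn ℝ 1 W (puncturedDisk S))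
    (hr : r ∈ Ioo 0 S) :
    HasDerivAt (circleFlux W)
      (2 * ∫ θ in (-Real.pi)..Real.pi, r * wirt W (polarPt r θ)) r := by
  have ho := isOpen_puncturedDisk S
  have hcW := hW.continuousOn
  have hc1 : ContinuousOn (wirt W) (puncturedDisk S) :=
    (ContDiffOn.wirt hW ho (m := 0) (by norm_num)).continuousOn
  have hc2 : ContinuousOn (wirtBar W) (puncturedDisk S) :=
    (ContDiffOn.wirtBar hW ho (m := 0) (by norm_num)).continuousOn
  have hwirt : ∀ z ∈ puncturedDisk S, HasWirtAt W (wirt W z) (wirtBar W z) z := fun z hz =>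
    ((hW.contDiffAt (ho.mem_nhds hz)).differentiableAt (by norm_num)).hasWirtAt
  -- With this `X`, the radial derivative of the integrand is `X + r ∂W`, while `X - r ∂W` is the
  -- angular derivative of `i e^{-iθ} W`. By periodicity `X` and `r ∂W` then have the same integral,
  -- which accounts for the factor `2`.
  set X : ℝ → ℝ → ℂ := fun r θ => Complex.exp (-(θ * Complex.I)) * W (polarPt r θ)
    + r * Complex.exp (-(θ * Complex.I)) * Complex.exp (-(θ * Complex.I))
      * wirtBar W (polarPt r θ) with hX
  have hmaps : MapsTo (fun p : ℝ × ℝ => polarPt p.1 p.2) (Ioo 0 S ×ˢ Icc (-Real.pi) Real.pi)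
      (puncturedDisk S) := fun p hp => polarPt_mem_puncturedDisk hp.1 p.2
  have hcP {g : ℂ → ℂ} (hg : ContinuousOn g (puncturedDisk S)) :
      ContinuousOn (fun p : ℝ × ℝ => g (polarPt p.1 p.2))
        (Ioo 0 S ×ˢ Icc (-Real.pi) Real.pi) := hg.comp continuous_polarPt.continuousOn hmaps
  have hcR {g : ℂ → ℂ} (hg : ContinuousOn g (puncturedDisk S)) {r : ℝ} (hr : r ∈ Ioo 0 S) :
      ContinuousOn (fun θ : ℝ => g (polarPt r θ)) (Icc (-Real.pi) Real.pi) :=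
    (hcP hg).comp (f := fun θ => (r, θ)) (by fun_prop) fun θ hθ => ⟨hr, hθ⟩
  have hee : ∀ θ : ℝ, Complex.exp (-(θ * Complex.I)) * Complex.exp (θ * Complex.I) = 1 :=
      fun θ => by
    rw [← Complex.exp_add]; simp
  have hpi : -Real.pi ≤ Real.pi := by linarith [Real.pi_pos]
  have h1 : HasDerivAt (circleFlux W)
      (∫ θ in (-Real.pi)..Real.pi, (X r θ + r * wirt W (polarPt r θ))) r := by
    refine hasDerivAt_intervalIntegral_of_continuousOn
      (F' := fun r θ => X r θ + r * wirt W (polarPt r θ)) hpi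
      (Ioo_mem_nhds hr.1 hr.2) ?_ ?_ ?_
    · intro x hx
      exact (Continuous.continuousOn (by fun_prop)).mul (hcR hcW hx)
    · have e1 := hcP hcW
      have e2 := hcP hc1
      have e3 := hcP hc2
      have e0 : Continuous fun p : ℝ × ℝ => Complex.exp (-(p.2 * Complex.I)) := by fun_prop
      have e4 : Continuous fun p : ℝ × ℝ => (p.1 : ℂ) := by fun_prop
      exact ((e0.continuousOn.mul e1).add (((e4.mul e0).mul e0).continuousOn.mul e3)).add
        (e4.continuousOn.mul e2)
    · intro x hx θ _
      have h1 := HasWirtAt.comp_real (p := fun r : ℝ => polarPt r θ)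
        (hwirt _ (polarPt_mem_puncturedDisk hx θ)) (hasDerivAt_polarPt_left x θ)
      have h2 := ((Complex.ofRealCLM.hasDerivAt (x := x)).mul_const
        (Complex.exp (-(θ * Complex.I)))).mul h1
      refine h2.congr_deriv ?_
      simp only [Complex.ofRealCLM_apply, Complex.ofReal_one, conj_exp_mul_I, hX]
      linear_combination (x * wirt W (polarPt x θ)) * hee θ
  have hcX : ContinuousOn (X r) (Icc (-Real.pi) Real.pi) := by
    have e0 : Continuous fun θ : ℝ => Complex.exp (-(θ * Complex.I)) := by fun_prop
    exact (e0.continuousOn.mul (hcR hcW hr)).add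
      (((continuous_const.mul e0).mul e0).continuousOn.mul (hcR hc2 hr))
  have hcw : ContinuousOn (fun θ : ℝ => r * wirt W (polarPt r θ)) (Icc (-Real.pi) Real.pi) :=
    continuousOn_const.mul (hcR hc1 hr)
  have h2 : ∫ θ in (-Real.pi)..Real.pi, (X r θ - r * wirt W (polarPt r θ)) = 0 := by
    have hd : ∀ θ ∈ uIcc (-Real.pi) Real.pi, HasDerivAt
        (fun θ : ℝ => Complex.I * Complex.exp (-(θ * Complex.I)) * W (polarPt r θ))
        (X r θ - r * wirt W (polarPt r θ)) θ := by
      intro θ _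
      have h1 := (hwirt _ (polarPt_mem_puncturedDisk hr θ)).comp_real
        (hasDerivAt_polarPt_right r θ)
      have h2 := ((hasDerivAt_exp_neg_mul_I θ).const_mul Complex.I).mul h1
      refine h2.congr_deriv ?_
      simp only [hX, map_mul, Complex.conj_I, polarPt, conj_exp_mul_I, Complex.conj_ofReal]
      linear_combination (- Complex.exp (-(θ * Complex.I)) * W (r * Complex.exp (θ * Complex.I))
        + Complex.exp (-(θ * Complex.I)) * (wirt W (r * Complex.exp (θ * Complex.I)) * r
           * Complex.exp (θ * Complex.I) - wirtBar W (r * Complex.exp (θ * Complex.I)) * r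
           * Complex.exp (-(θ * Complex.I)))) * Complex.I_mul_I
           - r * wirt W (r * Complex.exp (θ * Complex.I)) * hee θ
    rw [intervalIntegral.integral_eq_sub_of_hasDerivAt hd]
    · have : polarPt r Real.pi = polarPt r (-Real.pi) := by
        simp [polarPt, Complex.exp_neg]
      rw [this]
      simp [Complex.exp_neg]
    · refine ContinuousOn.intervalIntegrable ?_
      rw [uIcc_of_le hpi]
      exact hcX.sub hcw
  refine h1.congr_deriv ?_
  rw [← sub_zero (∫ θ in (-Real.pi)..Real.pi, (X r θ + r * wirt W (polarPt r θ))), ← h2,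
    ← intervalIntegral.integral_sub, ← intervalIntegral.integral_const_mul]
  · congr 1; ext θ; ring
  · exact ContinuousOn.intervalIntegrable (by rw [uIcc_of_le hpi]; exact hcX.add hcw)
  · exact ContinuousOn.intervalIntegrable (by rw [uIcc_of_le hpi]; exact hcX.sub hcw)

/-- Integration in polar coordinates over the disk. -/
lemma integral_disk_eq_polar {g : ℂ → ℂ} {S : ℝ} (hS : 0 < S)
    (hc : ContinuousOn g (puncturedDisk S)) (hi : IntegrableOn g (disk S)) :
    IntervalIntegrable (fun r => ∫ θ in (-Real.pi)..Real.pi, r * g (polarPt r θ)) volume 0 S ∧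
      ∫ z in disk S, g z
        = ∫ r in (0 : ℝ)..S, ∫ θ in (-Real.pi)..Real.pi, r * g (polarPt r θ) := by
  have hpi : -Real.pi ≤ Real.pi := by linarith [Real.pi_pos]
  have hsymm : ∀ p : ℝ × ℝ, Complex.polarCoord.symm p = polarPt p.1 p.2 := fun p => by
    rw [Complex.polarCoord_symm_apply, polarPt, Complex.exp_mul_I]; simp
  set T : Set (ℝ × ℝ) := Ioo 0 S ×ˢ Ioo (-Real.pi) Real.pi with hT
  have hTm : MeasurableSet T := measurableSet_Ioo.prod measurableSet_Ioo
  have htarget : ∀ p ∈ polarCoord.target, (polarPt p.1 p.2 ∈ disk S ↔ p ∈ T) := by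
    rintro ⟨r, θ⟩ ⟨hr, hθ⟩
    simp only [mem_Ioi] at hr
    simp only [mem_disk, norm_polarPt, hT, mem_prod, mem_Ioo, abs_of_pos hr]
    exact ⟨fun h => ⟨⟨hr, h⟩, hθ⟩, fun h => h.1.2⟩
  have hTt : T ⊆ polarCoord.target := fun p hp => ⟨hp.1.1, hp.2⟩
  have hmeas : AEStronglyMeasurable (fun p : ℝ × ℝ => (p.1 : ℂ) * g (polarPt p.1 p.2))
      (volume.restrict T) := by
    refine ContinuousOn.aestronglyMeasurable ?_ hTm
    have : ContinuousOn (fun p : ℝ × ℝ => g (polarPt p.1 p.2)) T :=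
      hc.comp continuous_polarPt.continuousOn fun p hp => polarPt_mem_puncturedDisk hp.1 p.2
    exact (Continuous.continuousOn (by fun_prop)).mul this
  have htm : MeasurableSet polarCoord.target := polarCoord.open_target.measurableSet
  have hint : IntegrableOn (fun p : ℝ × ℝ => (p.1 : ℂ) * g (polarPt p.1 p.2)) T := by
    refine ⟨hmeas, ?_⟩
    have h1 := hi.2
    rw [hasFiniteIntegral_iff_enorm] at h1 ⊢
    rw [← lintegral_indicator (isOpen_disk S).measurableSet,
      ← Complex.lintegral_comp_polarCoord_symm, ← lintegral_indicator htm] at h1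
    rw [← lintegral_indicator hTm]
    refine lt_of_le_of_lt (le_of_eq ?_) h1
    congr 1
    ext p
    by_cases hp : p ∈ T
    · have hp' := hTt hp
      rw [indicator_of_mem hp, indicator_of_mem hp', hsymm,
        indicator_of_mem ((htarget p hp').2 hp), enorm_mul, smul_eq_mul]
      congr 1
      rw [← ofReal_norm, Complex.norm_real, Real.norm_of_nonneg (le_of_lt hp.1.1)]
    · rw [indicator_of_notMem hp]
      by_cases hp' : p ∈ polarCoord.target
      · rw [indicator_of_mem hp', hsymm, indicator_of_notMem (mt (htarget p hp').1 hp)]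
        simp
      · rw [indicator_of_notMem hp']
  have hsplit : ∀ r : ℝ, ∫ θ in (-Real.pi)..Real.pi, (r : ℂ) * g (polarPt r θ)
      = ∫ θ in Ioo (-Real.pi) Real.pi, (r : ℂ) * g (polarPt r θ) := fun r => by
    rw [intervalIntegral.integral_of_le hpi, integral_Ioc_eq_integral_Ioo]
  constructor
  · rw [intervalIntegrable_iff_integrableOn_Ioo_of_le hS.le]
    simp_rw [hsplit]
    have : Integrable (fun p : ℝ × ℝ => (p.1 : ℂ) * g (polarPt p.1 p.2))
        ((volume.restrict (Ioo 0 S)).prod (volume.restrict (Ioo (-Real.pi) Real.pi))) := by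
      rw [Measure.prod_restrict]; exact hint
    exact this.integral_prod_left
  · rw [intervalIntegral.integral_of_le hS.le, integral_Ioc_eq_integral_Ioo]
    simp_rw [hsplit]
    rw [← setIntegral_prod (fun p : ℝ × ℝ => (p.1 : ℂ) * g (polarPt p.1 p.2)) hint,
      ← integral_indicator (isOpen_disk S).measurableSet, ← Complex.integral_comp_polarCoord_symm,
      ← integral_indicator htm, ← Measure.volume_eq_prod, ← integral_indicator hTm]
    congr 1
    ext p
    by_cases hp : p ∈ T
    · have hp' := hTt hp
      rw [indicator_of_mem hp, indicator_of_mem hp', hsymm,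
        indicator_of_mem ((htarget p hp').2 hp), Complex.real_smul]
    · rw [indicator_of_notMem hp]
      by_cases hp' : p ∈ polarCoord.target
      · rw [indicator_of_mem hp', hsymm, indicator_of_notMem (mt (htarget p hp').1 hp)]
        simp
      · rw [indicator_of_notMem hp']

/-- Stokes' theorem for `∂W` on a punctured disk, with limiting fluxes at both ends. -/
theorem integral_disk_wirt {W : ℂ → ℂ} {S : ℝ} {m₀ m₁ : ℂ} (hS : 0 < S)
    (hW : ContDiffOn ℝ 1 W (puncturedDisk S)) (hi : IntegrableOn (wirt W) (disk S))
    (h₀ : Tendsto (circleFlux W) (𝓝[>] 0) (𝓝 m₀)) (h₁ : Tendsto (circleFlux W) (𝓝[<] S) (𝓝 m₁)) :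
    ∫ z in disk S, wirt W z = (m₁ - m₀) / 2 := by
  have hc1 : ContinuousOn (wirt W) (puncturedDisk S) :=
    (ContDiffOn.wirt hW (isOpen_puncturedDisk S) (m := 0) (by norm_num)).continuousOn
  obtain ⟨h2, h3⟩ := integral_disk_eq_polar hS hc1 hi
  have := intervalIntegral.integral_eq_sub_of_hasDerivAt_of_tendsto hS
    (fun r hr => hasDerivAt_circleFlux hW hr) (h2.const_mul 2) h₀ h₁
  rw [intervalIntegral.integral_const_mul] at this
  rw [h3, ← this]; ring

lemma norm_circleFlux_le {W : ℂ → ℂ} {r C : ℝ} (hr : 0 ≤ r) (hC : ∀ z, ‖z‖ = r → ‖W z‖ ≤ C) :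
    ‖circleFlux W r‖ ≤ 2 * Real.pi * (r * C) := by
  have := intervalIntegral.norm_integral_le_of_norm_le_const (a := -Real.pi) (b := Real.pi)
    (C := r * C) (f := fun θ : ℝ => r * Complex.exp (-(θ * Complex.I)) * W (polarPt r θ)) ?_
  · refine this.trans (le_of_eq ?_)
    rw [abs_of_pos (by linarith [Real.pi_pos])]; ring
  · intro θ _
    rw [norm_mul, norm_mul, Complex.norm_real, Real.norm_of_nonneg hr]
    have : ‖Complex.exp (-(θ * Complex.I))‖ = 1 := by
      rw [← conj_exp_mul_I, RCLike.norm_conj, Complex.norm_exp_ofReal_mul_I]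
    rw [this, mul_one]
    exact mul_le_mul_of_nonneg_left (hC _ (by rw [norm_polarPt, abs_of_nonneg hr])) hr

/-! ### The inhomogeneous Cauchy-Riemann equation -/

/-- The Jacobian factor `r` of polar coordinates cancels the singularity. -/
lemma integrableOn_norm_inv (S : ℝ) : IntegrableOn (fun z : ℂ => ‖z‖⁻¹) (disk S) := by
  have h := (integrableOn_fun_norm_addHaar (volume : Measure ℂ) (f := fun r : ℝ => r⁻¹)
    (r := S))
  refine h.2 ?_
  rw [Complex.finrank_real_complex]
  have : IntegrableOn (fun _ : ℝ => (1 : ℝ)) (Ioo 0 S) := by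
    simp
  refine this.congr_fun (fun r hr => ?_) measurableSet_Ioo
  have : r ≠ 0 := hr.1.ne'
  simp [this]

lemma continuousOn_inv_puncturedDisk (S : ℝ) :
    ContinuousOn (fun z : ℂ => z⁻¹) (puncturedDisk S) :=
  continuousOn_inv₀.mono fun _ hz => (mem_puncturedDisk.mp hz).2

lemma disk_ae_eq_puncturedDisk (S : ℝ) : (puncturedDisk S : Set ℂ) =ᵐ[volume] disk S :=
  sdiff_null_ae_eq_self (by simp)

/-- A function that is continuous off the origin and `O(1/|z|)` is integrable on the disk. -/
lemma integrableOn_disk_of_bound {E : Type*} [NormedAddCommGroup E]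
    {g : ℂ → E} {S C : ℝ} (hg : ContinuousOn g (puncturedDisk S))
    (hC : ∀ z ∈ puncturedDisk S, ‖g z‖ ≤ C * ‖z‖⁻¹) : IntegrableOn g (disk S) := by
  rw [← integrableOn_congr_set_ae (disk_ae_eq_puncturedDisk S)]
  refine Integrable.mono' (g := fun z => C * ‖z‖⁻¹) ?_
    (hg.aestronglyMeasurable (isOpen_puncturedDisk S).measurableSet) ?_
  · exact IntegrableOn.mono_set ((integrableOn_norm_inv S).const_mul C) sdiff_subset
  · exact (ae_restrict_iff' (isOpen_puncturedDisk S).measurableSet).2 (Eventually.of_forall hC)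

lemma continuous_wirtBar {g : ℂ → ℂ} (hg : ContDiff ℝ 1 g) : Continuous (wirtBar g) := by
  have := ContDiffOn.wirtBar (m := 0) hg.contDiffOn isOpen_univ (by norm_num)
  exact continuousOn_univ.mp this.continuousOn

lemma _root_.HasCompactSupport.wirtBar {g : ℂ → ℂ} (hg : HasCompactSupport g) :
    HasCompactSupport (HiggsDisk.wirtBar g) := by
  refine (hg.fderiv ℝ).mono fun z hz => ?_
  contrapose! hz
  have : fderiv ℝ g z = 0 := by simpa using hz
  simp [HiggsDisk.wirtBar, this]

/-- The Cauchy-Pompeiu formula for functions of compact support. -/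
lemma integral_wirtBar_div {g : ℂ → ℂ} (hg : ContDiff ℝ 1 g) (hc : HasCompactSupport g) :
    ∫ z, z⁻¹ * wirtBar g z = -(Real.pi * g 0) := by
  obtain ⟨S₀, hS₀⟩ := hc.isCompact.isBounded.subset_ball 0
  set S := max S₀ 0 + 1 with hS
  have hSpos : 0 < S := by positivity
  have hzero : ∀ z : ℂ, S₀ ≤ ‖z‖ → g z = 0 := fun z hz => by
    by_contra h
    have := hS₀ (subset_tsupport g h)
    rw [mem_ball_zero_iff] at this
    linarith
  have hzero' : ∀ z : ℂ, S ≤ ‖z‖ → wirtBar g z = 0 := fun z hz => by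
    have hz' : z ∉ tsupport g := fun h => by
      have := hS₀ h
      rw [mem_ball_zero_iff] at this
      have := le_max_left S₀ 0
      linarith
    have : fderiv ℝ g z = 0 := by
      by_contra h
      exact hz' (support_fderiv_subset ℝ h)
    simp [wirtBar, this]
  -- Stokes' theorem is available for `∂`; conjugating turns `∂̄` of `g/z` into `∂W`.
  set W : ℂ → ℂ := fun z => (starRingEnd ℂ) (z⁻¹ * g z) with hW
  have hWw : ∀ z ∈ puncturedDisk S, wirt W z = (starRingEnd ℂ) (z⁻¹ * wirtBar g z) := fun z hz => by
    have h1 := ((hasWirtAt_inv (mem_puncturedDisk.mp hz).2).mul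
      ((hg.differentiable (by norm_num)) z).hasWirtAt).conj
    rw [hW, h1.wirt]; simp
  have hWc : ContDiffOn ℝ 1 W (puncturedDisk S) := by
    refine (Complex.conjCLE.contDiff).comp_contDiffOn ?_
    refine ContDiffOn.mul ?_ hg.contDiffOn
    exact contDiffOn_id.inv fun z hz => (mem_puncturedDisk.mp hz).2
  obtain ⟨C, hC⟩ :=
    (HasCompactSupport.wirtBar hc).exists_bound_of_continuous (continuous_wirtBar hg)
  have hint : IntegrableOn (wirt W) (disk S) := by
    refine integrableOn_disk_of_bound (C := C)
      (ContDiffOn.wirt hWc (isOpen_puncturedDisk S) (m := 0) (by norm_num)).continuousOn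
      fun z hz => ?_
    rw [hWw z hz, RCLike.norm_conj, norm_mul, norm_inv, mul_comm]
    exact mul_le_mul_of_nonneg_right (hC z) (by positivity)
  -- On the circle `z̄ = r e^{-iθ}`, so the pole cancels and the flux becomes a circle integral of
  -- `ḡ`, which tends to `2π` times the conjugate of `g 0`.
  have hflux : ∀ r : ℝ, r ≠ 0 → circleFlux W r
      = ∫ θ in (-Real.pi)..Real.pi, (starRingEnd ℂ) (g (polarPt r θ)) := fun r hr => by
    unfold circleFlux
    congr 1
    ext θ
    have h1 : (starRingEnd ℂ) (polarPt r θ) = r * Complex.exp (-(θ * Complex.I)) := by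
      rw [polarPt, map_mul, conj_exp_mul_I, Complex.conj_ofReal]
    have h2 : (r : ℂ) * Complex.exp (-(θ * Complex.I)) ≠ 0 :=
      mul_ne_zero (by exact_mod_cast hr) (Complex.exp_ne_zero _)
    simp only [hW, map_mul, map_inv₀, h1]
    rw [mul_inv_cancel_left₀ h2]
  have h₁ : Tendsto (circleFlux W) (𝓝[<] S) (𝓝 0) := by
    refine tendsto_const_nhds.congr' ?_
    have : max S₀ 0 < S := by rw [hS]; linarith
    filter_upwards [Ioo_mem_nhdsLT this] with r hr
    have hr0 : 0 < r := lt_of_le_of_lt (le_max_right _ _) hr.1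
    rw [hflux r hr0.ne']
    have : ∀ θ, g (polarPt r θ) = 0 := fun θ => hzero _ (by
      rw [norm_polarPt, abs_of_pos hr0]
      exact (le_max_left _ _).trans hr.1.le)
    simp [this]
  have h₀ : Tendsto (circleFlux W) (𝓝[>] 0) (𝓝 (2 * Real.pi * (starRingEnd ℂ) (g 0))) := by
    have hcont : Continuous fun r : ℝ =>
        ∫ θ in (-Real.pi)..Real.pi, (starRingEnd ℂ) (g (polarPt r θ)) := by
      refine intervalIntegral.continuous_parametric_intervalIntegral_of_continuous' ?_ _ _
      exact Complex.continuous_conj.comp (hg.continuous.comp continuous_polarPt)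
    have h := (hcont.tendsto 0).mono_left (nhdsWithin_le_nhds (s := Ioi 0))
    have h0 : ∫ θ in (-Real.pi)..Real.pi, (starRingEnd ℂ) (g (polarPt 0 θ))
        = 2 * Real.pi * (starRingEnd ℂ) (g 0) := by
      simp only [polarPt, Complex.ofReal_zero, zero_mul, intervalIntegral.integral_const]
      rw [Complex.real_smul]; push_cast; ring
    rw [h0] at h
    refine h.congr' ?_
    filter_upwards [self_mem_nhdsWithin] with r hr
    exact (hflux r (ne_of_gt hr)).symm
  have key := integral_disk_wirt hSpos hWc hint h₀ h₁
  rw [← setIntegral_congr_set (disk_ae_eq_puncturedDisk S),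
    setIntegral_congr_fun (isOpen_puncturedDisk S).measurableSet hWw, integral_conj,
    setIntegral_congr_set (disk_ae_eq_puncturedDisk S),
    setIntegral_eq_integral_of_forall_compl_eq_zero] at key
  · have := congrArg (starRingEnd ℂ) key
    rw [Complex.conj_conj] at this
    rw [this, show (0 - 2 * (Real.pi : ℂ) * (starRingEnd ℂ) (g 0)) / 2
      = -(Real.pi * (starRingEnd ℂ) (g 0)) by ring]
    simp
  · intro z hz
    rw [mem_disk, not_lt] at hz
    simp [hzero' z hz]

/-- Convolution with the fundamental solution `1/(πz)`: derivatives can be placed on `g`, and the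
Cauchy-Pompeiu formula evaluates the resulting integral. -/
theorem exists_wirtBar_eq_of_hasCompactSupport {g : ℂ → ℂ} (hg : ContDiff ℝ ∞ g)
    (hc : HasCompactSupport g) : ∃ c : ℂ → ℂ, ContDiff ℝ ∞ c ∧ ∀ z, wirtBar c z = g z := by
  have hg1 : ContDiff ℝ 1 g := hg.of_le (by exact_mod_cast le_top)
  set K : ℂ → ℂ := fun z => z⁻¹ with hK
  have hKi : LocallyIntegrable K := by
    rw [locallyIntegrable_iff]
    intro k hk
    obtain ⟨S, hS⟩ := hk.isBounded.subset_ball 0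
    refine IntegrableOn.mono_set ?_ hS
    exact integrableOn_disk_of_bound (C := 1) (continuousOn_inv_puncturedDisk S)
      fun z _ => by simp [hK]
  set L := ContinuousLinearMap.mul ℝ ℂ with hL
  set c₀ := convolution K g L volume with hc₀
  have hc₀s : ContDiff ℝ ∞ c₀ := hc.contDiff_convolution_right L hKi hg
  have hc₀d : ∀ z, wirtBar c₀ z = Real.pi * g z := by
    intro z
    have h1 := hc.hasFDerivAt_convolution_right L hKi hg1 z
    have hcf : Continuous (fderiv ℝ g) := hg1.continuous_fderiv (by norm_num)
    have h2 : ∀ v : ℂ, fderiv ℝ c₀ z v = ∫ t, K t * fderiv ℝ g (z - t) v := fun v => by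
      rw [h1.fderiv, convolution_precompR_apply L hKi (hc.fderiv ℝ) hcf, convolution_def]
      simp [hL]
    have hint : ∀ v : ℂ, Integrable fun t => K t * fderiv ℝ g (z - t) v := fun v => by
      have hcs : HasCompactSupport fun a => fderiv ℝ g a v := by
        refine (hc.fderiv ℝ).mono fun a ha => ?_
        contrapose! ha
        have : fderiv ℝ g a = 0 := by simpa using ha
        simp [this]
      have := hcs.convolutionExists_right L hKi (hcf.clm_apply continuous_const) z
      simpa [ConvolutionExistsAt, hL] using this
    have h3 : wirtBar c₀ z = ∫ t, K t * wirtBar g (z - t) := by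
      rw [wirtBar, h2, h2, ← integral_const_mul, ← integral_add (hint 1) ((hint _).const_mul _),
        ← integral_div]
      congr 1
      ext t
      simp only [wirtBar]; ring
    have h4 : ∀ t, wirtBar (fun t => g (z - t)) t = - wirtBar g (z - t) := fun t => by
      have h := ((hg1.differentiable (by norm_num)) (z - t)).hasFDerivAt.comp t
        ((hasFDerivAt_id t).const_sub z)
      have h' : fderiv ℝ (fun t => g (z - t)) t = _ := h.fderiv
      simp only [wirtBar, h']
      simp; ring
    have h5 := integral_wirtBar_div (g := fun t => g (z - t))
      (hg1.comp (contDiff_const.sub contDiff_id))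
      (hc.comp_homeomorph (Homeomorph.subLeft z))
    simp only [h4, mul_neg, integral_neg, sub_zero, neg_inj] at h5
    rw [h3, h5]
  refine ⟨fun z => (Real.pi : ℂ)⁻¹ * c₀ z, contDiff_const.mul hc₀s, fun z => ?_⟩
  have h := ((hc₀s.differentiable (by simp)) z).hasWirtAt.const_mul (Real.pi : ℂ)⁻¹
  rw [h.wirtBar, hc₀d]
  have : (Real.pi : ℂ) ≠ 0 := by exact_mod_cast Real.pi_ne_zero
  field_simp

theorem exists_wirtBar_eq_on_disk {g : ℂ → ℂ} {R ρ : ℝ} (hR : 0 < R) (hRρ : R < ρ)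
    (hg : ContDiffOn ℝ ∞ g (disk ρ)) :
    ∃ c : ℂ → ℂ, ContDiff ℝ ∞ c ∧ ∀ z ∈ disk R, wirtBar c z = g z := by
  -- The bump is `1` on the closed disk of radius `R` and has closed support inside the domain of
  -- `g`; this is where the gap `R < ρ` is needed.
  let ψ : ContDiffBump (0 : ℂ) := ⟨R, (R + ρ) / 2, hR, by linarith⟩
  have hsupp : tsupport ψ ⊆ disk ρ := by
    rw [ψ.tsupport_eq]
    exact Metric.closedBall_subset_ball (by change (R + ρ) / 2 < ρ; linarith)
  set G : ℂ → ℂ := fun z => (ψ z : ℂ) * g z with hG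
  have hts : tsupport G ⊆ tsupport ψ := by
    refine closure_mono fun z hz => ?_
    contrapose! hz
    have : ψ z = 0 := by simpa using hz
    simp [hG, this]
  have hψ : ContDiff ℝ ∞ fun z => (ψ z : ℂ) := Complex.ofRealCLM.contDiff.comp ψ.contDiff
  have hGs : ContDiff ℝ ∞ G := by
    rw [contDiff_iff_contDiffAt]
    intro z
    by_cases hz : z ∈ disk ρ
    · exact hψ.contDiffAt.mul (hg.contDiffAt ((isOpen_disk ρ).mem_nhds hz))
    · have hz' : z ∉ tsupport G := fun h => hz (hsupp (hts h))
      have : G =ᶠ[𝓝 z] fun _ => 0 := notMem_tsupport_iff_eventuallyEq.mp hz'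
      exact contDiffAt_const.congr_of_eventuallyEq this
  have hGc : HasCompactSupport G := ψ.hasCompactSupport.mono' (subset_closure.trans hts)
  obtain ⟨c, hc, hcd⟩ := exists_wirtBar_eq_of_hasCompactSupport hGs hGc
  refine ⟨c, hc, fun z hz => ?_⟩
  rw [hcd, hG]
  have : ψ z = 1 := ψ.one_of_mem_closedBall (by
    rw [mem_closedBall_zero_iff]; exact (mem_disk.mp hz).le)
  simp [this]

/-! ### Two first order equations with regular singularity -/

lemma _root_.DifferentiableOn.hasDerivAt_of_isOpen {g : ℂ → ℂ} {s : Set ℂ}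
    (hg : DifferentiableOn ℂ g s) (hs : IsOpen s) {z : ℂ} (hz : z ∈ s) :
    HasDerivAt g (deriv g z) z :=
  (hg.differentiableAt (hs.mem_nhds hz)).hasDerivAt

/-- The equation `2zξ' + ξ = P` has a holomorphic solution on a disk. -/
theorem exists_euler_solution {P : ℂ → ℂ} {ρ : ℝ} (hP : DifferentiableOn ℂ P (disk ρ)) :
    ∃ ξ : ℂ → ℂ, DifferentiableOn ℂ ξ (disk ρ) ∧
      ∀ z ∈ disk ρ, 2 * z * deriv ξ z + ξ z = P z := by
  have ho := isOpen_disk ρ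
  have hmem : ∀ z ∈ disk ρ, ∀ τ ∈ Icc (0 : ℝ) 1, (τ : ℂ) ^ 2 * z ∈ disk ρ := by
    intro z hz τ hτ
    rw [mem_disk] at hz ⊢
    rw [norm_mul, norm_pow, Complex.norm_real, Real.norm_of_nonneg hτ.1]
    have : τ ^ 2 ≤ 1 := pow_le_one₀ hτ.1 hτ.2
    nlinarith [norm_nonneg z]
  have hPc := hP.continuousOn
  have hP'c : ContinuousOn (deriv P) (disk ρ) := (hP.deriv ho).continuousOn
  have hFc : ∀ z ∈ disk ρ, ContinuousOn (fun τ : ℝ => P ((τ : ℂ) ^ 2 * z)) (Icc 0 1) :=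
    fun z hz => hPc.comp (Continuous.continuousOn (by fun_prop)) fun τ hτ => hmem z hz τ hτ
  have hF'c : ContinuousOn (fun p : ℂ × ℝ => (p.2 : ℂ) ^ 2 * deriv P ((p.2 : ℂ) ^ 2 * p.1))
      (disk ρ ×ˢ Icc 0 1) := by
    refine (Continuous.continuousOn (by fun_prop)).mul
      (hP'c.comp (Continuous.continuousOn (by fun_prop)) ?_)
    exact fun p hp => hmem p.1 hp.1 p.2 hp.2
  have hd : ∀ z ∈ disk ρ, HasDerivAt (fun z => ∫ τ in (0 : ℝ)..1, P ((τ : ℂ) ^ 2 * z))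
      (∫ τ in (0 : ℝ)..1, (τ : ℂ) ^ 2 * deriv P ((τ : ℂ) ^ 2 * z)) z := by
    intro z hz
    refine hasDerivAt_intervalIntegral_of_continuousOn
      (F := fun z τ => P ((τ : ℂ) ^ 2 * z))
      (F' := fun z τ => (τ : ℂ) ^ 2 * deriv P ((τ : ℂ) ^ 2 * z)) zero_le_one
      (ho.mem_nhds hz) hFc hF'c ?_
    intro x hx τ hτ
    have h1 := hP.hasDerivAt_of_isOpen ho (hmem x hx τ hτ)
    have h2 : HasDerivAt (fun y : ℂ => (τ : ℂ) ^ 2 * y) ((τ : ℂ) ^ 2) x := by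
      simpa using (hasDerivAt_id x).const_mul ((τ : ℂ) ^ 2)
    exact (h1.comp x h2).congr_deriv (by ring)
  -- On power series the equation divides the coefficient of `z^n` by `2n + 1`, which is what `∫
  -- τ^{2n} dτ` does. It holds because `P(τ²z) + 2zτ²P'(τ²z)` is the `τ`-derivative of `τ P(τ²z)`.
  refine ⟨fun z => ∫ τ in (0 : ℝ)..1, P ((τ : ℂ) ^ 2 * z),
    fun z hz => (hd z hz).differentiableAt.differentiableWithinAt, fun z hz => ?_⟩
  have hF'z : ContinuousOn (fun τ : ℝ => (τ : ℂ) ^ 2 * deriv P ((τ : ℂ) ^ 2 * z)) (Icc 0 1) :=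
    hF'c.comp (f := fun τ : ℝ => (z, τ)) (by fun_prop) fun τ hτ => ⟨hz, hτ⟩
  have hi1 : IntervalIntegrable (fun τ : ℝ => P ((τ : ℂ) ^ 2 * z)) volume 0 1 :=
    ContinuousOn.intervalIntegrable (by rw [uIcc_of_le zero_le_one]; exact hFc z hz)
  have hi2 : IntervalIntegrable (fun τ : ℝ => (τ : ℂ) ^ 2 * deriv P ((τ : ℂ) ^ 2 * z)) volume 0 1 :=
    ContinuousOn.intervalIntegrable (by rw [uIcc_of_le zero_le_one]; exact hF'z)
  rw [(hd z hz).deriv, ← intervalIntegral.integral_const_mul,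
    ← intervalIntegral.integral_add (hi2.const_mul _) hi1,
    intervalIntegral.integral_eq_sub_of_hasDerivAt (f := fun τ : ℝ => (τ : ℂ) * P ((τ : ℂ) ^ 2 * z))
      _ ((hi2.const_mul _).add hi1)]
  · simp
  · intro τ hτ
    rw [uIcc_of_le zero_le_one] at hτ
    have h1 := hP.hasDerivAt_of_isOpen ho (hmem z hz τ hτ)
    have h0 : HasDerivAt (fun τ : ℝ => (τ : ℂ)) 1 τ := by
      exact Complex.ofRealCLM.hasDerivAt.congr_deriv (by simp)
    have h2 := (h0.pow 2).mul_const z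
    have h3 := h0.mul (HasDerivAt.comp τ h1 h2)
    refine h3.congr_deriv ?_
    simp
    ring

lemma hasDerivAt_exp_const_mul (c : ℂ) (θ : ℝ) :
    HasDerivAt (fun θ : ℝ => Complex.exp (c * θ)) (c * Complex.exp (c * θ)) θ := by
  have h0 : HasDerivAt (fun θ : ℝ => c * (θ : ℂ)) c θ := by
    simpa using (Complex.ofRealCLM.hasDerivAt (x := θ)).const_mul c
  exact h0.cexp.congr_deriv (by ring)

lemma mul_exp_mem_puncturedDisk {R : ℝ} {z : ℂ} (hz : z ∈ puncturedDisk R) (θ : ℝ) :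
    z * Complex.exp (Complex.I * θ) ∈ puncturedDisk R := by
  rw [mem_puncturedDisk] at hz ⊢
  refine ⟨?_, mul_ne_zero hz.2 (Complex.exp_ne_zero _)⟩
  rw [norm_mul, mul_comm Complex.I, Complex.norm_exp_ofReal_mul_I, mul_one]
  exact hz.1

lemma hasDerivAt_comp_mul_exp {g : ℂ → ℂ} {R : ℝ} (hg : DifferentiableOn ℂ g (puncturedDisk R))
    {z : ℂ} (hz : z ∈ puncturedDisk R) (θ : ℝ) :
    HasDerivAt (fun θ : ℝ => g (z * Complex.exp (Complex.I * θ)))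
      (deriv g (z * Complex.exp (Complex.I * θ)) *
        (z * (Complex.I * Complex.exp (Complex.I * θ)))) θ :=
  HasDerivAt.comp θ (hg.hasDerivAt_of_isOpen (isOpen_puncturedDisk R)
    (mul_exp_mem_puncturedDisk hz θ)) ((hasDerivAt_exp_const_mul Complex.I θ).const_mul z)

/-- The equation `b' + b / 2z = k` has a holomorphic solution on a punctured disk, because its
monodromy is `-1`. -/
theorem exists_twisted_primitive {k : ℂ → ℂ} {R : ℝ} (hk : DifferentiableOn ℂ k (puncturedDisk R)) :
    ∃ b : ℂ → ℂ, DifferentiableOn ℂ b (puncturedDisk R) ∧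
      ∀ z ∈ puncturedDisk R, deriv b z + b z / (2 * z) = k z := by
  have ho := isOpen_puncturedDisk R
  have hpi : (0 : ℝ) ≤ 2 * Real.pi := by positivity
  have hkc := hk.continuousOn
  have hk'c : ContinuousOn (deriv k) (puncturedDisk R) := (hk.deriv ho).continuousOn
  -- The equation says that `√z b` is a primitive of `√z k`. The integral of `√ζ k dζ` once around
  -- the circle, starting at `z`, has `z`-derivative end value minus start value, which is `-2√z k`
  -- by the sign change of the root. Writing `ζ = z e^{iθ}` produces the phase `e^{3iθ/2}` and the
  -- factor `-(i/2) z`.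
  set ε : ℝ → ℂ := fun θ => Complex.exp (3 / 2 * Complex.I * θ) with hε
  have hεc : Continuous ε := by rw [hε]; fun_prop
  set e : ℝ → ℂ := fun θ => Complex.exp (Complex.I * θ) with he
  have hec : Continuous e := by rw [he]; fun_prop
  have hmem : ∀ z ∈ puncturedDisk R, ∀ θ, z * e θ ∈ puncturedDisk R := fun z hz θ =>
    mul_exp_mem_puncturedDisk hz θ
  have hFc : ∀ z ∈ puncturedDisk R, ContinuousOn (fun θ => ε θ * k (z * e θ))
      (Icc 0 (2 * Real.pi)) := fun z hz => hεc.continuousOn.mul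
    (hkc.comp (Continuous.continuousOn (by fun_prop)) fun θ _ => hmem z hz θ)
  have hF'c : ContinuousOn (fun p : ℂ × ℝ => ε p.2 * (deriv k (p.1 * e p.2) * e p.2))
      (puncturedDisk R ×ˢ Icc 0 (2 * Real.pi)) := by
    refine (Continuous.continuousOn (by fun_prop)).mul
      ((hk'c.comp (Continuous.continuousOn (by fun_prop)) ?_).mul
        (Continuous.continuousOn (by fun_prop)))
    exact fun p hp => hmem p.1 hp.1 p.2
  set J : ℂ → ℂ := fun z => ∫ θ in (0 : ℝ)..(2 * Real.pi), ε θ * k (z * e θ) with hJ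
  have hd : ∀ z ∈ puncturedDisk R, HasDerivAt J
      (∫ θ in (0 : ℝ)..(2 * Real.pi), ε θ * (deriv k (z * e θ) * e θ)) z := by
    intro z hz
    refine hasDerivAt_intervalIntegral_of_continuousOn
      (F := fun z θ => ε θ * k (z * e θ))
      (F' := fun z θ => ε θ * (deriv k (z * e θ) * e θ)) hpi
      (ho.mem_nhds hz) hFc hF'c ?_
    intro x hx θ _
    have h1 := hk.hasDerivAt_of_isOpen ho (hmem x hx θ)
    have h2 : HasDerivAt (fun y : ℂ => y * e θ) (e θ) x := by
      simpa using (hasDerivAt_id x).mul_const (e θ)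
    exact (h1.comp x h2).const_mul (ε θ)
  have hbd : ∀ z ∈ puncturedDisk R, HasDerivAt (fun z => -(Complex.I / 2) * (z * J z))
      (-(Complex.I / 2) * (1 * J z +
        z * ∫ θ in (0 : ℝ)..(2 * Real.pi), ε θ * (deriv k (z * e θ) * e θ))) z :=
    fun z hz => ((hasDerivAt_id z).mul (hd z hz)).const_mul _
  refine ⟨fun z => -(Complex.I / 2) * (z * J z),
    fun z hz => (hbd z hz).differentiableAt.differentiableWithinAt, fun z hz => ?_⟩
  have hz0 := (mem_puncturedDisk.mp hz).2
  have hF'z : ContinuousOn (fun θ : ℝ => ε θ * (deriv k (z * e θ) * e θ))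
      (Icc 0 (2 * Real.pi)) :=
    hF'c.comp (f := fun θ : ℝ => (z, θ)) (by fun_prop) fun τ hτ => ⟨hz, hτ⟩
  have hi1 : IntervalIntegrable (fun θ : ℝ => ε θ * k (z * e θ)) volume 0 (2 * Real.pi) :=
    ContinuousOn.intervalIntegrable (by rw [uIcc_of_le hpi]; exact hFc z hz)
  have hi2 : IntervalIntegrable (fun θ : ℝ => ε θ * (deriv k (z * e θ) * e θ)) volume 0
      (2 * Real.pi) :=
    ContinuousOn.intervalIntegrable (by rw [uIcc_of_le hpi]; exact hF'z)
  have hFTC : ∫ θ in (0 : ℝ)..(2 * Real.pi), (3 / 2 * Complex.I * (ε θ * k (z * e θ))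
      + z * Complex.I * (ε θ * (deriv k (z * e θ) * e θ))) = -2 * k z := by
    rw [intervalIntegral.integral_eq_sub_of_hasDerivAt (f := fun θ : ℝ => ε θ * k (z * e θ))
      _ ((hi1.const_mul _).add (hi2.const_mul _))]
    · have h1 : e (2 * Real.pi) = 1 := by
        simp only [he]
        rw [← Complex.exp_two_pi_mul_I]; push_cast; ring_nf
      have h2 : ε (2 * Real.pi) = -1 := by
        simp only [hε]
        rw [← Complex.exp_pi_mul_I, show (3 / 2 * Complex.I * ((2 * Real.pi : ℝ) : ℂ))
          = Real.pi * Complex.I + 2 * Real.pi * Complex.I by push_cast; ring,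
          Complex.exp_add, Complex.exp_two_pi_mul_I, mul_one]
      have h3 : e 0 = 1 := by simp [he]
      have h4 : ε 0 = 1 := by simp [hε]
      rw [h1, h2, h3, h4, mul_one]; ring
    · intro θ _
      exact ((hasDerivAt_exp_const_mul (3 / 2 * Complex.I) θ).mul
        (hasDerivAt_comp_mul_exp hk hz θ)).congr_deriv (by simp only [hε, he]; ring)
  rw [intervalIntegral.integral_add (hi1.const_mul _) (hi2.const_mul _),
    intervalIntegral.integral_const_mul, intervalIntegral.integral_const_mul] at hFTC
  rw [(hbd z hz).deriv]
  change -(Complex.I / 2) * (1 * J z + z * _) + -(Complex.I / 2) * (z * J z) / (2 * z) = k z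
  have : -(Complex.I / 2) * (z * J z) / (2 * z) = -(Complex.I / 4) * J z := by
    field_simp
    ring
  rw [this]
  linear_combination (-1 / 2 : ℂ) * hFTC

/-- The equation `g' + g / 2z = 0` has no nontrivial solution on a punctured disk. -/
theorem eq_zero_of_twisted {g : ℂ → ℂ} {R : ℝ} (hg : DifferentiableOn ℂ g (puncturedDisk R))
    (h : ∀ z ∈ puncturedDisk R, deriv g z + g z / (2 * z) = 0) :
    ∀ z ∈ puncturedDisk R, g z = 0 := by
  intro z hz
  -- Up to a constant this is `√ζ g(ζ)` continued along the circle. It has derivative zero, yet its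
  -- values at `0` and `2π` are opposite.
  set F : ℝ → ℂ := fun θ => Complex.exp (Complex.I / 2 * θ) * g (z * Complex.exp (Complex.I * θ))
    with hF
  have hd : ∀ θ, HasDerivAt F 0 θ := fun θ => by
    refine ((hasDerivAt_exp_const_mul (Complex.I / 2) θ).mul
      (hasDerivAt_comp_mul_exp hg hz θ)).congr_deriv ?_
    have hm := mul_exp_mem_puncturedDisk hz θ
    have h1 := h _ hm
    have h2 := (mem_puncturedDisk.mp hm).2
    set ζ := z * Complex.exp (Complex.I * θ)
    have h3 : z * (Complex.I * Complex.exp (Complex.I * θ)) = Complex.I * ζ := by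
      simp only [ζ]; ring
    have h4 : deriv g ζ * ζ = - g ζ / 2 := by
      field_simp at h1
      linear_combination (1 / 2 : ℂ) * h1
    rw [h3]
    linear_combination (Complex.exp (Complex.I / 2 * θ) * Complex.I) * h4
  have hconst := is_const_of_deriv_eq_zero (fun θ => (hd θ).differentiableAt)
    (fun θ => (hd θ).deriv) 0 (2 * Real.pi)
  have h1 : Complex.exp (Complex.I * ((2 * Real.pi : ℝ) : ℂ)) = 1 := by
    rw [← Complex.exp_two_pi_mul_I]; push_cast; ring_nf
  have h2 : Complex.exp (Complex.I / 2 * ((2 * Real.pi : ℝ) : ℂ)) = -1 := by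
    rw [← Complex.exp_pi_mul_I]; push_cast; ring_nf
  simp only [hF, h1, h2] at hconst
  simp only [Complex.ofReal_zero, mul_zero, Complex.exp_zero, one_mul, mul_one] at hconst
  linear_combination (1 / 2 : ℂ) * hconst

/-! ### Matrix computations -/

lemma lie_eq (A B : Mat) : ⁅A, B⁆ =
    !![A 0 1 * B 1 0 - B 0 1 * A 1 0,
       A 0 0 * B 0 1 + A 0 1 * B 1 1 - (B 0 0 * A 0 1 + B 0 1 * A 1 1);
       A 1 0 * B 0 0 + A 1 1 * B 1 0 - (B 1 0 * A 0 0 + B 1 1 * A 1 0),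
       A 1 0 * B 0 1 - B 1 0 * A 0 1] := by
  ext i j
  fin_cases i <;> fin_cases j <;> simp [Ring.lie_def, Matrix.mul_apply, Fin.sum_univ_two] <;> ring

lemma mat_ext {A B : Mat} (h00 : A 0 0 = B 0 0) (h01 : A 0 1 = B 0 1) (h10 : A 1 0 = B 1 0)
    (h11 : A 1 1 = B 1 1) : A = B := by
  ext i j
  fin_cases i <;> fin_cases j <;> assumption

lemma apply_one_one_of_trace {A : Mat} (h : A.trace = 0) : A 1 1 = -A 0 0 := by
  rw [Matrix.trace_fin_two] at h
  linear_combination h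

lemma exp_sub_eq_rpow {r : ℝ} (hr : 0 < r) (c x : ℝ) :
    r ^ c * Real.exp x = Real.exp (c * Real.log r + x) := by
  rw [Real.exp_add, Real.rpow_def_of_pos hr, mul_comm c]

/-- The metric has determinant `1`, so conjugation only rescales the off-diagonal entries, by the
ratio `|z| e^{2w}` of the two weights and its inverse. -/
lemma adj_diagMetric (w : ℝ → ℝ) {z : ℂ} (hz : z ≠ 0) (B : Mat) :
    adj (diagMetric w z) B =
      !![(starRingEnd ℂ) (B 0 0), ‖z‖ * Real.exp (2 * w ‖z‖) * (starRingEnd ℂ) (B 1 0);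
         (‖z‖ : ℂ)⁻¹ * Real.exp (-(2 * w ‖z‖)) * (starRingEnd ℂ) (B 0 1),
         (starRingEnd ℂ) (B 1 1)] := by
  have hr : 0 < ‖z‖ := norm_pos_iff.mpr hz
  set a : ℝ := ‖z‖ ^ (-(1 / 2) : ℝ) * Real.exp (-w ‖z‖) with ha
  set d : ℝ := ‖z‖ ^ (1 / 2 : ℝ) * Real.exp (w ‖z‖) with hd
  have ha' : a = Real.exp (-(1 / 2) * Real.log ‖z‖ + -w ‖z‖) := exp_sub_eq_rpow hr _ _
  have hd' : d = Real.exp ((1 / 2) * Real.log ‖z‖ + w ‖z‖) := exp_sub_eq_rpow hr _ _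
  have had : a * d = 1 := by rw [ha', hd', ← Real.exp_add, Real.exp_eq_one_iff]; ring
  have hdd : d * d = ‖z‖ * Real.exp (2 * w ‖z‖) := by
    rw [hd', ← Real.exp_add, show 1 / 2 * Real.log ‖z‖ + w ‖z‖ + (1 / 2 * Real.log ‖z‖ + w ‖z‖)
      = Real.log ‖z‖ + 2 * w ‖z‖ by ring, Real.exp_add, Real.exp_log hr]
  have haa : a * a = ‖z‖⁻¹ * Real.exp (-(2 * w ‖z‖)) := by
    rw [ha', ← Real.exp_add, show -(1 / 2) * Real.log ‖z‖ + -w ‖z‖ +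
      (-(1 / 2) * Real.log ‖z‖ + -w ‖z‖) = -Real.log ‖z‖ + -(2 * w ‖z‖) by ring, Real.exp_add,
      Real.exp_neg (Real.log ‖z‖), Real.exp_log hr]
  have hH : diagMetric w z = !![(a : ℂ), 0; 0, (d : ℂ)] := rfl
  have hadC : (a : ℂ) * d = 1 := by exact_mod_cast had
  have hinv : (diagMetric w z)⁻¹ = !![(d : ℂ), 0; 0, (a : ℂ)] := by
    apply Matrix.inv_eq_left_inv
    rw [hH]
    ext i j
    fin_cases i <;> fin_cases j <;>
      simp [Matrix.mul_apply, Fin.sum_univ_two, hadC, mul_comm (d : ℂ)]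
  have hddC : (d : ℂ) * d = ‖z‖ * Real.exp (2 * w ‖z‖) := by exact_mod_cast hdd
  have haaC : (a : ℂ) * a = (‖z‖ : ℂ)⁻¹ * Real.exp (-(2 * w ‖z‖)) := by exact_mod_cast haa
  rw [adj, hinv, hH, ← hddC, ← haaC]
  apply mat_ext <;> simp [Matrix.mul_apply, Fin.sum_univ_two, Matrix.vecMul, dotProduct]
  · linear_combination (starRingEnd ℂ) (B 0 0) * hadC
  · ring
  · ring
  · linear_combination (starRingEnd ℂ) (B 1 1) * hadC

lemma inv_mul_matDz_diagMetric (w : ℝ → ℝ) {w' : ℝ} {z : ℂ} (hz : z ≠ 0)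
    (hw : HasDerivAt (fun s => w (Real.exp s)) w' (Real.log ‖z‖)) :
    (diagMetric w z)⁻¹ * matDz (diagMetric w) z =
      !![-((1 + 2 * w') / (4 * z)), 0; 0, (1 + 2 * w') / (4 * z)] := by
  have hr : 0 < ‖z‖ := norm_pos_iff.mpr hz
  have hev : ∀ᶠ y in 𝓝 z, y ≠ 0 := isOpen_ne.mem_nhds hz
  set a : ℝ := Real.exp (-(1 / 2) * Real.log ‖z‖ + -w ‖z‖) with ha
  set d : ℝ := Real.exp ((1 / 2) * Real.log ‖z‖ + w ‖z‖) with hd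
  have had : a * d = 1 := by rw [ha, hd, ← Real.exp_add, Real.exp_eq_one_iff]; ring
  have hadC : (a : ℂ) * d = 1 := by exact_mod_cast had
  have hH : diagMetric w z = !![(a : ℂ), 0; 0, (d : ℂ)] := by
    rw [ha, hd, ← exp_sub_eq_rpow hr, ← exp_sub_eq_rpow hr]; rfl
  have hinv : (diagMetric w z)⁻¹ = !![(d : ℂ), 0; 0, (a : ℂ)] := by
    apply Matrix.inv_eq_left_inv
    rw [hH]
    ext i j
    fin_cases i <;> fin_cases j <;>
      simp [Matrix.mul_apply, Fin.sum_univ_two, hadC, mul_comm (d : ℂ)]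
  have e1 : HasWirtAt (fun y => diagMetric w y 0 0) (a * (-(1 / 2) - w') / (2 * z))
      (a * (-(1 / 2) - w') / (2 * (starRingEnd ℂ) z)) z := by
    have h1 : HasDerivAt (fun s => Real.exp (-(1 / 2) * s + -w (Real.exp s)))
        (a * (-(1 / 2) - w')) (Real.log ‖z‖) := by
      refine ((((hasDerivAt_id _).const_mul (-(1 / 2) : ℝ)).add hw.neg).exp).congr_deriv ?_
      simp [ha, Real.exp_log hr]; ring
    have h2 := hasWirtAt_logNorm hz h1
    push_cast at h2
    refine h2.congr_of_eventuallyEq ?_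
    filter_upwards [hev] with y hy
    have hy' : 0 < ‖y‖ := norm_pos_iff.mpr hy
    have : diagMetric w y 0 0 = ((‖y‖ ^ (-(1 / 2) : ℝ) * Real.exp (-w ‖y‖) : ℝ) : ℂ) := rfl
    rw [this, exp_sub_eq_rpow hy', Real.exp_log hy']
    push_cast; rfl
  have e2 : HasWirtAt (fun y => diagMetric w y 1 1) (d * (1 / 2 + w') / (2 * z))
      (d * (1 / 2 + w') / (2 * (starRingEnd ℂ) z)) z := by
    have h1 : HasDerivAt (fun s => Real.exp ((1 / 2) * s + w (Real.exp s)))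
        (d * (1 / 2 + w')) (Real.log ‖z‖) := by
      refine ((((hasDerivAt_id _).const_mul (1 / 2 : ℝ)).add hw).exp).congr_deriv ?_
      simp [hd, Real.exp_log hr]
    have h2 := hasWirtAt_logNorm hz h1
    push_cast at h2
    refine h2.congr_of_eventuallyEq ?_
    filter_upwards [hev] with y hy
    have hy' : 0 < ‖y‖ := norm_pos_iff.mpr hy
    have : diagMetric w y 1 1 = ((‖y‖ ^ (1 / 2 : ℝ) * Real.exp (w ‖y‖) : ℝ) : ℂ) := rfl
    rw [this, exp_sub_eq_rpow hy', Real.exp_log hy']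
    push_cast; rfl
  have e3 : matDz (diagMetric w) z = !![a * (-(1 / 2) - w') / (2 * z), 0; 0,
      d * (1 / 2 + w') / (2 * z)] := by
    apply mat_ext
    · exact e1.wirt
    · exact (hasWirtAt_const 0 z).wirt
    · exact (hasWirtAt_const 0 z).wirt
    · exact e2.wirt
  rw [hinv, e3]
  apply mat_ext <;> simp
  · field_simp
    linear_combination (-(4 + 8 * (w' : ℂ))) * hadC
  · field_simp
    linear_combination (4 + 8 * (w' : ℂ)) * hadC

lemma chernDz_diagMetric (w : ℝ → ℝ) {w' : ℝ} {z : ℂ} (hz : z ≠ 0)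
    (hw : HasDerivAt (fun s => w (Real.exp s)) w' (Real.log ‖z‖)) (a : ℂ → Mat) :
    chernDz (diagMetric w) a z =
      !![wirt (fun y => a y 0 0) z,
         wirt (fun y => a y 0 1) z - (1 + 2 * w') / (2 * z) * a z 0 1;
         wirt (fun y => a y 1 0) z + (1 + 2 * w') / (2 * z) * a z 1 0,
         wirt (fun y => a y 1 1) z] := by
  rw [chernDz, inv_mul_matDz_diagMetric w hz hw, lie_eq]
  apply mat_ext <;> simp [matDz] <;> field_simp <;> ring

/-- Eliminating `z̄` makes the matrix identities below rational in `z` and `|z|`, so that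
`field_simp` and `ring` can decide them. -/
lemma conj_eq_div {z : ℂ} (hz : z ≠ 0) : (starRingEnd ℂ) z = (‖z‖ : ℂ) ^ 2 / z := by
  rw [← conj_mul_self, mul_div_cancel_right₀ _ hz]

lemma norm_ne_zero_of_ne {z : ℂ} (hz : z ≠ 0) : (‖z‖ : ℂ) ≠ 0 := by
  exact_mod_cast norm_ne_zero_iff.mpr hz

/-! ### The upper triangular representative -/

/-- The coefficient `P` of the strictly upper triangular representative of `(η, f)`. -/
def upperCoeff (f : ℂ → Mat) (z : ℂ) : ℂ := f z 0 1 + z * f z 1 0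

section
variable {ρ R : ℝ} {η f : ℂ → Mat}

lemma MatContDiffOn.hasWirtAt {A : ℂ → Mat} {s : Set ℂ} {n : WithTop ℕ∞}
    (hA : MatContDiffOn n A s) (hn : n ≠ 0) (hs : IsOpen s) {z : ℂ} (hz : z ∈ s) (i j : Fin 2) :
    HasWirtAt (fun y => A y i j) (wirt (fun y => A y i j) z) (wirtBar (fun y => A y i j) z) z :=
  (((hA i j).contDiffAt (hs.mem_nhds hz)).differentiableAt hn).hasWirtAt

lemma IsHiggsDeformation.wirtBar_eq (h : IsHiggsDeformation (disk ρ) higgs η f) {z : ℂ}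
    (hz : z ∈ disk ρ) :
    wirtBar (fun y => f y 0 0) z = z * η z 1 0 - η z 0 1 ∧
    wirtBar (fun y => f y 0 1) z = -(2 * z * η z 0 0) ∧
    wirtBar (fun y => f y 1 0) z = 2 * η z 0 0 := by
  have e := h.eqn z hz
  have ht := apply_one_one_of_trace (h.trace_eta z hz)
  rw [lie_eq] at e
  have e00 := congrFun (congrFun e 0) 0
  have e01 := congrFun (congrFun e 0) 1
  have e10 := congrFun (congrFun e 1) 0
  simp [matDzBar, higgs, ht] at e00 e01 e10
  exact ⟨by linear_combination e00, by linear_combination e01, by linear_combination e10⟩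

/-- The coefficient is `tr(φ φ̇)`, and `tr(φ [η̇, φ]) = 0`; in entries, the contributions `-2zη₀₀`
and `z · 2η₀₀` to its `∂̄` cancel. -/
lemma IsHiggsDeformation.differentiableOn_upperCoeff
    (h : IsHiggsDeformation (disk ρ) higgs η f) :
    DifferentiableOn ℂ (upperCoeff f) (disk ρ) := by
  intro z hz
  obtain ⟨-, h01, h10⟩ := h.wirtBar_eq hz
  have e01 := h.smooth_phi.hasWirtAt (by simp) (isOpen_disk ρ) hz 0 1
  have e10 := h.smooth_phi.hasWirtAt (by simp) (isOpen_disk ρ) hz 1 0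
  rw [h01] at e01
  rw [h10] at e10
  have := (e01.add ((hasWirtAt_id z).mul e10)).congr_coeff rfl
    (show _ = (0 : ℂ) by ring)
  exact this.hasDerivAt.differentiableAt.differentiableWithinAt

theorem IsHiggsDeformation.gaugeEquiv_upper (h : IsHiggsDeformation (disk ρ) higgs η f)
    (hR : 0 < R) (hRρ : R < ρ) :
    GaugeEquiv (disk R) higgs η f (fun _ => 0) (upper (upperCoeff f)) := by
  obtain ⟨c, hc, hcd⟩ := exists_wirtBar_eq_on_disk hR hRρ (h.smooth_eta 1 0).neg
  have hsub : disk R ⊆ disk ρ := Metric.ball_subset_ball hRρ.le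
  have hf := fun i j => (h.smooth_phi i j).mono hsub
  -- Requiring the new Higgs variation to be strictly upper triangular fixes the diagonal and
  -- expresses the upper right entry through the lower left entry `c`. For `c` only `∂̄c = -η₁₀`
  -- remains, and the deformation equation then gives the other entries of `∂̄γ = -η`.
  refine ⟨fun z => !![-(f z 1 0) / 2, f z 0 0 + z * c z; c z, f z 1 0 / 2], ?_, ?_, ?_, ?_⟩
  · intro i j
    fin_cases i <;> fin_cases j
    · exact (hf 1 0).neg.div_const 2
    · exact (hf 0 0).add (contDiffOn_id.mul hc.contDiffOn)
    · exact hc.contDiffOn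
    · exact (hf 1 0).div_const 2
  · intro z _
    simp [Matrix.trace_fin_two]; ring
  · intro z hz
    obtain ⟨h00, -, h10⟩ := h.wirtBar_eq (hsub hz)
    have ht := apply_one_one_of_trace (h.trace_eta z (hsub hz))
    have e00 := h.smooth_phi.hasWirtAt (by simp) (isOpen_disk ρ) (hsub hz) 0 0
    have e10 := h.smooth_phi.hasWirtAt (by simp) (isOpen_disk ρ) (hsub hz) 1 0
    have ec := ((hc.differentiable (by simp)) z).hasWirtAt
    rw [hcd z hz] at ec
    rw [h00] at e00
    rw [h10] at e10
    apply mat_ext <;> simp only [matDzBar, Matrix.of_apply]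
    · have := (e10.const_mul (-(1 / 2))).wirtBar
      simp only [Matrix.cons_val', Matrix.cons_val_zero, Matrix.cons_val_fin_one,
        Matrix.sub_apply, Matrix.zero_apply, zero_sub]
      rw [show (fun w => -f w 1 0 / 2) = fun w => -(1 / 2) * f w 1 0 by ext; ring, this]; ring
    · have := (e00.add ((hasWirtAt_id z).mul ec)).wirtBar
      simp [this]; ring
    · simp [ec.wirtBar]
    · have := (e10.const_mul (1 / 2)).wirtBar
      simp only [Matrix.cons_val', Matrix.cons_val_one, Matrix.cons_val_fin_one,
        Matrix.sub_apply, Matrix.zero_apply, zero_sub]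
      rw [show (fun w => f w 1 0 / 2) = fun w => (1 / 2) * f w 1 0 by ext; ring, this, ht]; ring
  · intro z hz
    have ht := apply_one_one_of_trace (h.trace_phi z (hsub hz))
    rw [lie_eq]
    apply mat_ext <;> simp [upper, upperCoeff, higgs, ht] <;> ring

/-- Gauge changes preserve `tr(φ φ̇)`, and for a strictly upper triangular `φ̇` this trace is its
only entry. -/
lemma IsGauge.eq_upper {s : Set ℂ} {γ η' f' : ℂ → Mat} (hg : IsGauge s higgs γ η f η' f') {z : ℂ}
    (hz : z ∈ s) (hf' : f' z 0 0 = 0 ∧ f' z 1 0 = 0 ∧ f' z 1 1 = 0) :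
    f' z = upper (upperCoeff f) z := by
  have e := hg.phi z hz
  have ht := apply_one_one_of_trace (hg.traceless z hz)
  rw [lie_eq] at e
  have e01 := congrFun (congrFun e 0) 1
  have e10 := congrFun (congrFun e 1) 0
  simp [higgs, hf'.2.1, ht] at e01 e10
  apply mat_ext <;> simp [upper, upperCoeff, hf'.1, hf'.2.1, hf'.2.2]
  linear_combination e01 + z * e10

end

/-! ### The limiting metric -/

lemma hasDerivAt_zero_exp (s : ℝ) : HasDerivAt (fun s => (fun _ : ℝ => (0 : ℝ)) (Real.exp s)) 0 s :=
  hasDerivAt_const s 0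

lemma adj_hInf {z : ℂ} (hz : z ≠ 0) (B : Mat) : adj (hInf z) B =
    !![(starRingEnd ℂ) (B 0 0), ‖z‖ * (starRingEnd ℂ) (B 1 0);
       (‖z‖ : ℂ)⁻¹ * (starRingEnd ℂ) (B 0 1), (starRingEnd ℂ) (B 1 1)] := by
  rw [hInf, adj_diagMetric _ hz]; simp

lemma chernDz_hInf {z : ℂ} (hz : z ≠ 0) (a : ℂ → Mat) : chernDz hInf a z =
    !![wirt (fun y => a y 0 0) z, wirt (fun y => a y 0 1) z - 1 / (2 * z) * a z 0 1;
       wirt (fun y => a y 1 0) z + 1 / (2 * z) * a z 1 0, wirt (fun y => a y 1 1) z] := by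
  rw [hInf, chernDz_diagMetric _ hz (hasDerivAt_zero_exp _)]; simp

lemma chernDz_eq_zero_of_eventuallyEq (H : ℂ → Mat) {a : ℂ → Mat} {z : ℂ}
    (h : ∀ᶠ y in 𝓝 z, a y = 0) : chernDz H a z = 0 := by
  have h1 : matDz a z = 0 := by
    ext i j
    have : (fun y => a y i j) =ᶠ[𝓝 z] fun _ => 0 := h.mono fun y hy => by simp [hy]
    exact ((hasWirtAt_const 0 z).congr_of_eventuallyEq this).wirt
  rw [chernDz, h1, h.self_of_nhds, Ring.lie_def]; simp

section
variable {P : ℂ → ℂ} {R : ℝ}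

lemma matDzBar_nuInf (hP : DifferentiableOn ℂ P (disk R)) {z : ℂ} (hz : z ∈ puncturedDisk R) :
    matDzBar (nuInf P) z = 0 := by
  have hz0 := (mem_puncturedDisk.mp hz).2
  have h1 := hP.hasDerivAt_of_isOpen (isOpen_disk R) hz.1
  have h2 := (h1.div ((hasDerivAt_id z).const_mul 4) (by simpa using hz0)).neg.hasWirtAt
  have h0 : wirtBar (fun y => -(P y / (4 * y))) z = 0 := h2.wirtBar
  have h3 : wirtBar (fun y => P y / (4 * y)) z = 0 :=
    (h1.div ((hasDerivAt_id z).const_mul 4) (by simpa using hz0)).hasWirtAt.wirtBar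
  have h4 : wirtBar (fun _ => 0) z = 0 := (hasWirtAt_const 0 z).wirtBar
  apply mat_ext <;> simp [matDzBar, nuInf, h0, h3, h4]

/-- `ν_∞` is holomorphic off the origin, which removes the second order term. It is chosen so that
`φ̇ + [ν_∞, φ] = (P/2z) φ`, and `φ†` is a multiple of `φ`, which removes the bracket. -/
theorem formalCoulomb_nuInf (hP : DifferentiableOn ℂ P (disk R)) (t : ℝ) :
    FormalCoulomb (puncturedDisk R) hInf (fun z => (t : ℂ) • higgs z) (fun _ => 0)
      (fun z => (t : ℂ) • upper P z) (nuInf P) := by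
  intro z hz
  have hz0 := (mem_puncturedDisk.mp hz).2
  have hr := norm_ne_zero_of_ne hz0
  rw [chernDz_eq_zero_of_eventuallyEq]
  · rw [zero_add, adj_hInf hz0, lie_eq, lie_eq]
    apply mat_ext <;> simp [nuInf, upper, higgs, conj_eq_div hz0]
    · field_simp; ring
    · field_simp; ring
  · filter_upwards [(isOpen_puncturedDisk R).mem_nhds hz] with y hy
    rw [matDzBar_nuInf hP hy, sub_zero]

/-- Since `φ` and `φ†` commute, the left side equals `[Y, φ†] + [φ, Y†]` with `Y = φ̇ + [ν_∞, φ]`,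
and `Y` is a multiple of `φ`. -/
theorem linearizedNormal_nuInf (t : ℝ) :
    LinearizedNormal (puncturedDisk R) hInf (fun z => (t : ℂ) • higgs z)
      (fun z => (t : ℂ) • upper P z) (nuInf P) := by
  intro z hz
  have hz0 := (mem_puncturedDisk.mp hz).2
  have hr := norm_ne_zero_of_ne hz0
  simp only [adj_hInf hz0, lie_eq]
  apply mat_ext <;> simp [nuInf, upper, higgs, conj_eq_div hz0, map_ofNat] <;> field_simp <;> ring

/-- A holomorphic `g` with `√z g` imaginary vanishes on the punctured disk. -/
lemma eq_zero_of_add_conj_eq_zero {g : ℂ → ℂ} (hg : DifferentiableOn ℂ g (puncturedDisk R))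
    (h : ∀ z ∈ puncturedDisk R, g z + (starRingEnd ℂ) (g z) * (‖z‖ * z⁻¹) = 0) :
    ∀ z ∈ puncturedDisk R, g z = 0 := by
  refine eq_zero_of_twisted hg fun z hz => ?_
  have hz0 := (mem_puncturedDisk.mp hz).2
  have h1 := (hg.hasDerivAt_of_isOpen (isOpen_puncturedDisk R) hz).hasWirtAt
  have h2 := (h1.conj.mul ((hasWirtAt_norm hz0).mul (hasWirtAt_inv hz0))).neg
  have h3 : (fun z => -((starRingEnd ℂ) (g z) * (‖z‖ * z⁻¹))) =ᶠ[𝓝 z] g := by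
    filter_upwards [(isOpen_puncturedDisk R).mem_nhds hz] with y hy
    linear_combination -h y hy
  -- The hypothesis expresses `g` through its conjugate, and `∂ḡ = 0`. Differentiating therefore
  -- hits only the factor `|z|/z` and yields `g' = -g/2z`.
  have h4 := (h2.congr_of_eventuallyEq h3.symm).wirt
  rw [h1.wirt] at h4
  rw [h4]
  have h5 := h z hz
  simp only [map_zero]
  field_simp at h5 ⊢
  linear_combination h5

lemma nuInf_add_adj {z : ℂ} (hz : z ≠ 0) :
    nuInf P z + adj (hInf z) (nuInf P z) =
      !![-(P z / (4 * z)) - (starRingEnd ℂ) (P z) * z / (4 * ‖z‖ ^ 2), 0;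
        0, P z / (4 * z) + (starRingEnd ℂ) (P z) * z / (4 * ‖z‖ ^ 2)] := by
  have hr := norm_ne_zero_of_ne hz
  rw [adj_hInf hz]
  apply mat_ext <;> simp [nuInf, conj_eq_div hz, map_ofNat] <;> field_simp
  ring

end

/-! ### Metric variations of the limiting metric up to gauge -/

section
variable {R : ℝ} {η f ν γ γ' η' f' : ℂ → Mat} {P : ℂ → ℂ}

lemma IsGauge.mono {s s' : Set ℂ} {M : ℂ → Mat} (h : IsGauge s M γ η f η' f') (hs : s' ⊆ s) :
    IsGauge s' M γ η f η' f' :=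
  ⟨fun i j => (h.smooth i j).mono hs, fun z hz => h.traceless z (hs hz),
    fun z hz => h.eta z (hs hz), fun z hz => h.phi z (hs hz)⟩

lemma IsGauge.wirtBar_apply {s : Set ℂ} {M : ℂ → Mat} (h : IsGauge s M γ η f (fun _ => 0) f')
    {z : ℂ} (hz : z ∈ s) (i j : Fin 2) : wirtBar (fun y => γ y i j) z = -η z i j := by
  have := congrFun (congrFun (h.eta z hz) i) j
  simpa [matDzBar] using this.symm

lemma IsGauge.hasWirtAt {s : Set ℂ} (hs : IsOpen s) {M : ℂ → Mat}
    (h : IsGauge s M γ η f (fun _ => 0) f')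
    {z : ℂ} (hz : z ∈ s) (i j : Fin 2) :
    HasWirtAt (fun y => γ y i j) (wirt (fun y => γ y i j) z) (-η z i j) z := by
  rw [← h.wirtBar_apply hz]
  exact h.smooth.hasWirtAt (by simp) hs hz i j

lemma IsGauge.apply_eq {s : Set ℂ} (h : IsGauge s higgs γ η f (fun _ => 0) (upper P)) {z : ℂ}
    (hz : z ∈ s) :
    f z = !![γ z 0 1 - z * γ z 1 0, P z + 2 * z * γ z 0 0; -(2 * γ z 0 0),
      z * γ z 1 0 - γ z 0 1] := by
  have e := h.phi z hz
  have ht := apply_one_one_of_trace (h.traceless z hz)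
  have : f z = upper P z - ⁅higgs z, γ z⁆ := by rw [← e]; simp
  rw [this, lie_eq]
  apply mat_ext <;> simp [upper, higgs, ht] <;> ring

/-- Two such transformations differ by an element commuting with `φ`, that is `g φ`, and `g` is
holomorphic because both have the same `∂̄`. Equal hermitian parts then give `g + ḡ|z|/z = 0`, so `g
= 0`. -/
theorem gauge_unique
    (h : IsGauge (puncturedDisk R) higgs γ η f (fun _ => 0) (upper P))
    (h' : IsGauge (puncturedDisk R) higgs γ' η f (fun _ => 0) (upper P))
    (hν : ∀ z ∈ puncturedDisk R, (ν z + γ z) + adj (hInf z) (ν z + γ z) =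
      nuInf P z + adj (hInf z) (nuInf P z))
    (hν' : ∀ z ∈ puncturedDisk R, (ν z + γ' z) + adj (hInf z) (ν z + γ' z) =
      nuInf P z + adj (hInf z) (nuInf P z)) :
    ∀ z ∈ puncturedDisk R, γ' z = γ z := by
  have hcomm : ∀ z ∈ puncturedDisk R, γ' z 0 0 = γ z 0 0 ∧
      γ' z 0 1 - γ z 0 1 = z * (γ' z 1 0 - γ z 1 0) := by
    intro z hz
    have e := (h.apply_eq hz).symm.trans (h'.apply_eq hz)
    have e00 := congrFun (congrFun e 0) 0
    have e10 := congrFun (congrFun e 1) 0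
    simp at e00 e10
    exact ⟨by linear_combination -e10, by linear_combination -e00⟩
  have hg : DifferentiableOn ℂ (fun z => γ' z 1 0 - γ z 1 0) (puncturedDisk R) := by
    intro z hz
    have ho := isOpen_puncturedDisk R
    have := ((h'.hasWirtAt ho hz 1 0).sub (h.hasWirtAt ho hz 1 0)).congr_coeff rfl (sub_self _)
    exact this.hasDerivAt.differentiableAt.differentiableWithinAt
  have hg0 := eq_zero_of_add_conj_eq_zero hg (by
    intro z hz
    have hz0 := (mem_puncturedDisk.mp hz).2
    have hr := norm_ne_zero_of_ne hz0
    have e := (hν z hz).trans (hν' z hz).symm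
    rw [adj_hInf hz0, adj_hInf hz0] at e
    have e10 := congrFun (congrFun e 1) 0
    simp at e10
    have e2 := congrArg (starRingEnd ℂ) (hcomm z hz).2
    simp only [map_sub, map_mul, conj_eq_div hz0] at e2
    simp only [map_sub]
    field_simp at e2 e10 ⊢
    refine mul_left_cancel₀ hr ?_
    linear_combination (-z) * e10 - e2)
  intro z hz
  have h1 := hcomm z hz
  have h2 : γ' z 1 0 - γ z 1 0 = 0 := hg0 z hz
  rw [h2, mul_zero] at h1
  have t1 := apply_one_one_of_trace (h.traceless z hz)
  have t2 := apply_one_one_of_trace (h'.traceless z hz)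
  apply mat_ext
  · exact h1.1
  · exact sub_eq_zero.mp h1.2
  · exact sub_eq_zero.mp h2
  · rw [t1, t2, h1.1]

/-- When `η̇ = ∂̄ν` the Coulomb equation is purely algebraic and determines `ν + γ` up to a multiple
`g φ`. Here `∂̄(ν + γ) = 0`, so `g` is holomorphic, and the condition on the hermitian part kills
it. -/
theorem eq_nuInf_of_eta_eq
    (h : IsGauge (puncturedDisk R) higgs γ η f (fun _ => 0) (upper P))
    (hs : MatContDiffOn (⊤ : ℕ∞) ν (puncturedDisk R)) (ht : TracelessOn ν (puncturedDisk R))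
    (hcoul : FormalCoulomb (puncturedDisk R) hInf higgs η f ν)
    (hν : ∀ z ∈ puncturedDisk R, (ν z + γ z) + adj (hInf z) (ν z + γ z) =
      nuInf P z + adj (hInf z) (nuInf P z))
    (heta : ∀ z ∈ puncturedDisk R, η z - matDzBar ν z = 0) :
    ∀ z ∈ puncturedDisk R, ν z + γ z = nuInf P z := by
  have ho := isOpen_puncturedDisk R
  have halg : ∀ z ∈ puncturedDisk R, ν z 0 0 + γ z 0 0 = -(P z / (4 * z)) ∧
      ν z 0 1 + γ z 0 1 = z * (ν z 1 0 + γ z 1 0) := by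
    intro z hz
    have hz0 := (mem_puncturedDisk.mp hz).2
    have hr := norm_ne_zero_of_ne hz0
    have e := hcoul z hz
    rw [chernDz_eq_zero_of_eventuallyEq _ (by
      filter_upwards [ho.mem_nhds hz] with y hy
      rw [← neg_sub, heta y hy, neg_zero]), zero_add, adj_hInf hz0, lie_eq, lie_eq,
      h.apply_eq hz] at e
    have t1 := apply_one_one_of_trace (ht z hz)
    have e00 := congrFun (congrFun e 0) 0
    have e01 := congrFun (congrFun e 0) 1
    simp [higgs, t1, conj_eq_div hz0] at e00 e01
    field_simp at e00 e01
    constructor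
    · field_simp
      refine mul_left_cancel₀ hr ?_
      linear_combination -e00
    · refine mul_left_cancel₀ hr ?_
      linear_combination (-1 / 2 : ℂ) * e01
  have hg : DifferentiableOn ℂ (fun z => ν z 1 0 + γ z 1 0) (puncturedDisk R) := by
    intro z hz
    have e := congrFun (congrFun (heta z hz) 1) 0
    simp [matDzBar] at e
    have := ((hs.hasWirtAt (by simp) ho hz 1 0).add (h.hasWirtAt ho hz 1 0)).congr_coeff rfl
      (show _ = (0 : ℂ) by linear_combination -e)
    exact this.hasDerivAt.differentiableAt.differentiableWithinAt
  have hg0 := eq_zero_of_add_conj_eq_zero hg (by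
    intro z hz
    have hz0 := (mem_puncturedDisk.mp hz).2
    have hr := norm_ne_zero_of_ne hz0
    have e := hν z hz
    rw [nuInf_add_adj hz0, adj_hInf hz0] at e
    have e10 := congrFun (congrFun e 1) 0
    simp at e10
    have e2 := congrArg (starRingEnd ℂ) (halg z hz).2
    simp only [map_add, map_mul, conj_eq_div hz0] at e2
    simp only [map_add]
    field_simp at e2 e10 ⊢
    refine mul_left_cancel₀ hr ?_
    linear_combination z * e10 - e2)
  intro z hz
  obtain ⟨h1, h2⟩ := halg z hz
  have h3 : ν z 1 0 + γ z 1 0 = 0 := hg0 z hz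
  rw [h3, mul_zero] at h2
  have t1 := apply_one_one_of_trace (ht z hz)
  have t2 := apply_one_one_of_trace (h.traceless z hz)
  apply mat_ext <;> simp [nuInf, h1, h2, h3, t1, t2]
  linear_combination -h1

/-- The linearized equation already fixes the hermitian part transverse to `φ`. Along `φ`, a
suitable holomorphic multiple of `φ` is added to `γ₀` so that this component becomes skew-adjoint.
-/
theorem exists_gauge_to_nuInf {γ₀ : ℂ → Mat}
    (h : IsGauge (puncturedDisk R) higgs γ₀ η f (fun _ => 0) (upper P))
    (hs : MatContDiffOn (⊤ : ℕ∞) ν (puncturedDisk R)) (ht : TracelessOn ν (puncturedDisk R))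
    (hηs : MatContDiffOn ∞ η (puncturedDisk R))
    (hcoul : FormalCoulomb (puncturedDisk R) hInf higgs η f ν)
    (hlin : LinearizedNormal (puncturedDisk R) hInf higgs f ν) :
    ∃ γ, IsGauge (puncturedDisk R) higgs γ η f (fun _ => 0) (upper P) ∧
      ∀ z ∈ puncturedDisk R, (ν z + γ z) + adj (hInf z) (ν z + γ z) =
        nuInf P z + adj (hInf z) (nuInf P z) := by
  have ho := isOpen_puncturedDisk R
  set X : Fin 2 → Fin 2 → ℂ → ℂ := fun i j z => wirtBar (fun y => ν y i j) z - η z i j with hX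
  have hXs : ∀ i j, ContDiffOn ℝ 1 (X i j) (puncturedDisk R) := fun i j =>
    (ContDiffOn.wirtBar (hs i j) ho (by
      rw [one_add_one_eq_two]; exact WithTop.coe_le_coe.mpr le_top)).sub
      ((hηs i j).of_le (by exact_mod_cast le_top))
  have hXw : ∀ i j, ∀ z ∈ puncturedDisk R,
      HasWirtAt (X i j) (wirt (X i j) z) (wirtBar (X i j) z) z := fun i j z hz =>
    (((hXs i j).contDiffAt (ho.mem_nhds hz)).differentiableAt (by norm_num)).hasWirtAt
  -- the component along the Higgs field
  set d : ℂ → ℂ := fun z =>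
    (1 / 2) * ((ν z 0 1 + γ₀ z 0 1) * z⁻¹ + (ν z 1 0 + γ₀ z 1 0)) with hd
  set l : ℂ → ℂ := fun z => (1 / 2) * (X 0 1 z * z⁻¹ + X 1 0 z) with hl
  have hdw : ∀ z ∈ puncturedDisk R, HasWirtAt d (wirt d z) (l z) z := by
    intro z hz
    have hz0 := (mem_puncturedDisk.mp hz).2
    have h1 := (hs.hasWirtAt (by simp) ho hz 0 1).add (h.hasWirtAt ho hz 0 1)
    have h2 := (hs.hasWirtAt (by simp) ho hz 1 0).add (h.hasWirtAt ho hz 1 0)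
    have h3 := ((h1.mul (hasWirtAt_inv hz0)).add h2).const_mul (1 / 2)
    refine h3.congr_coeff h3.wirt.symm ?_
    simp only [hl, hX]; ring
  -- Pairing the Coulomb equation with `φ` gives the combination `e₀₁ + z e₁₀`; the bracket drops
  -- out because `φ†` is a multiple of `φ`. What remains is a first order equation for `l = ∂̄d`.
  have hlw : ∀ z ∈ puncturedDisk R, HasWirtAt l (-(l z / (2 * z))) (wirtBar l z) z := by
    intro z hz
    have hz0 := (mem_puncturedDisk.mp hz).2
    have hr := norm_ne_zero_of_ne hz0
    have h3 := (((hXw 0 1 z hz).mul (hasWirtAt_inv hz0)).add (hXw 1 0 z hz)).const_mul (1 / 2)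
    refine h3.congr_coeff ?_ h3.wirtBar.symm
    have e := hcoul z hz
    rw [chernDz_hInf hz0, adj_hInf hz0, lie_eq] at e
    have e01 := congrFun (congrFun e 0) 1
    have e10 := congrFun (congrFun e 1) 0
    have hX' : ∀ i j, (fun y => (matDzBar ν y - η y) i j) = X i j := fun i j => by
      ext y; simp [matDzBar, hX]
    have hX'' : ∀ i j y, (matDzBar ν y - η y) i j = X i j y := fun i j y => by
      simp [matDzBar, hX]
    simp only [Matrix.add_apply, Matrix.of_apply, Matrix.cons_val', Matrix.cons_val_zero,
      Matrix.cons_val_fin_one, Matrix.cons_val_one, hX'', Matrix.zero_apply] at e01 e10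
    simp [higgs, conj_eq_div hz0] at e01 e10
    simp only [hl]
    field_simp at e01 e10 ⊢
    linear_combination e01 + z * e10
  -- `k φ` is the adjoint of `l φ` for `h_∞`, and the equation for `l` says precisely that `k` is
  -- holomorphic.
  set k : ℂ → ℂ := fun z => (starRingEnd ℂ) (l z) * (‖z‖ * z⁻¹) with hk
  have hkd : DifferentiableOn ℂ k (puncturedDisk R) := by
    intro z hz
    have hz0 := (mem_puncturedDisk.mp hz).2
    have h1 := (hlw z hz).conj.mul ((hasWirtAt_norm hz0).mul (hasWirtAt_inv hz0))
    have h2 := h1.congr_coeff rfl (show _ = (0 : ℂ) by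
      have hr := norm_ne_zero_of_ne hz0
      simp only [map_neg, map_div₀, map_mul, map_ofNat, conj_eq_div hz0]
      field_simp
      ring)
    exact h2.hasDerivAt.differentiableAt.differentiableWithinAt
  obtain ⟨b, hbd, hb⟩ := exists_twisted_primitive hkd
  -- The equation for `b` gives `∂̄(b̄|z|/z) = l = ∂̄d`, so `g` is holomorphic. After adding `g φ`,
  -- the component along `φ` is `b̄|z|/z - b`, and `(bφ)† - bφ` is skew-adjoint.
  set g : ℂ → ℂ := fun z => -((d z - (starRingEnd ℂ) (b z) * (‖z‖ * z⁻¹)) + b z) with hg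
  have hgd : DifferentiableOn ℂ g (puncturedDisk R) := by
    intro z hz
    have hz0 := (mem_puncturedDisk.mp hz).2
    have hbw := (hbd.hasDerivAt_of_isOpen ho hz).hasWirtAt
    have h1 := (((hdw z hz).sub
      (hbw.conj.mul ((hasWirtAt_norm hz0).mul (hasWirtAt_inv hz0)))).add hbw).neg
    have h2 := h1.congr_coeff rfl (show _ = (0 : ℂ) by
      have hr := norm_ne_zero_of_ne hz0
      have hbk := congrArg (starRingEnd ℂ) (hb z hz)
      simp only [hk, map_add, map_div₀, map_mul, map_ofNat, map_inv₀, Complex.conj_conj,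
        Complex.conj_ofReal, conj_eq_div hz0] at hbk
      rw [conj_eq_div hz0]
      field_simp at hbk ⊢
      linear_combination hbk)
    exact h2.hasDerivAt.differentiableAt.differentiableWithinAt
  have hgs : ContDiffOn ℝ ∞ g (puncturedDisk R) := (hgd.contDiffOn ho).restrict_scalars ℝ
  refine ⟨fun z => γ₀ z + !![0, z * g z; g z, 0], ⟨?_, ?_, ?_, ?_⟩, ?_⟩
  · intro i j
    fin_cases i <;> fin_cases j
    · simpa using h.smooth 0 0
    · simpa using (h.smooth 0 1).add (contDiffOn_id.mul hgs)
    · simpa using (h.smooth 1 0).add hgs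
    · simpa using h.smooth 1 1
  · intro z hz
    have := h.traceless z hz
    rw [Matrix.trace_add, this]
    simp [Matrix.trace_fin_two]
  · intro z hz
    have hgw := (hgd.hasDerivAt_of_isOpen ho hz).hasWirtAt
    apply mat_ext
    · have := (h.hasWirtAt ho hz 0 0).wirtBar
      simp [matDzBar, this]
    · have := ((h.hasWirtAt ho hz 0 1).add ((hasWirtAt_id z).mul hgw)).wirtBar
      simp [matDzBar, this]
    · have := ((h.hasWirtAt ho hz 1 0).add hgw).wirtBar
      simp [matDzBar, this]
    · have := (h.hasWirtAt ho hz 1 1).wirtBar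
      simp [matDzBar, this]
  · intro z hz
    rw [h.phi z hz, lie_eq, lie_eq]
    apply mat_ext <;> simp [higgs] <;> ring
  · intro z hz
    have hz0 := (mem_puncturedDisk.mp hz).2
    have hr := norm_ne_zero_of_ne hz0
    have t1 := apply_one_one_of_trace (ht z hz)
    have t2 := apply_one_one_of_trace (h.traceless z hz)
    have e := hlin z hz
    rw [h.apply_eq hz] at e
    simp only [adj_hInf hz0, lie_eq] at e
    have e00 := congrFun (congrFun e 0) 0
    have e10 := congrFun (congrFun e 1) 0
    simp [higgs, t1, conj_eq_div hz0, map_ofNat] at e00 e10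
    rw [nuInf_add_adj hz0, adj_hInf hz0]
    field_simp at e00 e10
    clear e
    apply mat_ext <;> simp [t1, t2, hg, hd, map_ofNat, conj_eq_div hz0]
    · field_simp
      linear_combination e00
    · field_simp
      linear_combination (-1 / 2 : ℂ) * e10
    · field_simp
      linear_combination (1 / 2 : ℂ) * e10
    · field_simp
      linear_combination -e00

end

/-! ### A one-dimensional maximum principle -/

section
variable {D D₁ D₂ : ℝ → ℝ}

lemma sub_le_of_hasDerivAt_le {a b C : ℝ} (hD : ∀ s, HasDerivAt D (D₁ s) s) (hab : a ≤ b)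
    (h : ∀ s ∈ Ioo a b, D₁ s ≤ C) : D b - D a ≤ C * (b - a) := by
  rcases hab.eq_or_lt with rfl | hab
  · simp
  obtain ⟨c, hc, hc'⟩ := exists_hasDerivAt_eq_slope D D₁ hab
    (fun s _ => (hD s).continuousAt.continuousWithinAt) fun s _ => hD s
  have h1 := h c hc
  rw [hc', div_le_iff₀ (by linarith)] at h1
  exact h1

lemma le_sub_of_le_hasDerivAt {a b C : ℝ} (hD : ∀ s, HasDerivAt D (D₁ s) s) (hab : a ≤ b)
    (h : ∀ s ∈ Ioo a b, C ≤ D₁ s) : C * (b - a) ≤ D b - D a := by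
  have := sub_le_of_hasDerivAt_le (D := fun s => -D s) (D₁ := fun s => -D₁ s) (C := -C)
    (fun s => (hD s).neg) hab fun s hs => neg_le_neg (h s hs)
  linarith

/-- At a positive interior maximum the second derivative would be positive, making the point a local
minimum too; then `D` is locally constant and `D₂` vanishes there. -/
lemma nonpos_of_convex_of_pos (hD : ∀ s, HasDerivAt D (D₁ s) s) (hD₁ : ∀ s, HasDerivAt D₁ (D₂ s) s)
    {p q : ℝ} (hp : D p ≤ 0) (hq : D q ≤ 0) (h : ∀ s ∈ Ioo p q, 0 < D s → 0 < D₂ s) :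
    ∀ s ∈ Icc p q, D s ≤ 0 := by
  by_contra! hcon
  obtain ⟨s, hs, hs0⟩ := hcon
  have hc : ContinuousOn D (Icc p q) := fun s _ => (hD s).continuousAt.continuousWithinAt
  obtain ⟨c, hcm, hmax⟩ := isCompact_Icc.exists_isMaxOn ⟨s, hs⟩ hc
  have hc0 : 0 < D c := lt_of_lt_of_le hs0 (hmax hs)
  have hcp : c ≠ p := fun h => by rw [h] at hc0; linarith
  have hcq : c ≠ q := fun h => by rw [h] at hc0; linarith
  have hci : c ∈ Ioo p q := ⟨lt_of_le_of_ne hcm.1 hcp.symm, lt_of_le_of_ne hcm.2 hcq⟩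
  have hlmax : IsLocalMax D c := hmax.isLocalMax (Icc_mem_nhds hci.1 hci.2)
  have hderiv : deriv D = D₁ := funext fun s => (hD s).deriv
  have hd0 : D₁ c = 0 := hlmax.hasDerivAt_eq_zero (hD c)
  have hlmin : IsLocalMin D c := by
    refine isLocalMin_of_deriv_deriv_pos ?_ ?_ (hD c).continuousAt
    · rw [hderiv, (hD₁ c).deriv]; exact h c hci hc0
    · rw [hderiv]; exact hd0
  have hconst : D =ᶠ[𝓝 c] fun _ => D c := by
    filter_upwards [hlmax, hlmin] with x h1 h2 using le_antisymm h1 h2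
  have hd : deriv D =ᶠ[𝓝 c] fun _ => 0 := by
    have := hconst.deriv
    simpa using this
  rw [hderiv] at hd
  have h2 := (hD₁ c).deriv
  rw [hd.deriv_eq] at h2
  have := h c hci hc0
  simp at h2
  linarith

lemma nonpos_of_tendsto_zero (hD : ∀ s, HasDerivAt D (D₁ s) s)
    (hD₁ : ∀ s, HasDerivAt D₁ (D₂ s) s) (htop : Tendsto D atTop (𝓝 0)) {p : ℝ} (hp : D p ≤ 0)
    (h : ∀ s > p, 0 < D s → 0 < D₂ s) : ∀ s ≥ p, D s ≤ 0 := by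
  intro x hx
  refine le_of_forall_pos_le_add fun ε hε => ?_
  have h1 : ∀ᶠ s in atTop, D s < ε := htop.eventually (gt_mem_nhds hε)
  obtain ⟨q, hq, hxq⟩ := (h1.and (eventually_ge_atTop x)).exists
  have := nonpos_of_convex_of_pos (D := fun s => D s - ε) (fun s => (hD s).sub_const ε) hD₁
    (p := p) (q := q) (by linarith) (by linarith)
    (fun s hs h0 => h s hs.1 (by linarith)) x ⟨hx, hxq⟩
  linarith

/-- Comparison with the affine barrier `η + ε(S - s)`, which dominates `D` at both ends of a large
interval and does not change `D₂`. Sublinear growth at `-∞` is what two solutions with the same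
logarithmic asymptotics provide. -/
lemma nonpos_of_sublinear (hD : ∀ s, HasDerivAt D (D₁ s) s)
    (hD₁ : ∀ s, HasDerivAt D₁ (D₂ s) s) (htop : Tendsto D atTop (𝓝 0))
    (hbot : ∀ ε > 0, ∀ᶠ s in atBot, D s ≤ ε * -s) (h : ∀ s, 0 < D s → 0 < D₂ s) :
    ∀ s, D s ≤ 0 := by
  intro x
  refine le_of_forall_pos_le_add fun η hη => ?_
  have h1 : ∀ᶠ s in atTop, D s < η := htop.eventually (gt_mem_nhds hη)
  obtain ⟨S, hS, hxS⟩ := (h1.and (eventually_ge_atTop (max x 0))).exists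
  have hxS' : x ≤ S := (le_max_left _ _).trans hxS
  have hS0 : 0 ≤ S := (le_max_right _ _).trans hxS
  refine le_of_forall_pos_le_add fun δ hδ => ?_
  set ε := δ / (S - x + 1) with hε
  have hpos : 0 < S - x + 1 := by linarith
  have hε0 : 0 < ε := div_pos hδ hpos
  obtain ⟨p, hp, hpx⟩ := ((hbot ε hε0).and (eventually_le_atBot x)).exists
  have hB : ∀ s, HasDerivAt (fun s => η + ε * (S - s)) (-ε) s := fun s => by
    have := (((hasDerivAt_id s).const_sub S).const_mul ε).const_add η
    exact this.congr_deriv (by ring)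
  have := nonpos_of_convex_of_pos (D := fun s => D s - (η + ε * (S - s)))
    (D₁ := fun s => D₁ s - -ε) (fun s => (hD s).sub (hB s)) (fun s => (hD₁ s).sub_const _)
    (p := p) (q := S) ?_ ?_ ?_ x ⟨hpx, hxS'⟩
  · have h2 : ε * (S - x) ≤ δ := by
      rw [hε, div_mul_eq_mul_div, div_le_iff₀ hpos]
      nlinarith
    linarith
  · nlinarith
  · simp only [sub_self, mul_zero, add_zero]; linarith
  · intro s hs h0
    refine h s ?_
    have : 0 ≤ ε * (S - s) := mul_nonneg hε0.le (by linarith [hs.2])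
    linarith

end

/-! ### The model solution in the logarithmic coordinate -/

/-- Follows from `cosh s > s`. This crude bound suffices: the asymptotics at infinity are used only
to know that `u` tends to `0`. -/
lemma norm_besselK0_le {x : ℝ} (hx : 0 < x) : ‖besselK0 x‖ ≤ 1 / x := by
  have h1 := integrableOn_exp_mul_Ioi (neg_lt_zero.mpr hx) 0
  have h2 := integral_exp_mul_Ioi (neg_lt_zero.mpr hx) 0
  have h3 : ∫ s in Ioi (0 : ℝ), Real.exp (-x * s) = 1 / x := by rw [h2]; simp
  rw [← h3]
  refine norm_integral_le_of_norm_le h1 ?_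
  refine (ae_restrict_iff' measurableSet_Ioi).2 (Eventually.of_forall fun s hs => ?_)
  rw [Real.norm_of_nonneg (Real.exp_pos _).le, Real.exp_le_exp]
  have h4 : s ≤ Real.sinh s := Real.self_le_sinh_iff.2 (le_of_lt hs)
  have h5 := Real.sinh_lt_cosh s
  nlinarith

lemma tendsto_besselK0 : Tendsto besselK0 atTop (𝓝 0) := by
  refine squeeze_zero_norm' (a := fun x => 1 / x) ?_ ?_
  · filter_upwards [eventually_gt_atTop 0] with x hx using norm_besselK0_le hx
  · simpa using tendsto_inv_atTop_zero (𝕜 := ℝ)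

/-- `U(s) = u(e^s)` for the model solution `u`, together with its derivative `U₁`. -/
structure IsCylSolution (t : ℝ) (U U₁ : ℝ → ℝ) : Prop where
  hasDerivAt : ∀ s, HasDerivAt U (U₁ s) s
  hasDerivAt₁ : ∀ s, HasDerivAt U₁ (8 * t ^ 2 * Real.exp (3 * s) * Real.sinh (2 * U s)) s
  atTop : Tendsto U atTop (𝓝 0)
  atBot : Tendsto (fun s => U s / s) atBot (𝓝 (-(1 / 2)))

/-- In `s = log r` the radial Laplacian is `e^{-2s} d²/ds²`, so the first order term disappears. -/
lemma IsModelSolution.isCylSolution {t : ℝ} (ht : 0 < t) {u : ℝ → ℝ} (hu : IsModelSolution t u) :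
    IsCylSolution t (fun s => u (Real.exp s)) (fun s => deriv u (Real.exp s) * Real.exp s) := by
  have hu1 : ∀ r > 0, HasDerivAt u (deriv u r) r := fun r hr =>
    ((hu.contDiffOn.contDiffAt (Ioi_mem_nhds hr)).differentiableAt (by norm_num)).hasDerivAt
  have hu2 : ∀ r > 0, HasDerivAt (deriv u) (deriv (deriv u) r) r := fun r hr => by
    have h1 : ContDiffOn ℝ 1 (deriv u) (Ioi 0) :=
      hu.contDiffOn.deriv_of_isOpen isOpen_Ioi (by norm_num)
    exact ((h1.contDiffAt (Ioi_mem_nhds hr)).differentiableAt (by norm_num)).hasDerivAt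
  refine ⟨fun s => ?_, fun s => ?_, ?_, ?_⟩
  · exact (hu1 _ (Real.exp_pos s)).comp s (Real.hasDerivAt_exp s)
  · have h1 := ((hu2 _ (Real.exp_pos s)).comp s (Real.hasDerivAt_exp s)).mul (Real.hasDerivAt_exp s)
    refine h1.congr_deriv ?_
    have h2 := hu.ode _ (Real.exp_pos s)
    have h3 : Real.exp s ≠ 0 := (Real.exp_pos s).ne'
    have h4 : Real.exp (3 * s) = Real.exp s ^ 3 := by rw [← Real.exp_nat_mul]; norm_num
    simp only [Function.comp]
    rw [h4]
    field_simp at h2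
    linear_combination (Real.exp s) * h2
  · have h1 : Tendsto (fun r : ℝ => 8 * t / 3 * r ^ (3 / 2 : ℝ)) Filter.atTop Filter.atTop :=
      (tendsto_rpow_atTop (by norm_num)).const_mul_atTop (by positivity)
    have h2 := (tendsto_besselK0.comp h1).const_mul (1 / Real.pi)
    rw [mul_zero] at h2
    exact (hu.atTop.symm.tendsto_nhds h2).comp Real.tendsto_exp_atTop
  · have h1 := hu.atZero.comp_tendsto Real.tendsto_exp_atBot_nhdsGT
    rw [isEquivalent_iff_tendsto_one] at h1
    · have h2 := h1.const_mul (-(1 / 2) : ℝ)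
      rw [mul_one] at h2
      refine h2.congr' ?_
      filter_upwards [eventually_lt_atBot 0] with s hs
      simp only [Pi.div_apply, Function.comp, Real.log_exp]
      field_simp
    · filter_upwards [eventually_lt_atBot 0] with s hs
      simp only [Function.comp, Real.log_exp]
      exact mul_ne_zero (by norm_num) hs.ne

namespace IsCylSolution
variable {t : ℝ} {U U₁ : ℝ → ℝ}

/-- Maximum principle for `-U`: where `U < 0` the right side of the equation is negative, and `U/s →
-1/2` makes `U` positive near `-∞`. -/
lemma nonneg (h : IsCylSolution t U U₁) (ht : 0 < t) (s : ℝ) : 0 ≤ U s := by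
  have := nonpos_of_sublinear (D := fun s => -U s) (fun s => (h.hasDerivAt s).neg)
    (fun s => (h.hasDerivAt₁ s).neg) (by simpa using h.atTop.neg) ?_ ?_ s
  · linarith
  · intro ε hε
    have h1 : ∀ᶠ s in Filter.atBot, U s / s < 0 := h.atBot.eventually (gt_mem_nhds (by norm_num))
    filter_upwards [h1, eventually_lt_atBot 0] with s h2 h3
    rw [div_lt_iff_of_neg h3, zero_mul] at h2
    nlinarith
  · intro s hs
    have : Real.sinh (2 * U s) < 0 := Real.sinh_neg_iff.2 (by linarith)
    have h2 : 0 < 8 * t ^ 2 * Real.exp (3 * s) := by positivity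
    nlinarith

lemma second_nonneg (h : IsCylSolution t U U₁) (ht : 0 < t) (s : ℝ) :
    0 ≤ 8 * t ^ 2 * Real.exp (3 * s) * Real.sinh (2 * U s) := by
  have : 0 ≤ Real.sinh (2 * U s) := Real.sinh_nonneg_iff.2 (by linarith [h.nonneg ht s])
  positivity

lemma monotone (h : IsCylSolution t U U₁) (ht : 0 < t) : Monotone U₁ :=
  monotone_of_hasDerivAt_nonneg h.hasDerivAt₁ fun s => h.second_nonneg ht s

/-- A convex function with a positive slope somewhere grows at least linearly, contradicting `U →
0`. -/
lemma first_nonpos (h : IsCylSolution t U U₁) (ht : 0 < t) (a : ℝ) : U₁ a ≤ 0 := by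
  by_contra! hcon
  have h1 : ∀ᶠ s in Filter.atTop, U s < 1 := h.atTop.eventually (gt_mem_nhds (by norm_num))
  obtain ⟨s, hs, hs'⟩ := (h1.and (eventually_ge_atTop (max a (a + 1 / U₁ a)))).exists
  have h2 := le_sub_of_le_hasDerivAt h.hasDerivAt ((le_max_left _ _).trans hs')
    fun x hx => h.monotone ht hx.1.le
  have h3 : a + 1 / U₁ a ≤ s := (le_max_right _ _).trans hs'
  have h4 : 1 ≤ U₁ a * (s - a) := by
    have : 1 / U₁ a ≤ s - a := by linarith
    rwa [div_le_iff₀ hcon, mul_comm] at this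
  have := h.nonneg ht a
  linarith

/-- By convexity `U` lies above its tangent at `a`; dividing by `s < 0` and letting `s → -∞`
compares `-1/2` with the slope. -/
lemma le_first (h : IsCylSolution t U U₁) (ht : 0 < t) (a : ℝ) : -(1 / 2) ≤ U₁ a := by
  have h2 : Tendsto (fun s => U a / s + U₁ a * (1 - a / s)) Filter.atBot (𝓝 (U₁ a)) := by
    have h3 : ∀ c : ℝ, Tendsto (fun s => c / s) Filter.atBot (𝓝 0) := fun c =>
      tendsto_const_nhds.div_atBot tendsto_id
    simpa using (h3 (U a)).add (((h3 a).const_sub 1).const_mul (U₁ a))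
  refine le_of_tendsto_of_tendsto h.atBot h2 ?_
  filter_upwards [eventually_lt_atBot 0, eventually_le_atBot a] with s hs hsa
  have h4 := sub_le_of_hasDerivAt_le h.hasDerivAt hsa (fun x hx => h.monotone ht hx.2.le)
  have h5 : U a / s + U₁ a * (1 - a / s) = (U a + U₁ a * (s - a)) / s := by
    have := hs.ne
    field_simp
  rw [h5]
  exact div_le_div_of_nonpos_of_le hs.le (by linarith)

lemma exists_first_lt (h : IsCylSolution t U U₁) {δ : ℝ} (hδ : 0 < δ) :
    ∃ a, U₁ a < -(1 / 2) + δ := by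
  by_contra! hcon
  have h2 : Tendsto (fun s => U 0 / s + (-(1 / 2) + δ)) Filter.atBot (𝓝 (-(1 / 2) + δ)) := by
    have h3 : Tendsto (fun s => U 0 / s) Filter.atBot (𝓝 0) :=
      tendsto_const_nhds.div_atBot tendsto_id
    simpa using h3.add_const (-(1 / 2) + δ)
  have : -(1 / 2) + δ ≤ -(1 / 2) := by
    refine le_of_tendsto_of_tendsto h2 h.atBot ?_
    filter_upwards [eventually_lt_atBot 0] with s hs
    have h4 := le_sub_of_le_hasDerivAt h.hasDerivAt hs.le (fun x _ => hcon x)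
    have h5 : U 0 / s + (-(1 / 2) + δ) = (U 0 + (-(1 / 2) + δ) * s) / s := by
      rw [add_div, mul_div_cancel_right₀ _ hs.ne]
    rw [h5]
    exact div_le_div_of_nonpos_of_le hs.le (by linarith)
  linarith

/-- Regularity at the origin: `u + (log r) / 2` is bounded with small derivatives. -/
lemma exists_bound_atBot (h : IsCylSolution t U U₁) (ht : 0 < t) :
    ∃ K : ℝ, 0 ≤ K ∧ ∀ s ≤ 0, |U s + s / 2| ≤ K ∧ |U₁ s + 1 / 2| ≤ K * Real.exp (2 * s) ∧
      |8 * t ^ 2 * Real.exp (3 * s) * Real.sinh (2 * U s)| ≤ K * Real.exp (2 * s) := by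
  set C : ℝ := 4 * t ^ 2 * Real.exp (2 * U 0) with hC
  have hC0 : 0 < C := by positivity
  have hV : ∀ s, HasDerivAt (fun s => U s + s / 2) (U₁ s + 1 / 2) s := fun s =>
    (h.hasDerivAt s).add ((hasDerivAt_id s).div_const 2)
  have hexp : ∀ s : ℝ, HasDerivAt (fun s => Real.exp (2 * s)) (2 * Real.exp (2 * s)) s :=
      fun s => by
    have := ((hasDerivAt_id s).const_mul (2 : ℝ)).exp
    exact this.congr_deriv (by simp; ring)
  -- `U + s/2` is nondecreasing. Hence `e^{2U} ≤ e^{2U(0)} e^{-s}`, which turns the factor `e^{3s}`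
  -- of the equation into the rate `e^{2s}` and explains `C`.
  have hle : ∀ s ≤ 0, U s + s / 2 ≤ U 0 := fun s hs => by
    have := le_sub_of_le_hasDerivAt (C := 0) hV hs fun x _ => by linarith [h.le_first ht x]
    simp at this; linarith
  have hU2 : ∀ s ≤ 0, 8 * t ^ 2 * Real.exp (3 * s) * Real.sinh (2 * U s)
      ≤ C * Real.exp (2 * s) := by
    intro s hs
    have h1 : Real.sinh (2 * U s) ≤ Real.exp (2 * U s) / 2 := by
      rw [Real.sinh_eq]; linarith [Real.exp_pos (-(2 * U s))]
    have h2 : Real.exp (3 * s) * Real.exp (2 * U s) ≤ Real.exp (2 * U 0) * Real.exp (2 * s) := by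
      rw [← Real.exp_add, ← Real.exp_add, Real.exp_le_exp]
      linarith [hle s hs]
    calc _ ≤ 8 * t ^ 2 * Real.exp (3 * s) * (Real.exp (2 * U s) / 2) := by gcongr
      _ = 4 * t ^ 2 * (Real.exp (3 * s) * Real.exp (2 * U s)) := by ring
      _ ≤ 4 * t ^ 2 * (Real.exp (2 * U 0) * Real.exp (2 * s)) := by gcongr
      _ = _ := by rw [hC]; ring
  -- The bound on the second derivative is integrated from a point so far left that the slope is
  -- within `δ` of `-1/2`.
  have hU1 : ∀ s ≤ 0, U₁ s + 1 / 2 ≤ C / 2 * Real.exp (2 * s) := by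
    intro s hs
    refine le_of_forall_pos_le_add fun δ hδ => ?_
    obtain ⟨a, ha⟩ := h.exists_first_lt hδ
    have hb : U₁ (min a s) < -(1 / 2) + δ := (h.monotone ht (min_le_left a s)).trans_lt ha
    have := sub_le_of_hasDerivAt_le (D := fun s => U₁ s - C / 2 * Real.exp (2 * s)) (C := 0)
      (fun x => (h.hasDerivAt₁ x).sub ((hexp x).const_mul (C / 2))) (min_le_right a s)
      fun x hx => by
        have := hU2 x (hx.2.le.trans hs)
        linarith
    have h5 : 0 ≤ C / 2 * Real.exp (2 * min a s) := by positivity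
    simp at this
    linarith
  have hge : ∀ s ≤ 0, U 0 - C / 4 ≤ U s + s / 2 := by
    intro s hs
    have := sub_le_of_hasDerivAt_le (D := fun s => U s + s / 2 - C / 4 * Real.exp (2 * s)) (C := 0)
      (fun x => (hV x).sub ((hexp x).const_mul (C / 4))) hs
      fun x hx => by
        have := hU1 x hx.2.le
        linarith
    have h5 : 0 ≤ C / 4 * Real.exp (2 * s) := by positivity
    simp at this
    linarith
  have hU0 := h.nonneg ht 0
  refine ⟨U 0 + C, by positivity, fun s hs => ⟨?_, ?_, ?_⟩⟩
  · rw [abs_le]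
    exact ⟨by linarith [hge s hs], by linarith [hle s hs]⟩
  · rw [abs_of_nonneg (by linarith [h.le_first ht s])]
    refine (hU1 s hs).trans ?_
    gcongr
    linarith
  · rw [abs_of_nonneg (h.second_nonneg ht s)]
    refine (hU2 s hs).trans ?_
    gcongr
    linarith

/-- Where `U > V ≥ 0`, the larger coefficient and the monotonicity of `sinh` make `U - V` strictly
convex. The common asymptotics at `-∞` allow the maximum principle; the result bounds all `t ≥ 1` by
the single solution at `t = 1`. -/
lemma le_of_one_le {V V₁ : ℝ → ℝ} (h : IsCylSolution t U U₁) (ht : 1 ≤ t)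
    (hV : IsCylSolution 1 V V₁) (s : ℝ) : U s ≤ V s := by
  have := nonpos_of_sublinear (D := fun s => U s - V s)
    (fun s => (h.hasDerivAt s).sub (hV.hasDerivAt s))
    (fun s => (h.hasDerivAt₁ s).sub (hV.hasDerivAt₁ s)) (by simpa using h.atTop.sub hV.atTop)
    ?_ ?_ s
  · linarith
  · intro ε hε
    have h1 := h.atBot.sub hV.atBot
    rw [sub_self] at h1
    have h2 : ∀ᶠ s in Filter.atBot, -ε < U s / s - V s / s :=
      h1.eventually (lt_mem_nhds (by linarith))
    filter_upwards [h2, eventually_lt_atBot 0] with s h2 h3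
    rw [← sub_div, lt_div_iff_of_neg h3] at h2
    linarith
  · intro s hs
    have hV0 := hV.nonneg one_pos s
    have h1 : Real.sinh (2 * V s) < Real.sinh (2 * U s) := Real.sinh_lt_sinh.2 (by linarith)
    have h2 : 0 ≤ Real.sinh (2 * V s) := Real.sinh_nonneg_iff.2 (by linarith)
    have h3 : (1 : ℝ) ≤ t ^ 2 := one_le_pow₀ ht
    have h4 := Real.exp_pos (3 * s)
    have h5 : Real.sinh (2 * V s) < t ^ 2 * Real.sinh (2 * U s) := by nlinarith
    nlinarith

/-- To the right of `s₀` the inequality `sinh x ≥ x` gives `U'' ≥ κ²U` with `κ² = 16 t² e^{3s₀}`,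
and the exponential solves the equality case. -/
lemma le_exp_decay (h : IsCylSolution t U U₁) (ht : 0 < t) {s₀ C : ℝ} (hC : U s₀ ≤ C) :
    ∀ s ≥ s₀, U s ≤ C * Real.exp (-(4 * Real.exp (3 * s₀ / 2) * t * (s - s₀))) := by
  set κ := 4 * Real.exp (3 * s₀ / 2) * t with hκ
  have hκ2 : κ ^ 2 = 16 * t ^ 2 * Real.exp (3 * s₀) := by
    rw [hκ, mul_pow, mul_pow, ← Real.exp_nat_mul]
    norm_num
    ring_nf
  have hκ0 : 0 < κ := by positivity
  have hB : ∀ s, HasDerivAt (fun s => C * Real.exp (-(κ * (s - s₀))))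
      (-κ * (C * Real.exp (-(κ * (s - s₀))))) s := fun s => by
    have := (((((hasDerivAt_id s).sub_const s₀).const_mul κ).neg).exp).const_mul C
    exact this.congr_deriv (by simp; ring)
  have htop : Tendsto (fun s => C * Real.exp (-(κ * (s - s₀)))) Filter.atTop (𝓝 0) := by
    have h1 : Tendsto (fun s => κ * (s - s₀)) Filter.atTop Filter.atTop :=
      (tendsto_atTop_add_const_right _ (-s₀) tendsto_id).const_mul_atTop hκ0
    simpa using (Real.tendsto_exp_neg_atTop_nhds_zero.comp h1).const_mul C
  intro s hs
  have := nonpos_of_tendsto_zero (D := fun s => U s - C * Real.exp (-(κ * (s - s₀))))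
    (fun s => (h.hasDerivAt s).sub (hB s)) (fun s => (h.hasDerivAt₁ s).sub ((hB s).const_mul _))
    (by simpa using h.atTop.sub htop) (p := s₀) (by simpa using hC) ?_ s hs
  · linarith
  · intro x hx h0
    have hU0 := h.nonneg ht x
    have h1 : 2 * U x ≤ Real.sinh (2 * U x) := Real.self_le_sinh_iff.2 (by linarith)
    have h2 : Real.exp (3 * s₀) ≤ Real.exp (3 * x) := Real.exp_le_exp.2 (by linarith)
    have h3 : κ ^ 2 * U x ≤ 8 * t ^ 2 * Real.exp (3 * x) * Real.sinh (2 * U x) := by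
      calc κ ^ 2 * U x = 8 * t ^ 2 * Real.exp (3 * s₀) * (2 * U x) := by rw [hκ2]; ring
        _ ≤ _ := by gcongr
    have h4 : 0 < κ ^ 2 * (U x - C * Real.exp (-(κ * (x - s₀)))) := mul_pos (by positivity) h0
    linarith

end IsCylSolution

/-- Uniform exponential decay of a family of model solutions away from the origin. -/
theorem exists_exp_decay {U U₁ : ℝ → ℝ → ℝ} (h : ∀ t > 0, IsCylSolution t (U t) (U₁ t))
    (s₁ : ℝ) : ∃ C κ : ℝ, 0 ≤ C ∧ 0 < κ ∧ ∀ t ≥ 1, ∀ s ≥ s₁,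
      |U t s| ≤ C * Real.exp (-(κ * t)) ∧ |U₁ t s| ≤ C * Real.exp (-(κ * t)) := by
  -- One unit of length produces the decay of `U` to the right of `s₁ - 1`; the second lets
  -- convexity bound `-U₁(s)` by `U(s - 1) - U(s)`.
  set s₀ := s₁ - 2 with hs₀
  have hC := (h 1 one_pos).nonneg one_pos s₀
  refine ⟨U 1 s₀, 4 * Real.exp (3 * s₀ / 2), hC, by positivity, fun t ht s hs => ?_⟩
  have ht0 : 0 < t := by linarith
  have hU : ∀ x ≥ s₁ - 1, U t x ≤ U 1 s₀ * Real.exp (-(4 * Real.exp (3 * s₀ / 2) * t)) := by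
    intro x hx
    refine ((h t ht0).le_exp_decay ht0 ((h t ht0).le_of_one_le ht (h 1 one_pos) s₀) x
      (by linarith)).trans ?_
    have : 0 < 4 * Real.exp (3 * s₀ / 2) * t := by positivity
    refine mul_le_mul_of_nonneg_left (Real.exp_le_exp.2 ?_) hC
    nlinarith
  have hpos := (h t ht0).nonneg ht0
  refine ⟨?_, ?_⟩
  · rw [abs_of_nonneg (hpos s)]
    exact hU s (by linarith)
  · rw [abs_of_nonpos ((h t ht0).first_nonpos ht0 s)]
    have h1 := sub_le_of_hasDerivAt_le (h t ht0).hasDerivAt (show s - 1 ≤ s by linarith)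
      fun x hx => (h t ht0).monotone ht0 hx.2.le
    have h2 := hU (s - 1) (by linarith)
    have h3 := hpos s
    linarith

/-! ### Boundary and vanishing lemmas on the disk -/

lemma norm_wirtBar_le (g : ℂ → ℂ) (z : ℂ) : ‖wirtBar g z‖ ≤ ‖fderiv ℝ g z‖ := by
  have h1 : ‖fderiv ℝ g z 1‖ ≤ ‖fderiv ℝ g z‖ := by simpa using (fderiv ℝ g z).le_opNorm 1
  have h2 : ‖fderiv ℝ g z Complex.I‖ ≤ ‖fderiv ℝ g z‖ := by
    simpa using (fderiv ℝ g z).le_opNorm Complex.I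
  have h3 := norm_add_le (fderiv ℝ g z 1) (Complex.I * fderiv ℝ g z Complex.I)
  rw [norm_mul, Complex.norm_I, one_mul] at h3
  rw [wirtBar, norm_div, Complex.norm_ofNat]
  linarith

lemma exists_bound_of_contDiffOn_closedBall {g : ℂ → ℂ} {S : ℝ} (hS : 0 < S)
    (hg : ContDiffOn ℝ 2 g (Metric.closedBall 0 S)) :
    ∃ C, 0 ≤ C ∧ ∀ z ∈ disk S, ‖g z‖ ≤ C ∧ ‖wirtBar g z‖ ≤ C := by
  have hu : UniqueDiffOn ℝ (Metric.closedBall (0 : ℂ) S) :=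
    uniqueDiffOn_convex (convex_closedBall 0 S) (by
      rw [interior_closedBall _ hS.ne']; exact ⟨0, Metric.mem_ball_self hS⟩)
  obtain ⟨C₁, h₁⟩ := (isCompact_closedBall (0 : ℂ) S).exists_bound_of_continuousOn hg.continuousOn
  obtain ⟨C₂, h₂⟩ := (isCompact_closedBall (0 : ℂ) S).exists_bound_of_continuousOn
    (hg.continuousOn_fderivWithin hu (by norm_num))
  have h0 : (0 : ℂ) ∈ Metric.closedBall (0 : ℂ) S := Metric.mem_closedBall_self hS.le
  refine ⟨max C₁ C₂, le_max_of_le_left ((norm_nonneg _).trans (h₁ 0 h0)), fun z hz => ?_⟩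
  have hz' : z ∈ Metric.closedBall (0 : ℂ) S := Metric.ball_subset_closedBall hz
  refine ⟨(h₁ z hz').trans (le_max_left _ _), (norm_wirtBar_le g z).trans ?_⟩
  have h3 := h₂ z hz'
  rw [fderivWithin_of_mem_nhds (mem_of_superset ((isOpen_disk S).mem_nhds hz)
    Metric.ball_subset_closedBall)] at h3
  exact h3.trans (le_max_right _ _)

lemma tendsto_circleFlux_zero {W : ℂ → ℂ} {S C : ℝ} (hS : 0 < S)
    (hW : ∀ z ∈ puncturedDisk S, ‖W z‖ ≤ C) : Tendsto (circleFlux W) (𝓝[>] 0) (𝓝 0) := by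
  refine squeeze_zero_norm' (a := fun r => 2 * Real.pi * (r * C)) ?_ ?_
  · filter_upwards [Ioo_mem_nhdsGT hS] with r hr
    refine norm_circleFlux_le hr.1.le fun z hz => hW z ?_
    rw [mem_puncturedDisk, ← norm_pos_iff, hz]
    exact ⟨hr.2, hr.1⟩
  · have : Tendsto (fun r : ℝ => 2 * Real.pi * (r * C)) (𝓝 0) (𝓝 (2 * Real.pi * (0 * C))) :=
      Continuous.tendsto (by fun_prop) 0
    simp only [zero_mul, mul_zero] at this
    exact this.mono_left nhdsWithin_le_nhds

/-- Uniform continuity on a closed annulus, comparing each point with its radial projection to the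
boundary circle. Only continuity off the origin is required. -/
lemma eventually_le_of_eq_zero_on_sphere {G : ℂ → ℝ} {S : ℝ} (hS : 0 < S)
    (hG : ContinuousOn G (Metric.closedBall 0 S \ {0})) (h0 : ∀ z : ℂ, ‖z‖ = S → G z = 0)
    {ε : ℝ} (hε : 0 < ε) : ∀ᶠ r in 𝓝[<] S, ∀ z : ℂ, ‖z‖ = r → G z ≤ ε := by
  set A : Set ℂ := Metric.closedBall 0 S \ Metric.ball 0 (S / 2) with hA
  have hAc : IsCompact A := (isCompact_closedBall _ _).diff Metric.isOpen_ball
  have hAs : A ⊆ Metric.closedBall 0 S \ {0} := by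
    refine sdiff_subset_sdiff_right ?_
    rintro x rfl
    exact Metric.mem_ball_self (by linarith)
  have huc := hAc.uniformContinuousOn_of_continuous (hG.mono hAs)
  rw [Metric.uniformContinuousOn_iff] at huc
  obtain ⟨δ, hδ, hd⟩ := huc ε hε
  have hmem : Ioo (max (S / 2) (S - δ)) S ∈ 𝓝[<] S :=
    Ioo_mem_nhdsLT (max_lt (by linarith) (by linarith))
  filter_upwards [hmem] with r hr z hz
  have hr1 : S / 2 < r := (le_max_left _ _).trans_lt hr.1
  have hr2 : S - δ < r := (le_max_right _ _).trans_lt hr.1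
  have hr0 : 0 < r := by linarith
  have hzA : z ∈ A := by
    simp only [hA, Set.mem_sdiff, mem_closedBall_zero_iff, mem_ball_zero_iff, hz]
    exact ⟨hr.2.le, by linarith⟩
  set y : ℂ := ((S / r : ℝ) : ℂ) * z with hy
  have hyn : ‖y‖ = S := by
    rw [hy, norm_mul, Complex.norm_real, Real.norm_of_nonneg (by positivity), hz]
    field_simp
  have hyA : y ∈ A := by
    simp only [hA, Set.mem_sdiff, mem_closedBall_zero_iff, mem_ball_zero_iff, hyn]
    exact ⟨le_rfl, by linarith⟩
  have hdist : dist z y < δ := by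
    have : z - y = ((1 - S / r : ℝ) : ℂ) * z := by rw [hy]; push_cast; ring
    rw [dist_eq_norm, this, norm_mul, Complex.norm_real, hz, Real.norm_eq_abs,
      abs_of_nonpos (by rw [sub_nonpos, one_le_div hr0]; exact hr.2.le)]
    field_simp
    linarith
  have h1 := hd z hzA y hyA hdist
  rw [h0 y hyn, Real.dist_eq, sub_zero] at h1
  exact (le_abs_self _).trans h1.le

/-- Stokes' theorem without boundary contributions. -/
theorem integral_disk_wirt_eq_zero {W : ℂ → ℂ} {G : ℂ → ℝ} {S C : ℝ} (hS : 0 < S) (hC : 0 ≤ C)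
    (hW : ContDiffOn ℝ 1 W (puncturedDisk S)) (hi : IntegrableOn (wirt W) (disk S))
    (hWC : ∀ z ∈ puncturedDisk S, ‖W z‖ ≤ C) (hWG : ∀ z ∈ puncturedDisk S, ‖W z‖ ≤ C * G z)
    (hG : ContinuousOn G (Metric.closedBall 0 S \ {0})) (hG0 : ∀ z : ℂ, ‖z‖ = S → G z = 0) :
    ∫ z in disk S, wirt W z = 0 := by
  have h := integral_disk_wirt hS hW hi (tendsto_circleFlux_zero hS hWC) (m₁ := 0) ?_
  · simpa using h
  · rw [Metric.tendsto_nhds]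
    intro ε hε
    have hK : 0 < 2 * Real.pi * (S * (C + 1)) := by have := Real.pi_pos; positivity
    have hε' : 0 < ε / 2 / (2 * Real.pi * (S * (C + 1))) := by positivity
    filter_upwards [eventually_le_of_eq_zero_on_sphere hS hG hG0 hε', Ioo_mem_nhdsLT hS]
      with r h1 hr
    have h2 := norm_circleFlux_le (W := W) (C := C * (ε / 2 / (2 * Real.pi * (S * (C + 1)))))
      hr.1.le fun z hz => (hWG z (by
        rw [mem_puncturedDisk, ← norm_pos_iff, hz]; exact ⟨hr.2, hr.1⟩)).trans
          (mul_le_mul_of_nonneg_left (h1 z hz) hC)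
    rw [dist_zero_right]
    have h3 : 2 * Real.pi * (r * (C * (ε / 2 / (2 * Real.pi * (S * (C + 1)))))) ≤ ε / 2 := by
      calc _ = ε / 2 * ((2 * Real.pi * (r * C)) / (2 * Real.pi * (S * (C + 1)))) := by ring
        _ ≤ ε / 2 * 1 := by
          refine mul_le_mul_of_nonneg_left ?_ (by linarith)
          rw [div_le_one hK]
          have := Real.pi_pos
          have := hr.1; have := hr.2
          gcongr
          linarith
        _ = ε / 2 := mul_one _
    linarith

lemma eq_zero_of_integral_eq_zero {F : ℂ → ℝ} {S : ℝ} (hF : ContinuousOn F (puncturedDisk S))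
    (h0 : ∀ z ∈ puncturedDisk S, 0 ≤ F z) (hi : IntegrableOn F (disk S))
    (h : ∫ z in disk S, F z = 0) : ∀ z ∈ puncturedDisk S, F z = 0 := by
  have ho := isOpen_puncturedDisk S
  rw [← setIntegral_congr_set (disk_ae_eq_puncturedDisk S)] at h
  rw [← integrableOn_congr_set_ae (disk_ae_eq_puncturedDisk S)] at hi
  have h1 := (setIntegral_eq_zero_iff_of_nonneg_ae
    ((ae_restrict_iff' ho.measurableSet).2 (Eventually.of_forall h0)) hi).1 h
  exact Measure.eqOn_open_of_ae_eq h1 ho hF continuousOn_const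

/-- A `C²` function that is holomorphic off the origin and vanishes on the circle is zero. -/
lemma eq_zero_of_wirtBar_eq_zero {g : ℂ → ℂ} {S : ℝ} (hS : 0 < S)
    (hg : ContDiffOn ℝ 2 g (Metric.closedBall 0 S)) (h : ∀ z ∈ puncturedDisk S, wirtBar g z = 0)
    (h0 : ∀ z : ℂ, ‖z‖ = S → g z = 0) : ∀ z ∈ disk S, g z = 0 := by
  -- The origin is a removable singularity because `g` is continuous there.
  have hd : DifferentiableOn ℂ g (disk S) := by
    refine ((Complex.differentiableOn_compl_singleton_and_continuousAt_iff (c := 0)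
      ((isOpen_disk S).mem_nhds (mem_disk.mpr (by simpa using hS)))).1 ⟨fun z hz => ?_, ?_⟩)
    · have hz1 : z ∈ disk S := hz.1
      have : DifferentiableAt ℝ g z := (hg.contDiffAt (mem_of_superset
        ((isOpen_disk S).mem_nhds hz1) Metric.ball_subset_closedBall)).differentiableAt
          (by norm_num)
      exact (hasDerivAt_of_wirtBar_eq_zero this (h z hz)).differentiableAt.differentiableWithinAt
    · exact (hg.contDiffAt (Metric.closedBall_mem_nhds _ hS)).continuousAt
  have hcl : closure (disk S) = Metric.closedBall 0 S := closure_ball _ hS.ne'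
  have hdc : DiffContOnCl ℂ g (disk S) := ⟨hd, by rw [hcl]; exact hg.continuousOn⟩
  have := Complex.eqOn_closure_of_eqOn_frontier Metric.isBounded_ball hdc
    (diffContOnCl_const (c := (0 : ℂ))) (fun z hz => by
      have hz' : z ∈ Metric.sphere (0 : ℂ) S := frontier_ball (0 : ℂ) hS.ne' ▸ hz
      exact h0 z (by simpa using hz'))
  exact fun z hz => this (subset_closure hz)

lemma contDiffOn_logNorm {φ : ℝ → ℝ} {n : WithTop ℕ∞} (hφ : ContDiff ℝ n φ) (S : ℝ) :
    ContDiffOn ℝ n (fun z : ℂ => ((φ (Real.log ‖z‖) : ℝ) : ℂ)) (puncturedDisk S) := by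
  intro z hz
  have hz0 := (mem_puncturedDisk.mp hz).2
  have h1 : ContDiffAt ℝ n (fun z : ℂ => Real.log ‖z‖) z :=
    (contDiffAt_norm ℝ hz0).log (norm_ne_zero_iff.mpr hz0)
  exact (Complex.ofRealCLM.contDiff.contDiffAt.comp z
    (hφ.contDiffAt.comp z h1)).contDiffWithinAt

/-! ### The cut-off profile -/

lemma contDiff_one_of_hasDerivAt {g g' : ℝ → ℝ} (h : ∀ s, HasDerivAt g (g' s) s)
    (hc : Continuous g') : ContDiff ℝ 1 g := by
  rw [contDiff_one_iff_deriv]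
  refine ⟨fun s => (h s).differentiableAt, ?_⟩
  rwa [show deriv g = g' from funext fun s => (h s).deriv]

/-- The function `w(s)` of `s = log r` with three derivatives, which vanishes for `s ≥ s₂` and
behaves like a model solution at `-∞`. -/
structure IsProfile (s₂ : ℝ) (w w₁ w₂ w₃ : ℝ → ℝ) : Prop where
  hasDerivAt : ∀ s, HasDerivAt w (w₁ s) s
  hasDerivAt₁ : ∀ s, HasDerivAt w₁ (w₂ s) s
  hasDerivAt₂ : ∀ s, HasDerivAt w₂ (w₃ s) s
  continuous₃ : Continuous w₃
  nonneg : ∀ s, 0 ≤ w s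
  eq_zero : ∀ s ≥ s₂, w s = 0
  bound : ∃ K, 0 ≤ K ∧ ∀ s ≤ s₂, |w s + s / 2| ≤ K ∧ |w₁ s + 1 / 2| ≤ K * Real.exp (2 * s) ∧
    |w₂ s| ≤ K * Real.exp (2 * s)

namespace IsProfile
variable {s₂ : ℝ} {w w₁ w₂ w₃ : ℝ → ℝ}

lemma contDiff (h : IsProfile s₂ w w₁ w₂ w₃) : ContDiff ℝ 1 w :=
  contDiff_one_of_hasDerivAt h.hasDerivAt
    (continuous_iff_continuousAt.2 fun s => (h.hasDerivAt₁ s).continuousAt)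

lemma contDiff₁ (h : IsProfile s₂ w w₁ w₂ w₃) : ContDiff ℝ 1 w₁ :=
  contDiff_one_of_hasDerivAt h.hasDerivAt₁
    (continuous_iff_continuousAt.2 fun s => (h.hasDerivAt₂ s).continuousAt)

lemma contDiff₂ (h : IsProfile s₂ w w₁ w₂ w₃) : ContDiff ℝ 1 w₂ :=
  contDiff_one_of_hasDerivAt h.hasDerivAt₂ h.continuous₃

end IsProfile

/-- The derivatives of `U(s) χ(e^s)`. -/
def prof₁ (U U₁ X : ℝ → ℝ) (s : ℝ) : ℝ := U₁ s * X s + U s * deriv X s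

def modelSecond (t : ℝ) (U : ℝ → ℝ) (s : ℝ) : ℝ :=
  8 * t ^ 2 * Real.exp (3 * s) * Real.sinh (2 * U s)

def modelThird (t : ℝ) (U U₁ : ℝ → ℝ) (s : ℝ) : ℝ :=
  8 * t ^ 2 * Real.exp (3 * s) * (3 * Real.sinh (2 * U s) + 2 * U₁ s * Real.cosh (2 * U s))

def prof₂ (t : ℝ) (U U₁ X : ℝ → ℝ) (s : ℝ) : ℝ :=
  modelSecond t U s * X s + 2 * U₁ s * deriv X s + U s * deriv (deriv X) s

def prof₃ (t : ℝ) (U U₁ X : ℝ → ℝ) (s : ℝ) : ℝ :=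
  modelThird t U U₁ s * X s + 3 * modelSecond t U s * deriv X s
    + 3 * U₁ s * deriv (deriv X) s + U s * deriv (deriv (deriv X)) s

lemma IsCylSolution.hasDerivAt₂ {t : ℝ} {U U₁ : ℝ → ℝ} (h : IsCylSolution t U U₁) (s : ℝ) :
    HasDerivAt (modelSecond t U) (modelThird t U U₁ s) s := by
  have h1 : HasDerivAt (fun s : ℝ => Real.exp (3 * s)) (3 * Real.exp (3 * s)) s :=
    (((hasDerivAt_id s).const_mul (3 : ℝ)).exp).congr_deriv (by simp; ring)
  have h2 := (h1.const_mul (8 * t ^ 2)).mul (((h.hasDerivAt s).const_mul 2).sinh)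
  refine h2.congr_deriv ?_
  simp only [modelThird]; ring

section
variable {χ : ℝ → ℝ} {R₁ R₂ : ℝ}

lemma IsCutoff.contDiff_exp (hχ : IsCutoff χ R₁ R₂) : ContDiff ℝ ∞ fun s => χ (Real.exp s) :=
  hχ.contDiff.comp Real.contDiff_exp

lemma IsCutoff.eventually_eq_one (hχ : IsCutoff χ R₁ R₂) (hR₁ : 0 < R₁) {s : ℝ}
    (hs : s < Real.log R₁) : (fun s => χ (Real.exp s)) =ᶠ[𝓝 s] fun _ => 1 := by
  filter_upwards [Iio_mem_nhds hs] with x hx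
  exact hχ.eq_one _ ((Real.lt_log_iff_exp_lt hR₁).1 hx).le

lemma IsCutoff.deriv_eq_zero (hχ : IsCutoff χ R₁ R₂) (hR₁ : 0 < R₁) {s : ℝ}
    (hs : s < Real.log R₁) : χ (Real.exp s) = 1 ∧ deriv (fun s => χ (Real.exp s)) s = 0 ∧
      deriv (deriv fun s => χ (Real.exp s)) s = 0 ∧
      deriv (deriv (deriv fun s => χ (Real.exp s))) s = 0 := by
  have h0 := hχ.eventually_eq_one hR₁ hs
  have h1 : deriv (fun s => χ (Real.exp s)) =ᶠ[𝓝 s] fun _ => 0 := by simpa using h0.deriv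
  have h2 : deriv (deriv fun s => χ (Real.exp s)) =ᶠ[𝓝 s] fun _ => 0 := by simpa using h1.deriv
  have h3 : deriv (deriv (deriv fun s => χ (Real.exp s))) =ᶠ[𝓝 s] fun _ => 0 := by
    simpa using h2.deriv
  exact ⟨h0.self_of_nhds, h1.self_of_nhds, h2.self_of_nhds, h3.self_of_nhds⟩

lemma IsCutoff.hasDerivAt (hχ : IsCutoff χ R₁ R₂) :
    let X := fun s => χ (Real.exp s)
    (∀ s, HasDerivAt X (deriv X s) s) ∧ (∀ s, HasDerivAt (deriv X) (deriv (deriv X) s) s) ∧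
      (∀ s, HasDerivAt (deriv (deriv X)) (deriv (deriv (deriv X)) s) s) ∧
      Continuous (deriv (deriv (deriv X))) := by
  intro X
  have h0 : ContDiff ℝ ∞ X := hχ.contDiff_exp
  have h1 : ContDiff ℝ ∞ (deriv X) := (contDiff_infty_iff_deriv.1 h0).2
  have h2 : ContDiff ℝ ∞ (deriv (deriv X)) := (contDiff_infty_iff_deriv.1 h1).2
  have h3 : ContDiff ℝ ∞ (deriv (deriv (deriv X))) := (contDiff_infty_iff_deriv.1 h2).2
  have hd {g : ℝ → ℝ} (hg : ContDiff ℝ ∞ g) (s : ℝ) : HasDerivAt g (deriv g s) s :=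
    ((hg.differentiable (by simp)) s).hasDerivAt
  exact ⟨hd h0, hd h1, hd h2, h3.continuous⟩

/-- On a compact interval `e^{2s}` is bounded below, so the two forms of bound in `IsProfile` differ
only in the constant. -/
lemma exists_mul_exp_bound {g : ℝ → ℝ} (hg : Continuous g) (a b : ℝ) :
    ∃ K, 0 ≤ K ∧ ∀ s ∈ Icc a b, |g s| ≤ K ∧ |g s| ≤ K * Real.exp (2 * s) := by
  obtain ⟨C, hC⟩ := isCompact_Icc.exists_bound_of_continuousOn (s := Icc a b) hg.continuousOn
  refine ⟨max C 0 + max C 0 * Real.exp (-(2 * a)), by positivity, fun s hs => ?_⟩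
  have h1 : |g s| ≤ max C 0 := (hC s hs).trans (le_max_left _ _)
  have h2 : 0 ≤ max C 0 := le_max_right _ _
  have h3 : 0 ≤ max C 0 * Real.exp (-(2 * a)) := by positivity
  refine ⟨by linarith, h1.trans ?_⟩
  have h4 : max C 0 ≤ max C 0 * Real.exp (-(2 * a)) * Real.exp (2 * s) := by
    rw [mul_assoc, ← Real.exp_add]
    refine le_mul_of_one_le_right h2 (Real.one_le_exp ?_)
    linarith [hs.1]
  rw [add_mul]
  have : 0 ≤ max C 0 * Real.exp (2 * s) := by positivity
  linarith

/-- Far to the left the cutoff is `1` and the bounds of the model solution apply; the remaining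
interval up to `log R₂` is compact. -/
theorem IsCutoff.isProfile (hχ : IsCutoff χ R₁ R₂) (hR₁ : 0 < R₁) (hR₁₂ : R₁ < R₂)
    {t : ℝ} (ht : 0 < t) {U U₁ : ℝ → ℝ} (h : IsCylSolution t U U₁) :
    let X := fun s => χ (Real.exp s)
    IsProfile (Real.log R₂) (fun s => U s * X s) (prof₁ U U₁ X) (prof₂ t U U₁ X)
      (prof₃ t U U₁ X) := by
  intro X
  obtain ⟨hX, hX1, hX2, hX3⟩ := hχ.hasDerivAt
  have cU : Continuous U := continuous_iff_continuousAt.2 fun s => (h.hasDerivAt s).continuousAt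
  have cU1 : Continuous U₁ := continuous_iff_continuousAt.2 fun s => (h.hasDerivAt₁ s).continuousAt
  have cU2 : Continuous (modelSecond t U) :=
    continuous_iff_continuousAt.2 fun s => (h.hasDerivAt₂ s).continuousAt
  have cU3 : Continuous (modelThird t U U₁) := by
    have := Real.continuous_sinh
    have := Real.continuous_cosh
    unfold modelThird; fun_prop
  have cX : Continuous X := continuous_iff_continuousAt.2 fun s => (hX s).continuousAt
  have cX1 : Continuous (deriv X) := continuous_iff_continuousAt.2 fun s => (hX1 s).continuousAt
  have cX2 : Continuous (deriv (deriv X)) :=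
    continuous_iff_continuousAt.2 fun s => (hX2 s).continuousAt
  have d0 : ∀ s, HasDerivAt (fun s => U s * X s) (prof₁ U U₁ X s) s := fun s =>
    (h.hasDerivAt s).mul (hX s)
  have d1 : ∀ s, HasDerivAt (prof₁ U U₁ X) (prof₂ t U U₁ X s) s := fun s =>
    (((h.hasDerivAt₁ s).mul (hX s)).add ((h.hasDerivAt s).mul (hX1 s))).congr_deriv
      (by simp only [prof₂, modelSecond]; ring)
  have d2 : ∀ s, HasDerivAt (prof₂ t U U₁ X) (prof₃ t U U₁ X s) s := fun s =>
    ((((h.hasDerivAt₂ s).mul (hX s)).add (((h.hasDerivAt₁ s).const_mul 2).mul (hX1 s))).add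
      ((h.hasDerivAt s).mul (hX2 s))).congr_deriv
      (by simp only [prof₃, modelSecond]; ring)
  refine ⟨d0, d1, d2, ?_, ?_, ?_, ?_⟩
  · unfold prof₃; fun_prop
  · intro s
    exact mul_nonneg (h.nonneg ht s) (hχ.mem_Icc _).1
  · intro s hs
    have hR₂ : 0 < R₂ := hR₁.trans hR₁₂
    have : X s = 0 := hχ.eq_zero _ ((Real.log_le_iff_le_exp hR₂).1 hs)
    simp [this]
  · obtain ⟨K, hK0, hK⟩ := h.exists_bound_atBot ht
    -- Left of `a` both the model bounds, valid for `s ≤ 0`, and the vanishing of the derivatives of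
    -- the cutoff, valid for `s < log R₁`, are available.
    set a := min 0 (Real.log R₁) - 1 with ha
    obtain ⟨K₁, hK₁0, hK₁⟩ := exists_mul_exp_bound (g := fun s => U s * X s + s / 2)
      (by fun_prop) a (Real.log R₂)
    obtain ⟨K₂, hK₂0, hK₂⟩ := exists_mul_exp_bound (g := fun s => prof₁ U U₁ X s + 1 / 2)
      (by unfold prof₁; fun_prop) a (Real.log R₂)
    obtain ⟨K₃, hK₃0, hK₃⟩ := exists_mul_exp_bound (g := prof₂ t U U₁ X)
      (by unfold prof₂; fun_prop) a (Real.log R₂)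
    refine ⟨K + K₁ + K₂ + K₃, by positivity, fun s hs => ?_⟩
    have he := Real.exp_pos (2 * s)
    rcases le_or_gt a s with has | has
    · have h1 := (hK₁ s ⟨has, hs⟩).1
      have h2 := (hK₂ s ⟨has, hs⟩).2
      have h3 := (hK₃ s ⟨has, hs⟩).2
      refine ⟨by linarith, h2.trans ?_, h3.trans ?_⟩ <;> gcongr <;> linarith
    · have hs0 : s ≤ 0 := by linarith [min_le_left 0 (Real.log R₁)]
      have hs1 : s < Real.log R₁ := by linarith [min_le_right 0 (Real.log R₁)]
      obtain ⟨x0, x1, x2, -⟩ := hχ.deriv_eq_zero hR₁ hs1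
      obtain ⟨k1, k2, k3⟩ := hK s hs0
      have x0' : X s = 1 := x0
      have e1 : prof₁ U U₁ X s = U₁ s := by simp only [prof₁]; rw [x0', x1]; ring
      have e2 : prof₂ t U U₁ X s = modelSecond t U s := by
        simp only [prof₂]; rw [x0', x1, x2]; ring
      rw [e1, e2, x0', mul_one]
      refine ⟨by linarith, k2.trans ?_, k3.trans ?_⟩ <;> gcongr <;> linarith

end

/-! ### The off-diagonal part of the Coulomb equation -/

lemma integrableOn_disk_of_bounded {E : Type*} [NormedAddCommGroup E]
    {g : ℂ → E} {S C : ℝ} (hg : ContinuousOn g (puncturedDisk S))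
    (hC : ∀ z ∈ puncturedDisk S, ‖g z‖ ≤ C) : IntegrableOn g (disk S) := by
  refine integrableOn_disk_of_bound (C := C * S) hg fun z hz => (hC z hz).trans ?_
  obtain ⟨h1, h2⟩ := mem_puncturedDisk.mp hz
  have h3 : 0 < ‖z‖ := norm_pos_iff.mpr h2
  have h4 : 0 ≤ C := (norm_nonneg _).trans (hC z hz)
  rw [mul_assoc]
  refine le_mul_of_one_le_right h4 ?_
  rw [← div_eq_mul_inv, one_le_div h3]
  exact h1.le

lemma puncturedDisk_subset_disk (S : ℝ) : puncturedDisk S ⊆ disk S := sdiff_subset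

lemma disk_subset_closedBall (S : ℝ) : disk S ⊆ Metric.closedBall 0 S :=
  Metric.ball_subset_closedBall

lemma hasWirtAt_of_contDiffOn_closedBall {g : ℂ → ℂ} {S : ℝ}
    (hg : ContDiffOn ℝ 2 g (Metric.closedBall 0 S)) {z : ℂ} (hz : z ∈ disk S) :
    HasWirtAt g (wirt g z) (wirtBar g z) z ∧
      HasWirtAt (wirtBar g) (wirt (wirtBar g) z) (wirtBar (wirtBar g) z) z := by
  have h1 : ContDiffOn ℝ 2 g (disk S) := hg.mono (disk_subset_closedBall S)
  have h2 : ContDiffOn ℝ 1 (wirtBar g) (disk S) :=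
    ContDiffOn.wirtBar h1 (isOpen_disk S) (m := 1) (by norm_num)
  exact ⟨((h1.contDiffAt ((isOpen_disk S).mem_nhds hz)).differentiableAt (by norm_num)).hasWirtAt,
    ((h2.contDiffAt ((isOpen_disk S).mem_nhds hz)).differentiableAt (by norm_num)).hasWirtAt⟩

/-- Weighted energy argument: `∂W` is the nonnegative function `F`, and `W` has no flux at the
origin or at the boundary. Hence `F = 0`, so `b` and `c` are holomorphic, and their zero boundary
values finish the proof. -/
theorem offDiagonal_eq_zero {S t : ℝ} (hS : 0 < S) (ht : 0 < t) {w w₁ w₂ w₃ : ℝ → ℝ}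
    (hw : IsProfile (Real.log S) w w₁ w₂ w₃) {b c : ℂ → ℂ}
    (hb : ContDiffOn ℝ 2 b (Metric.closedBall 0 S)) (hc : ContDiffOn ℝ 2 c (Metric.closedBall 0 S))
    (hb' : ∀ z ∈ puncturedDisk S, wirt (wirtBar b) z =
      (1 + 2 * w₁ (Real.log ‖z‖)) / (2 * z) * wirtBar b z
        + 2 * t ^ 2 * Real.exp (Real.log ‖z‖ + 2 * w (Real.log ‖z‖)) * (b z - z * c z))
    (hc' : ∀ z ∈ puncturedDisk S, wirt (wirtBar c) z =
      -((1 + 2 * w₁ (Real.log ‖z‖)) / (2 * z) * wirtBar c z)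
        - 2 * t ^ 2 * Real.exp (-(Real.log ‖z‖ + 2 * w (Real.log ‖z‖))) * (starRingEnd ℂ) z
          * (b z - z * c z))
    (hb0 : ∀ z : ℂ, ‖z‖ = S → b z = 0) (hc0 : ∀ z : ℂ, ‖z‖ = S → c z = 0) :
    ∀ z ∈ disk S, b z = 0 ∧ c z = 0 := by
  have ho := isOpen_puncturedDisk S
  have hpd := puncturedDisk_subset_disk S
  have hpc := hpd.trans (disk_subset_closedBall S)
  set α : ℝ → ℝ := fun s => Real.exp (-(s + 2 * w s)) with hα
  set β : ℝ → ℝ := fun s => Real.exp (s + 2 * w s) with hβ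
  have dβ : ∀ s, HasDerivAt β (β s * (1 + 2 * w₁ s)) s := fun s =>
    ((hasDerivAt_id s).add ((hw.hasDerivAt s).const_mul 2)).exp
  have dα : ∀ s, HasDerivAt α (α s * -(1 + 2 * w₁ s)) s := fun s =>
    ((hasDerivAt_id s).add ((hw.hasDerivAt s).const_mul 2)).neg.exp
  have αβ : ∀ s, (α s : ℂ) * β s = 1 := fun s => by
    rw [← Complex.ofReal_mul, hα, hβ, ← Real.exp_add]; simp
  have cβ : ContDiff ℝ 1 β := (contDiff_id.add (contDiff_const.mul hw.contDiff)).exp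
  have cα : ContDiff ℝ 1 α := (contDiff_id.add (contDiff_const.mul hw.contDiff)).neg.exp
  obtain ⟨K, -, hK⟩ := hw.bound
  -- The profile behaves like `-s/2`, so `s + 2w` is bounded: the weights stay comparable to `1` up
  -- to the origin.
  have bα : ∀ z ∈ puncturedDisk S, α (Real.log ‖z‖) ≤ Real.exp (2 * K) := fun z hz => by
    obtain ⟨h1, h2⟩ := mem_puncturedDisk.mp hz
    have h3 := abs_le.1 (hK (Real.log ‖z‖) (Real.log_le_log (norm_pos_iff.mpr h2) h1.le)).1
    exact Real.exp_le_exp.2 (by linarith [h3.1])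
  have bβ : ∀ z ∈ puncturedDisk S, β (Real.log ‖z‖) ≤ Real.exp (2 * K) := fun z hz => by
    obtain ⟨h1, h2⟩ := mem_puncturedDisk.mp hz
    have h3 := abs_le.1 (hK (Real.log ‖z‖) (Real.log_le_log (norm_pos_iff.mpr h2) h1.le)).1
    exact Real.exp_le_exp.2 (by linarith [h3.2])
  obtain ⟨Cb, hCb, bb⟩ := exists_bound_of_contDiffOn_closedBall hS hb
  obtain ⟨Cc, hCc, bc⟩ := exists_bound_of_contDiffOn_closedBall hS hc
  have cb : ContDiffOn ℝ 1 b (puncturedDisk S) := (hb.mono hpc).of_le (by norm_num)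
  have cc : ContDiffOn ℝ 1 c (puncturedDisk S) := (hc.mono hpc).of_le (by norm_num)
  have cb1 : ContDiffOn ℝ 1 (wirtBar b) (puncturedDisk S) :=
    ContDiffOn.wirtBar (hb.mono hpc) ho (m := 1) (by norm_num)
  have cc1 : ContDiffOn ℝ 1 (wirtBar c) (puncturedDisk S) :=
    ContDiffOn.wirtBar (hc.mono hpc) ho (m := 1) (by norm_num)
  have conjC : ∀ {g : ℂ → ℂ}, ContDiffOn ℝ 1 g (puncturedDisk S) →
      ContDiffOn ℝ 1 (fun z => (starRingEnd ℂ) (g z)) (puncturedDisk S) := fun hg =>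
    (Complex.conjCLE : ℂ →L[ℝ] ℂ).contDiff.comp_contDiffOn hg
  -- The derivatives of the weights cancel the first order terms of the system, and since `αβ = 1`
  -- the zeroth order terms combine to `2t²|b - zc|²`.
  set W : ℂ → ℂ := fun z => (α (Real.log ‖z‖) : ℂ) * (wirtBar b z * (starRingEnd ℂ) (b z))
    + (β (Real.log ‖z‖) : ℂ) * (wirtBar c z * (starRingEnd ℂ) (c z)) with hW
  set F : ℂ → ℝ := fun z => 2 * t ^ 2 * ‖b z - z * c z‖ ^ 2
    + α (Real.log ‖z‖) * ‖wirtBar b z‖ ^ 2 + β (Real.log ‖z‖) * ‖wirtBar c z‖ ^ 2 with hF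
  have cW : ContDiffOn ℝ 1 W (puncturedDisk S) :=
    ((contDiffOn_logNorm cα S).mul (cb1.mul (conjC cb))).add
      ((contDiffOn_logNorm cβ S).mul (cc1.mul (conjC cc)))
  have wW : ∀ z ∈ puncturedDisk S, wirt W z = (F z : ℂ) := fun z hz => by
    have hz0 := (mem_puncturedDisk.mp hz).2
    obtain ⟨hb1, hb2⟩ := hasWirtAt_of_contDiffOn_closedBall hb (hpd hz)
    obtain ⟨hc1, hc2⟩ := hasWirtAt_of_contDiffOn_closedBall hc (hpd hz)
    have h := (((hasWirtAt_logNorm hz0 (dα _)).mul (hb2.mul hb1.conj)).add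
      ((hasWirtAt_logNorm hz0 (dβ _)).mul (hc2.mul hc1.conj))).wirt
    have hb2' : wirt (wirtBar b) z = (1 + 2 * w₁ (Real.log ‖z‖)) / (2 * z) * wirtBar b z
        + 2 * t ^ 2 * (β (Real.log ‖z‖) : ℂ) * (b z - z * c z) := hb' z hz
    have hc2' : wirt (wirtBar c) z = -((1 + 2 * w₁ (Real.log ‖z‖)) / (2 * z) * wirtBar c z)
        - 2 * t ^ 2 * (α (Real.log ‖z‖) : ℂ) * (starRingEnd ℂ) z * (b z - z * c z) := hc' z hz
    have e1 := αβ (Real.log ‖z‖)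
    refine h.trans ?_
    rw [hb2', hc2']
    simp only [hF]
    push_cast
    simp only [← conj_mul_self, map_sub, map_mul]
    linear_combination (2 * (t : ℂ) ^ 2 * (b z - z * c z) *
      ((starRingEnd ℂ) (b z) - (starRingEnd ℂ) z * (starRingEnd ℂ) (c z))) * e1
  have αpos : ∀ s, 0 < α s := fun s => Real.exp_pos _
  have βpos : ∀ s, 0 < β s := fun s => Real.exp_pos _
  have F0 : ∀ z, 0 ≤ F z := fun z => by
    have := αpos (Real.log ‖z‖)
    have := βpos (Real.log ‖z‖)
    positivity
  have clog : ContinuousOn (fun z : ℂ => Real.log ‖z‖) (puncturedDisk S) :=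
    continuous_norm.continuousOn.log fun z hz =>
      norm_ne_zero_iff.mpr (mem_puncturedDisk.mp hz).2
  have cF : ContinuousOn F (puncturedDisk S) :=
    ((continuousOn_const.mul ((cb.continuousOn.sub
      (continuousOn_id.mul cc.continuousOn)).norm.pow 2)).add
      ((cα.continuous.comp_continuousOn clog).mul (cb1.continuousOn.norm.pow 2))).add
      ((cβ.continuous.comp_continuousOn clog).mul (cc1.continuousOn.norm.pow 2))
  have iF : IntegrableOn F (disk S) := by
    refine integrableOn_disk_of_bounded (C := 2 * t ^ 2 * (Cb + S * Cc) ^ 2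
      + Real.exp (2 * K) * Cb ^ 2 + Real.exp (2 * K) * Cc ^ 2) cF fun z hz => ?_
    rw [Real.norm_of_nonneg (F0 z)]
    have h1 := bb z (hpd hz)
    have h2 := bc z (hpd hz)
    have h3 := (mem_puncturedDisk.mp hz).1
    have h4 : ‖b z - z * c z‖ ≤ Cb + S * Cc := by
      refine (norm_sub_le _ _).trans ?_
      rw [norm_mul]
      gcongr
      exacts [h1.1, h2.1]
    simp only [hF]
    gcongr
    exacts [bα z hz, h1.2, bβ z hz, h2.2]
  have iW : IntegrableOn (wirt W) (disk S) := by
    rw [← integrableOn_congr_set_ae (disk_ae_eq_puncturedDisk S)] at iF ⊢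
    exact IntegrableOn.congr_fun iF.ofReal (fun z hz => (wW z hz).symm) ho.measurableSet
  have nW : ∀ z ∈ puncturedDisk S, ‖W z‖ ≤ Real.exp (2 * K) * (Cb + Cc) * (‖b z‖ + ‖c z‖) := by
    intro z hz
    refine (norm_add_le _ _).trans ?_
    simp only [norm_mul, RCLike.norm_conj, Complex.norm_real, Real.norm_of_nonneg (αpos _).le,
      Real.norm_of_nonneg (βpos _).le]
    have h1 := bb z (hpd hz)
    have h2 := bc z (hpd hz)
    have h5 : α (Real.log ‖z‖) * (‖wirtBar b z‖ * ‖b z‖) ≤ Real.exp (2 * K) * (Cb * ‖b z‖) := by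
      gcongr
      exacts [bα z hz, h1.2]
    have h6 : β (Real.log ‖z‖) * (‖wirtBar c z‖ * ‖c z‖) ≤ Real.exp (2 * K) * (Cc * ‖c z‖) := by
      gcongr
      exacts [bβ z hz, h2.2]
    have h7 : 0 ≤ Real.exp (2 * K) * (Cc * ‖b z‖ + Cb * ‖c z‖) := by positivity
    linarith
  have key : ∫ z in disk S, wirt W z = 0 := by
    refine integral_disk_wirt_eq_zero (C := Real.exp (2 * K) * (Cb + Cc) * (1 + (Cb + Cc)))
      (G := fun z => ‖b z‖ + ‖c z‖) hS (by positivity) cW iW (fun z hz => ?_) (fun z hz => ?_) ?_ ?_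
    · refine (nW z hz).trans (mul_le_mul_of_nonneg_left ?_ (by positivity))
      linarith [(bb z (hpd hz)).1, (bc z (hpd hz)).1]
    · refine (nW z hz).trans (mul_le_mul_of_nonneg_right ?_ (by positivity))
      exact le_mul_of_one_le_right (by positivity) (by linarith)
    · exact ((hb.continuousOn.norm).add (hc.continuousOn.norm)).mono sdiff_subset
    · intro z hz
      simp [hb0 z hz, hc0 z hz]
  have key2 : ∫ z in disk S, F z = 0 := by
    rw [← setIntegral_congr_set (disk_ae_eq_puncturedDisk S),
      setIntegral_congr_fun ho.measurableSet wW, integral_complex_ofReal,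
      setIntegral_congr_set (disk_ae_eq_puncturedDisk S)] at key
    exact_mod_cast key
  have hF0 := eq_zero_of_integral_eq_zero cF (fun z _ => F0 z) iF key2
  have hz0 : ∀ z ∈ puncturedDisk S, wirtBar b z = 0 ∧ wirtBar c z = 0 := fun z hz => by
    have h := hF0 z hz
    have h1 := αpos (Real.log ‖z‖)
    have h2 := βpos (Real.log ‖z‖)
    have p1 : 0 ≤ 2 * t ^ 2 * ‖b z - z * c z‖ ^ 2 := by positivity
    have p2 : 0 ≤ α (Real.log ‖z‖) * ‖wirtBar b z‖ ^ 2 := by positivity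
    have p3 : 0 ≤ β (Real.log ‖z‖) * ‖wirtBar c z‖ ^ 2 := by positivity
    simp only [hF] at h
    have q2 : α (Real.log ‖z‖) * ‖wirtBar b z‖ ^ 2 = 0 := by linarith
    have q3 : β (Real.log ‖z‖) * ‖wirtBar c z‖ ^ 2 = 0 := by linarith
    exact ⟨by simpa [h1.ne'] using q2, by simpa [h2.ne'] using q3⟩
  exact fun z hz => ⟨eq_zero_of_wirtBar_eq_zero hS hb (fun z hz => (hz0 z hz).1) hb0 z hz,
    eq_zero_of_wirtBar_eq_zero hS hc (fun z hz => (hz0 z hz).2) hc0 z hz⟩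

/-! ### The entries of the Coulomb equation -/

section
variable {t R S : ℝ} {u χ : ℝ → ℝ} {P : ℂ → ℂ} {ν : ℂ → Mat}

/-- The metric is diagonal while `φ` and `φ̇` are off-diagonal, so the diagonal entry of `ν`
decouples from the other two. -/
lemma FormalCoulomb.entries (h : FormalCoulomb (puncturedDisk S) (hApp u χ)
      (fun z => (t : ℂ) • higgs z) (fun _ => 0) (fun z => (t : ℂ) • upper P z) ν)
    {w w₁ : ℝ → ℝ} (hw : ∀ s, w s = u (Real.exp s) * χ (Real.exp s))
    (hd : ∀ s, HasDerivAt w (w₁ s) s) {z : ℂ} (hz : z ∈ puncturedDisk S)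
    (htr : (ν z).trace = 0) :
    wirt (wirtBar fun y => ν y 0 0) z = t ^ 2 *
        (2 * Real.exp (Real.log ‖z‖ + 2 * w (Real.log ‖z‖)) * ν z 0 0
          + Real.exp (-(Real.log ‖z‖ + 2 * w (Real.log ‖z‖))) * (starRingEnd ℂ) z
            * (P z + 2 * z * ν z 0 0)) ∧
    wirt (wirtBar fun y => ν y 0 1) z =
      (1 + 2 * w₁ (Real.log ‖z‖)) / (2 * z) * wirtBar (fun y => ν y 0 1) z
        + 2 * t ^ 2 * Real.exp (Real.log ‖z‖ + 2 * w (Real.log ‖z‖)) * (ν z 0 1 - z * ν z 1 0) ∧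
    wirt (wirtBar fun y => ν y 1 0) z =
      -((1 + 2 * w₁ (Real.log ‖z‖)) / (2 * z) * wirtBar (fun y => ν y 1 0) z)
        - 2 * t ^ 2 * Real.exp (-(Real.log ‖z‖ + 2 * w (Real.log ‖z‖))) * (starRingEnd ℂ) z
          * (ν z 0 1 - z * ν z 1 0) := by
  have hz0 := (mem_puncturedDisk.mp hz).2
  have hr : 0 < ‖z‖ := norm_pos_iff.mpr hz0
  have hd' : HasDerivAt (fun s => u (Real.exp s) * χ (Real.exp s)) (w₁ (Real.log ‖z‖))
      (Real.log ‖z‖) := by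
    simpa only [funext hw] using hd (Real.log ‖z‖)
  have hwz : u ‖z‖ * χ ‖z‖ = w (Real.log ‖z‖) := by rw [hw, Real.exp_log hr]
  have e1 : Real.exp (Real.log ‖z‖ + 2 * w (Real.log ‖z‖))
      = ‖z‖ * Real.exp (2 * w (Real.log ‖z‖)) := by rw [Real.exp_add, Real.exp_log hr]
  have e2 : Real.exp (-(Real.log ‖z‖ + 2 * w (Real.log ‖z‖)))
      = ‖z‖⁻¹ * Real.exp (-(2 * w (Real.log ‖z‖))) := by
    rw [neg_add, Real.exp_add, Real.exp_neg (Real.log _), Real.exp_log hr]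
  have ht := apply_one_one_of_trace htr
  have h := h z hz
  rw [hApp, chernDz_diagMetric (fun r => u r * χ r) hz0 hd', adj_diagMetric _ hz0, hwz, lie_eq,
    lie_eq] at h
  have h00 := congrFun (congrFun h 0) 0
  have h01 := congrFun (congrFun h 0) 1
  have h10 := congrFun (congrFun h 1) 0
  simp only [e1, e2]
  simp [higgs, upper, matDzBar, ht] at h00 h01 h10 ⊢
  refine ⟨?_, ?_, ?_⟩
  · linear_combination h00
  · linear_combination h01
  · linear_combination h10

lemma nuInf_isDiag (P : ℂ → ℂ) (z : ℂ) : (nuInf P z).IsDiag := by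
  intro i j hij
  fin_cases i <;> fin_cases j <;> simp_all [nuInf]

theorem IsAppVariation.isDiag (h : IsAppVariation t R S u χ P ν) (hS : 0 < S) (hSR : S < R)
    (ht : 0 < t) {w w₁ w₂ w₃ : ℝ → ℝ} (hw : ∀ s, w s = u (Real.exp s) * χ (Real.exp s))
    (hp : IsProfile (Real.log S) w w₁ w₂ w₃) : ∀ z ∈ disk R, (ν z).IsDiag := by
  have hout : ∀ z : ℂ, ‖z‖ = S → ν z = nuInf P z := fun z hz =>
    h.outer z (mem_disk.mpr (hz.trans_lt hSR)) hz.ge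
  have hent : ∀ z ∈ puncturedDisk S, _ := fun z hz =>
    h.coulomb.entries hw hp.hasDerivAt hz
      (h.traceless z (mem_disk.mpr ((mem_puncturedDisk.mp hz).1.trans hSR)))
  have key := offDiagonal_eq_zero hS ht hp (h.contDiffOn 0 1) (h.contDiffOn 1 0)
    (fun z hz => (hent z hz).2.1) (fun z hz => (hent z hz).2.2)
    (fun z hz => by rw [hout z hz]; simp [nuInf]) (fun z hz => by rw [hout z hz]; simp [nuInf])
  intro z hz
  rcases lt_or_ge ‖z‖ S with hzS | hzS
  · obtain ⟨h1, h2⟩ := key z (mem_disk.mpr hzS)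
    intro i j hij
    fin_cases i <;> fin_cases j <;> simp_all
  · rw [h.outer z hz hzS]
    exact nuInf_isDiag P z

/-! ### The densities -/

lemma rayDensity_hApp {w : ℝ → ℝ} (hw : ∀ s, w s = u (Real.exp s) * χ (Real.exp s)) {z : ℂ}
    (hz : z ≠ 0) (htr : (ν z).trace = 0) :
    rayDensity t (hApp u χ) P ν z = 2 * t ^ 2 *
      Real.exp (-(Real.log ‖z‖ + 2 * w (Real.log ‖z‖))) * (P z + 2 * z * ν z 0 0)
        * (starRingEnd ℂ) (P z) := by
  have hr : 0 < ‖z‖ := norm_pos_iff.mpr hz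
  have hwz : u ‖z‖ * χ ‖z‖ = w (Real.log ‖z‖) := by rw [hw, Real.exp_log hr]
  have e2 : Real.exp (-(Real.log ‖z‖ + 2 * w (Real.log ‖z‖)))
      = ‖z‖⁻¹ * Real.exp (-(2 * w (Real.log ‖z‖))) := by
    rw [neg_add, Real.exp_add, Real.exp_neg (Real.log _), Real.exp_log hr]
  have ht := apply_one_one_of_trace htr
  rw [rayDensity, normDensity, hApp, adj_diagMetric _ hz, adj_diagMetric _ hz, hwz, lie_eq, e2]
  simp [higgs, upper, Matrix.trace_fin_two, Matrix.mul_apply, Fin.sum_univ_two, ht]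
  ring

lemma rayDensity_nuInf {z : ℂ} (hz : z ≠ 0) :
    rayDensity t hInf P (nuInf P) z = t ^ 2 * (‖z‖ : ℂ)⁻¹ * P z * (starRingEnd ℂ) (P z) := by
  have h := rayDensity_hApp (t := t) (u := fun _ => 0) (χ := fun _ => 0) (P := P) (ν := nuInf P)
    (w := fun _ => 0) (fun _ => by simp) hz (by simp [nuInf, Matrix.trace_fin_two])
  have e : hApp (fun _ => 0) (fun _ => 0) = hInf := by simp [hApp, hInf]
  rw [e] at h
  rw [h]
  have hr : 0 < ‖z‖ := norm_pos_iff.mpr hz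
  -- Projecting `φ̇` to the direction of `φ` leaves half of its upper right entry.
  have h1 : P z + 2 * z * nuInf P z 0 0 = P z / 2 := by
    simp [nuInf]
    field_simp
    ring
  rw [mul_zero, add_zero, Real.exp_neg, Real.exp_log hr, h1]
  push_cast
  ring

end

/-! ### The diagonal part of the Coulomb equation -/

/-- `-(P + 2 ξ w₁) / 4z`, which solves the diagonal Coulomb equation where the radial profile
solves the model equation. -/
def ansatz (w₁ : ℝ → ℝ) (P ξ : ℂ → ℂ) (z : ℂ) : ℂ :=
  -(z⁻¹ * (P z + 2 * ξ z * w₁ (Real.log ‖z‖))) / 4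

/-- `∂̄` of the ansatz. -/
def ansatzBar (w₂ : ℝ → ℝ) (ξ : ℂ → ℂ) (z : ℂ) : ℂ :=
  -(1 / 4) * (ξ z * (w₂ (Real.log ‖z‖) * Real.exp (-(2 * Real.log ‖z‖)) : ℝ))

/-- The failure of the ansatz to solve the diagonal Coulomb equation. -/
def defect (t : ℝ) (w w₁ w₂ w₃ : ℝ → ℝ) (P ξ : ℂ → ℂ) (z : ℂ) : ℂ :=
  t ^ 2 * (‖z‖ * z⁻¹) * (-(P z * Real.sinh (2 * w (Real.log ‖z‖)))
      - 2 * ξ z * w₁ (Real.log ‖z‖) * Real.cosh (2 * w (Real.log ‖z‖)))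
    + deriv ξ z / 4 * (w₂ (Real.log ‖z‖) * Real.exp (-(2 * Real.log ‖z‖)))
    + ξ z * z⁻¹ * ((w₃ (Real.log ‖z‖) - 2 * w₂ (Real.log ‖z‖))
      * Real.exp (-(2 * Real.log ‖z‖))) / 8

/-- `n` is the upper left entry of the metric variation; `ξ` solves `2 z ξ' + ξ = P`. -/
structure IsDiagonalSolution (t S ρ : ℝ) (w w₁ w₂ w₃ : ℝ → ℝ) (P ξ n : ℂ → ℂ) : Prop where
  t_pos : 0 < t
  S_pos : 0 < S
  S_lt : S < ρ
  profile : IsProfile (Real.log S) w w₁ w₂ w₃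
  holP : DifferentiableOn ℂ P (disk ρ)
  holξ : DifferentiableOn ℂ ξ (disk ρ)
  euler : ∀ z ∈ disk ρ, 2 * z * deriv ξ z + ξ z = P z
  contDiffOn : ContDiffOn ℝ 2 n (Metric.closedBall 0 S)
  eqn : ∀ z ∈ puncturedDisk S, wirt (wirtBar n) z = t ^ 2 *
        (2 * Real.exp (Real.log ‖z‖ + 2 * w (Real.log ‖z‖)) * n z
          + Real.exp (-(Real.log ‖z‖ + 2 * w (Real.log ‖z‖))) * (starRingEnd ℂ) z
            * (P z + 2 * z * n z))
  sphere : ∀ z : ℂ, ‖z‖ = S → n z = -(P z / (4 * z))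

lemma exists_bound_closedBall {g : ℂ → ℂ} {S ρ : ℝ} (hS : S < ρ) (hg : ContinuousOn g (disk ρ)) :
    ∃ C, 0 ≤ C ∧ ∀ z : ℂ, ‖z‖ ≤ S → ‖g z‖ ≤ C := by
  obtain ⟨C, hC⟩ := (isCompact_closedBall (0 : ℂ) S).exists_bound_of_continuousOn
    (hg.mono (Metric.closedBall_subset_ball hS))
  exact ⟨max C 0, le_max_right _ _, fun z hz =>
    (hC z (by simpa using hz)).trans (le_max_left _ _)⟩

lemma continuousOn_log_norm {A : Set ℂ} (hA : ∀ z ∈ A, z ≠ 0) :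
    ContinuousOn (fun z : ℂ => Real.log ‖z‖) A :=
  continuous_norm.continuousOn.log fun z hz => norm_ne_zero_iff.mpr (hA z hz)

lemma exp_neg_two_log {z : ℂ} (hz : z ≠ 0) :
    Real.exp (-(2 * Real.log ‖z‖)) = (‖z‖ ^ 2)⁻¹ := by
  have hr : 0 < ‖z‖ := norm_pos_iff.mpr hz
  rw [Real.exp_neg, two_mul, Real.exp_add, Real.exp_log hr, sq]

lemma exp_log_add {z : ℂ} (hz : z ≠ 0) (x : ℝ) :
    Real.exp (Real.log ‖z‖ + x) = ‖z‖ * Real.exp x := by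
  rw [Real.exp_add, Real.exp_log (norm_pos_iff.mpr hz)]

lemma exp_neg_log_add {z : ℂ} (hz : z ≠ 0) (x : ℝ) :
    Real.exp (-(Real.log ‖z‖ + x)) = ‖z‖⁻¹ * Real.exp (-x) := by
  rw [neg_add, Real.exp_add, Real.exp_neg, Real.exp_log (norm_pos_iff.mpr hz)]

namespace IsDiagonalSolution

variable {t S ρ : ℝ} {w w₁ w₂ w₃ : ℝ → ℝ} {P ξ n : ℂ → ℂ}
  (h : IsDiagonalSolution t S ρ w w₁ w₂ w₃ P ξ n)

include h

lemma dξ : DifferentiableOn ℂ (deriv ξ) (disk ρ) := h.holξ.deriv (isOpen_disk ρ)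

lemma punctured_subset : puncturedDisk S ⊆ disk ρ :=
  (puncturedDisk_subset_disk S).trans (Metric.ball_subset_ball h.S_lt.le)

/-- `P`, `ξ` and `1/z` are holomorphic off the origin, so `∂̄` falls only on `w₁(log|z|)`. -/
lemma hasWirtAt_ansatz {z : ℂ} (hz : z ∈ puncturedDisk S) :
    ∃ a, HasWirtAt (ansatz w₁ P ξ) a (ansatzBar w₂ ξ z) z := by
  have hz0 := (mem_puncturedDisk.mp hz).2
  have hc0 : (starRingEnd ℂ) z ≠ 0 := by simpa using hz0
  have hP := (h.holP.hasDerivAt_of_isOpen (isOpen_disk ρ) (h.punctured_subset hz)).hasWirtAt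
  have hξ := (h.holξ.hasDerivAt_of_isOpen (isOpen_disk ρ) (h.punctured_subset hz)).hasWirtAt
  have h1 := ((hasWirtAt_inv hz0).mul (hP.add ((hξ.const_mul 2).mul
    (hasWirtAt_logNorm hz0 (h.profile.hasDerivAt₁ _))))).const_mul (-(1 / 4))
  refine ⟨_, (h1.congr_of_eventuallyEq (f := ansatz w₁ P ξ)
    (Eventually.of_forall fun y => ?_)).congr_coeff rfl ?_⟩
  · simp only [ansatz]; ring
  · rw [ansatzBar, exp_neg_two_log hz0]
    push_cast
    rw [← conj_mul_self]
    field_simp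
    ring

lemma hasWirtAt_ansatzBar {z : ℂ} (hz : z ∈ puncturedDisk S) :
    ∃ b, HasWirtAt (ansatzBar w₂ ξ)
      (-(deriv ξ z / 4 * (w₂ (Real.log ‖z‖) * Real.exp (-(2 * Real.log ‖z‖)))
        + ξ z * z⁻¹ * ((w₃ (Real.log ‖z‖) - 2 * w₂ (Real.log ‖z‖))
          * Real.exp (-(2 * Real.log ‖z‖))) / 8)) b z := by
  have hz0 := (mem_puncturedDisk.mp hz).2
  have hξ := (h.holξ.hasDerivAt_of_isOpen (isOpen_disk ρ) (h.punctured_subset hz)).hasWirtAt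
  have hd : HasDerivAt (fun s => w₂ s * Real.exp (-(2 * s)))
      ((w₃ (Real.log ‖z‖) - 2 * w₂ (Real.log ‖z‖)) * Real.exp (-(2 * Real.log ‖z‖)))
      (Real.log ‖z‖) :=
    ((h.profile.hasDerivAt₂ _).mul
      (((hasDerivAt_id (Real.log ‖z‖)).const_mul 2).neg.exp)).congr_deriv (by simp; ring)
  refine ⟨_, ((hξ.mul (hasWirtAt_logNorm hz0 hd)).const_mul (-(1 / 4))).congr_coeff ?_ rfl⟩
  push_cast
  field_simp
  ring

/-- The linear equation for the error: its potential `4t²|z| cosh 2w` is nonnegative, and the defect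
enters as the source. -/
lemma defect_eq {z : ℂ} (hz : z ∈ puncturedDisk S) :
    ∃ b, HasWirtAt (fun y => wirtBar n y - ansatzBar w₂ ξ y)
      (4 * t ^ 2 * ‖z‖ * Real.cosh (2 * w (Real.log ‖z‖)) * (n z - ansatz w₁ P ξ z)
        + defect t w w₁ w₂ w₃ P ξ z) b z := by
  have hz0 := (mem_puncturedDisk.mp hz).2
  have hr := norm_ne_zero_of_ne hz0
  obtain ⟨b, hb⟩ := h.hasWirtAt_ansatzBar hz
  have hn := (hasWirtAt_of_contDiffOn_closedBall h.contDiffOn (puncturedDisk_subset_disk S hz)).2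
  refine ⟨_, (hn.sub hb).congr_coeff ?_ rfl⟩
  rw [h.eqn z hz, exp_log_add hz0, exp_neg_log_add hz0, defect, ansatz, Real.cosh_eq,
    Real.sinh_eq, conj_eq_div hz0]
  push_cast
  field_simp
  ring

lemma exists_bounds : ∃ C, 0 ≤ C ∧ ∀ z : ℂ, ‖z‖ ≤ S → ‖P z‖ ≤ C ∧ ‖ξ z‖ ≤ C ∧ ‖deriv ξ z‖ ≤ C := by
  obtain ⟨C₁, h1, b1⟩ := exists_bound_closedBall h.S_lt h.holP.continuousOn
  obtain ⟨C₂, h2, b2⟩ := exists_bound_closedBall h.S_lt h.holξ.continuousOn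
  obtain ⟨C₃, h3, b3⟩ := exists_bound_closedBall h.S_lt h.dξ.continuousOn
  exact ⟨C₁ + C₂ + C₃, by positivity, fun z hz =>
    ⟨by linarith [b1 z hz], by linarith [b2 z hz], by linarith [b3 z hz]⟩⟩

/-- Substituting `P = 2zξ' + ξ` exposes the factor `w₁ + 1/2`, which vanishes like `|z|²` at the
origin and cancels the pole. -/
lemma ansatz_eq {z : ℂ} (hz0 : z ≠ 0) (hz : z ∈ disk ρ) :
    ansatz w₁ P ξ z = -(deriv ξ z) / 2 - ξ z * z⁻¹ * (w₁ (Real.log ‖z‖) + 1 / 2 : ℝ) / 2 := by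
  rw [ansatz, ← h.euler z hz]
  push_cast
  field_simp
  ring

lemma exists_error_bound : ∃ C, 0 ≤ C ∧ ∀ z ∈ puncturedDisk S, ‖n z - ansatz w₁ P ξ z‖ ≤ C ∧
    ‖wirtBar n z - ansatzBar w₂ ξ z‖ ≤ C := by
  obtain ⟨A, hA, bA⟩ := h.exists_bounds
  obtain ⟨N, hN, bN⟩ := exists_bound_of_contDiffOn_closedBall h.S_pos h.contDiffOn
  obtain ⟨K, hK, bK⟩ := h.profile.bound
  have hS := h.S_pos
  refine ⟨N + A + A * K * S + A * K, by positivity, fun z hz => ?_⟩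
  obtain ⟨hzS, hz0⟩ := mem_puncturedDisk.mp hz
  have hr : 0 < ‖z‖ := norm_pos_iff.mpr hz0
  obtain ⟨-, k1, k2⟩ := bK (Real.log ‖z‖) (Real.log_le_log hr hzS.le)
  obtain ⟨-, a2, a3⟩ := bA z hzS.le
  obtain ⟨n1, n2⟩ := bN z (puncturedDisk_subset_disk S hz)
  have e2 : Real.exp (2 * Real.log ‖z‖) = ‖z‖ ^ 2 := by
    rw [two_mul, Real.exp_add, Real.exp_log hr, sq]
  rw [e2] at k1 k2
  have m1 : ‖ansatz w₁ P ξ z‖ ≤ A + A * K * S := by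
    rw [h.ansatz_eq hz0 (h.punctured_subset hz)]
    refine (norm_sub_le _ _).trans ?_
    simp only [norm_div, norm_neg, norm_mul, norm_inv, Complex.norm_real, Complex.norm_ofNat,
      Real.norm_eq_abs]
    have : ‖ξ z‖ * ‖z‖⁻¹ * |w₁ (Real.log ‖z‖) + 1 / 2| ≤ A * ‖z‖⁻¹ * (K * ‖z‖ ^ 2) := by gcongr
    have e : A * ‖z‖⁻¹ * (K * ‖z‖ ^ 2) = A * K * ‖z‖ := by field_simp
    have : A * K * ‖z‖ ≤ A * K * S := by gcongr
    have : 0 ≤ A * K * S := by positivity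
    linarith
  have m2 : ‖ansatzBar w₂ ξ z‖ ≤ A * K := by
    rw [ansatzBar, exp_neg_two_log hz0]
    simp only [norm_mul, norm_neg, Complex.norm_real, Real.norm_eq_abs, norm_div, norm_one,
      Complex.norm_ofNat]
    have : |(‖z‖ ^ 2)⁻¹| = (‖z‖ ^ 2)⁻¹ := abs_of_nonneg (by positivity)
    rw [this]
    have e : ‖ξ z‖ * (|w₂ (Real.log ‖z‖)| * (‖z‖ ^ 2)⁻¹) ≤ A * (K * ‖z‖ ^ 2 * (‖z‖ ^ 2)⁻¹) := by
      gcongr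
    have e' : A * (K * ‖z‖ ^ 2 * (‖z‖ ^ 2)⁻¹) = A * K := by field_simp
    have : 0 ≤ A * K := by positivity
    linarith
  have : 0 ≤ A * K := by positivity
  have : 0 ≤ A * K * S := by positivity
  exact ⟨(norm_sub_le _ _).trans (by linarith), (norm_sub_le _ _).trans (by linarith)⟩

/-- `w` vanishes to the right of `log S`, and the one-sided derivative determines the two-sided one.
Together with the prescribed boundary value of `n`, this makes the error vanish on the circle. -/
lemma deriv_profile_eq_zero : w₁ (Real.log S) = 0 := by
  have h1 : HasDerivWithinAt w 0 (Ici (Real.log S)) (Real.log S) :=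
    (hasDerivWithinAt_const _ _ (0 : ℝ)).congr (fun s hs => h.profile.eq_zero s hs)
      (h.profile.eq_zero _ le_rfl)
  exact (uniqueDiffOn_Ici (Real.log S) _ self_mem_Ici).eq_deriv _
    (h.profile.hasDerivAt _).hasDerivWithinAt h1

lemma error_sphere {z : ℂ} (hz : ‖z‖ = S) : n z - ansatz w₁ P ξ z = 0 := by
  have hz0 : z ≠ 0 := norm_ne_zero_iff.1 (hz ▸ h.S_pos.ne')
  rw [h.sphere z hz, ansatz, hz, h.deriv_profile_eq_zero]
  simp
  field_simp
  ring

lemma continuousOn_error :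
    ContinuousOn (fun z => n z - ansatz w₁ P ξ z) (Metric.closedBall 0 S \ {0}) := by
  have hs : Metric.closedBall (0 : ℂ) S \ {0} ⊆ disk ρ :=
    sdiff_subset.trans (Metric.closedBall_subset_ball h.S_lt)
  have hlog : ContinuousOn (fun z : ℂ => Real.log ‖z‖) (Metric.closedBall 0 S \ {0}) :=
    continuousOn_log_norm fun z hz => hz.2
  have hw1 : ContinuousOn (fun z : ℂ => ((w₁ (Real.log ‖z‖) : ℝ) : ℂ))
      (Metric.closedBall 0 S \ {0}) :=
    Complex.continuous_ofReal.comp_continuousOn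
      (h.profile.contDiff₁.continuous.comp_continuousOn hlog)
  have hinv : ContinuousOn (fun z : ℂ => z⁻¹) (Metric.closedBall 0 S \ {0}) :=
    continuousOn_id.inv₀ fun z hz => hz.2
  exact (h.contDiffOn.continuousOn.mono sdiff_subset).sub
    (((hinv.mul ((h.holP.continuousOn.mono hs).add ((continuousOn_const.mul
      (h.holξ.continuousOn.mono hs)).mul hw1))).neg).div_const 4)

end IsDiagonalSolution

/-! ### The energy estimate for the error of the ansatz -/

lemma ContDiffOn.conj {g : ℂ → ℂ} {A : Set ℂ} {m : WithTop ℕ∞} (hg : ContDiffOn ℝ m g A) :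
    ContDiffOn ℝ m (fun z => (starRingEnd ℂ) (g z)) A :=
  (Complex.conjCLE : ℂ →L[ℝ] ℂ).contDiff.comp_contDiffOn hg

lemma contDiffOn_of_holomorphic {g : ℂ → ℂ} {A : Set ℂ} {m : WithTop ℕ∞}
    (hg : DifferentiableOn ℂ g A) (hA : IsOpen A) : ContDiffOn ℝ m g A :=
  (hg.contDiffOn hA).restrict_scalars ℝ

namespace IsDiagonalSolution

variable {t S ρ : ℝ} {w w₁ w₂ w₃ : ℝ → ℝ} {P ξ n : ℂ → ℂ}
  (h : IsDiagonalSolution t S ρ w w₁ w₂ w₃ P ξ n)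

include h

lemma contDiffOn_error : ContDiffOn ℝ 1 (fun z => n z - ansatz w₁ P ξ z) (puncturedDisk S) := by
  have hn : ContDiffOn ℝ 1 n (puncturedDisk S) := (h.contDiffOn.mono
    ((puncturedDisk_subset_disk S).trans (disk_subset_closedBall S))).of_le (by norm_num)
  have hP := (contDiffOn_of_holomorphic (m := 1) h.holP (isOpen_disk ρ)).mono h.punctured_subset
  have hξ := (contDiffOn_of_holomorphic (m := 1) h.holξ (isOpen_disk ρ)).mono h.punctured_subset
  have hi : ContDiffOn ℝ 1 (fun z : ℂ => z⁻¹) (puncturedDisk S) :=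
    contDiffOn_id.inv fun z hz => (mem_puncturedDisk.mp hz).2
  exact hn.sub ((hi.mul (hP.add ((contDiffOn_const.mul hξ).mul
    (contDiffOn_logNorm h.profile.contDiff₁ S)))).neg.div_const 4)

lemma contDiffOn_errorBar :
    ContDiffOn ℝ 1 (fun z => wirtBar n z - ansatzBar w₂ ξ z) (puncturedDisk S) := by
  have hn : ContDiffOn ℝ 1 (wirtBar n) (puncturedDisk S) := ContDiffOn.wirtBar (h.contDiffOn.mono
    ((puncturedDisk_subset_disk S).trans (disk_subset_closedBall S))) (isOpen_puncturedDisk S)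
      (m := 1) (by norm_num)
  have hξ := (contDiffOn_of_holomorphic (m := 1) h.holξ (isOpen_disk ρ)).mono h.punctured_subset
  have he : ContDiff ℝ 1 fun s => w₂ s * Real.exp (-(2 * s)) :=
    h.profile.contDiff₂.mul (contDiff_const.mul contDiff_id).neg.exp
  exact hn.sub (contDiffOn_const.mul (hξ.mul (contDiffOn_logNorm he S)))

/-- Testing the error equation with `ē` gives `∂(ē D) = |D|² + 4t²|z| cosh(2w)|e|² + ē E`, where `D
= ∂̄e` and `E` is the defect. The left side integrates to zero, since `ē D` is bounded at the origin
and `e` vanishes on the circle. -/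
theorem energy_estimate {M R₁ : ℝ} (hR₁ : 0 < R₁)
    (hM : ∀ z ∈ puncturedDisk S, ‖defect t w w₁ w₂ w₃ P ξ z‖ ≤ M)
    (h0 : ∀ z ∈ puncturedDisk S, ‖z‖ < R₁ → defect t w w₁ w₂ w₃ P ξ z = 0) :
    IntegrableOn (fun z => ‖z‖ * ‖n z - ansatz w₁ P ξ z‖ ^ 2) (disk S) ∧
    ∫ z in disk S, ‖z‖ * ‖n z - ansatz w₁ P ξ z‖ ^ 2 ≤
      M ^ 2 * volume.real (disk S) / (16 * t ^ 4 * R₁) := by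
  have ho := isOpen_puncturedDisk S
  have ht := h.t_pos
  have hS := h.S_pos
  have hz1 : (S / 2 : ℂ) ∈ puncturedDisk S := by
    rw [mem_puncturedDisk]
    refine ⟨?_, by simpa using hS.ne'⟩
    rw [norm_div, Complex.norm_real, Real.norm_of_nonneg hS.le, Complex.norm_ofNat]
    linarith
  have hM0 : 0 ≤ M := (norm_nonneg _).trans (hM _ hz1)
  obtain ⟨C, hC, bC⟩ := h.exists_error_bound
  obtain ⟨K, hK, bK⟩ := h.profile.bound
  have ce := h.contDiffOn_error
  have cD := h.contDiffOn_errorBar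
  set e : ℂ → ℂ := fun z => n z - ansatz w₁ P ξ z with he
  set D : ℂ → ℂ := fun z => wirtBar n z - ansatzBar w₂ ξ z with hD
  set E : ℂ → ℂ := defect t w w₁ w₂ w₃ P ξ with hE
  set W : ℂ → ℂ := fun z => (starRingEnd ℂ) (e z) * D z with hW
  have cW : ContDiffOn ℝ 1 W (puncturedDisk S) := (ContDiffOn.conj ce).mul cD
  have wW : ∀ z ∈ puncturedDisk S, wirt W z = ((‖D z‖ ^ 2
      + 4 * t ^ 2 * (‖z‖ * Real.cosh (2 * w (Real.log ‖z‖))) * ‖e z‖ ^ 2 : ℝ) : ℂ)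
        + (starRingEnd ℂ) (e z) * E z := fun z hz => by
    have hn := (hasWirtAt_of_contDiffOn_closedBall h.contDiffOn
      (puncturedDisk_subset_disk S hz)).1
    obtain ⟨a, ha⟩ := h.hasWirtAt_ansatz hz
    obtain ⟨b, hb⟩ := h.defect_eq hz
    refine (((hn.sub ha).conj.mul hb).wirt).trans ?_
    push_cast
    simp only [← conj_mul_self]
    ring
  -- `e^{2w}` grows only like `1/|z|`, so the potential stays bounded.
  have hcosh : ∀ z ∈ puncturedDisk S, ‖z‖ * Real.cosh (2 * w (Real.log ‖z‖)) ≤ Real.exp (2 * K) :=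
    fun z hz => by
      obtain ⟨h1, h2⟩ := mem_puncturedDisk.mp hz
      have hr := norm_pos_iff.mpr h2
      have h3 := abs_le.1 (bK (Real.log ‖z‖) (Real.log_le_log hr h1.le)).1
      have hw0 := h.profile.nonneg (Real.log ‖z‖)
      have h4 : Real.cosh (2 * w (Real.log ‖z‖)) ≤ Real.exp (2 * w (Real.log ‖z‖)) := by
        rw [Real.cosh_eq]
        have : Real.exp (-(2 * w (Real.log ‖z‖))) ≤ Real.exp (2 * w (Real.log ‖z‖)) :=
          Real.exp_le_exp.2 (by linarith)
        linarith
      calc _ ≤ ‖z‖ * Real.exp (2 * w (Real.log ‖z‖)) := by gcongr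
        _ = Real.exp (Real.log ‖z‖ + 2 * w (Real.log ‖z‖)) := (exp_log_add h2 _).symm
        _ ≤ _ := Real.exp_le_exp.2 (by linarith [h3.2])
  have iW : IntegrableOn (wirt W) (disk S) := by
    refine integrableOn_disk_of_bounded
      (C := C ^ 2 + 4 * t ^ 2 * Real.exp (2 * K) * C ^ 2 + C * M)
      (ContDiffOn.wirt cW ho (m := 0) (by norm_num)).continuousOn fun z hz => ?_
    obtain ⟨b1, b2⟩ := bC z hz
    have hc0 : 0 ≤ ‖z‖ * Real.cosh (2 * w (Real.log ‖z‖)) := by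
      have := Real.cosh_pos (2 * w (Real.log ‖z‖)); positivity
    rw [wW z hz]
    refine (norm_add_le _ _).trans ?_
    rw [Complex.norm_real, Real.norm_of_nonneg (by positivity), norm_mul, RCLike.norm_conj]
    have p1 : ‖D z‖ ^ 2 ≤ C ^ 2 := pow_le_pow_left₀ (norm_nonneg _) b2 2
    have p2 : ‖e z‖ ^ 2 ≤ C ^ 2 := pow_le_pow_left₀ (norm_nonneg _) b1 2
    have p3 := hcosh z hz
    have p4 : ‖e z‖ * ‖E z‖ ≤ C * M := mul_le_mul b1 (hM z hz) (norm_nonneg _) hC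
    have p5 : 4 * t ^ 2 * (‖z‖ * Real.cosh (2 * w (Real.log ‖z‖))) * ‖e z‖ ^ 2 ≤
        4 * t ^ 2 * Real.exp (2 * K) * C ^ 2 := by gcongr
    linarith
  have nW : ∀ z ∈ puncturedDisk S, ‖W z‖ ≤ C * ‖e z‖ := fun z hz => by
    rw [hW, norm_mul, RCLike.norm_conj, mul_comm]
    gcongr
    exact (bC z hz).2
  have key : ∫ z in disk S, wirt W z = 0 := by
    refine integral_disk_wirt_eq_zero (C := C * (1 + C)) (G := fun z => ‖e z‖) hS (by positivity)
      cW iW (fun z hz => ?_) (fun z hz => ?_) h.continuousOn_error.norm ?_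
    · refine (nW z hz).trans (mul_le_mul_of_nonneg_left ?_ hC)
      linarith [(bC z hz).1]
    · refine (nW z hz).trans (mul_le_mul_of_nonneg_right ?_ (norm_nonneg _))
      exact le_mul_of_one_le_right hC (by linarith)
    · intro z hz
      simp only [he, h.error_sphere hz, norm_zero]
  have ir : IntegrableOn (fun z => ‖z‖ * ‖e z‖ ^ 2) (disk S) := by
    refine integrableOn_disk_of_bounded (C := S * C ^ 2)
      (continuous_norm.continuousOn.mul (ce.continuousOn.norm.pow 2)) fun z hz => ?_
    rw [Real.norm_of_nonneg (by positivity)]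
    have := (mem_puncturedDisk.mp hz).1.le
    gcongr
    exact (bC z hz).1
  refine ⟨ir, ?_⟩
  have pw : ∀ z ∈ puncturedDisk S,
      2 * t ^ 2 * (‖z‖ * ‖e z‖ ^ 2) - M ^ 2 / (8 * t ^ 2 * R₁) ≤ (wirt W z).re := fun z hz => by
    have hr : 0 < ‖z‖ := norm_pos_iff.mpr (mem_puncturedDisk.mp hz).2
    rw [wW z hz, Complex.add_re, Complex.ofReal_re]
    have h1 : -(‖e z‖ * ‖E z‖) ≤ ((starRingEnd ℂ) (e z) * E z).re := by
      have := Complex.abs_re_le_norm ((starRingEnd ℂ) (e z) * E z)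
      rw [norm_mul, RCLike.norm_conj] at this
      exact (abs_le.1 this).1
    have h2 : 4 * t ^ 2 * (‖z‖ * ‖e z‖ ^ 2) ≤
        4 * t ^ 2 * (‖z‖ * Real.cosh (2 * w (Real.log ‖z‖))) * ‖e z‖ ^ 2 := by
      have := Real.one_le_cosh (2 * w (Real.log ‖z‖))
      have h3 : ‖z‖ * 1 ≤ ‖z‖ * Real.cosh (2 * w (Real.log ‖z‖)) := by gcongr
      calc _ = 4 * t ^ 2 * (‖z‖ * 1) * ‖e z‖ ^ 2 := by ring
        _ ≤ _ := by gcongr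
    -- Young's inequality absorbs half of the potential term. Its price `M²/(8t²|z|)` is paid only
    -- for `|z| ≥ R₁`, because the defect vanishes inside.
    have h4 : ‖e z‖ * ‖E z‖ ≤ 2 * t ^ 2 * (‖z‖ * ‖e z‖ ^ 2) + M ^ 2 / (8 * t ^ 2 * R₁) := by
      rcases lt_or_ge ‖z‖ R₁ with hlt | hge
      · rw [h0 z hz hlt, norm_zero, mul_zero]
        positivity
      · have h5 : M ^ 2 / (8 * t ^ 2 * ‖z‖) ≤ M ^ 2 / (8 * t ^ 2 * R₁) := by gcongr
        have h6 : ‖e z‖ * M ≤ 2 * t ^ 2 * (‖z‖ * ‖e z‖ ^ 2) + M ^ 2 / (8 * t ^ 2 * ‖z‖) := by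
          have h7 : 0 ≤ (4 * t ^ 2 * ‖z‖ * ‖e z‖ - M) ^ 2 / (8 * t ^ 2 * ‖z‖) := by positivity
          have h8 : (4 * t ^ 2 * ‖z‖ * ‖e z‖ - M) ^ 2 / (8 * t ^ 2 * ‖z‖) =
            2 * t ^ 2 * (‖z‖ * ‖e z‖ ^ 2) + M ^ 2 / (8 * t ^ 2 * ‖z‖) - ‖e z‖ * M := by
              field_simp
              ring
          linarith
        have h9 : ‖e z‖ * ‖E z‖ ≤ ‖e z‖ * M := by gcongr; exact hM z hz
        linarith
    have h10 : 0 ≤ ‖D z‖ ^ 2 := by positivity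
    linarith
  have hfin : volume (disk S) < ⊤ := measure_ball_lt_top
  have hmono : ∫ z in disk S, (2 * t ^ 2 * (‖z‖ * ‖e z‖ ^ 2) - M ^ 2 / (8 * t ^ 2 * R₁)) ≤
      ∫ z in disk S, (wirt W z).re := by
    rw [← setIntegral_congr_set (disk_ae_eq_puncturedDisk S),
      ← setIntegral_congr_set (disk_ae_eq_puncturedDisk S)]
    refine setIntegral_mono_on ?_ ?_ ho.measurableSet pw
    · have i2 : IntegrableOn (fun z => 2 * t ^ 2 * (‖z‖ * ‖e z‖ ^ 2) - M ^ 2 / (8 * t ^ 2 * R₁))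
        (disk S) := (ir.const_mul _).sub (integrableOn_const hfin.ne)
      exact i2.mono_set sdiff_subset
    · exact (iW.mono_set sdiff_subset).re
  have hre : ∫ z in disk S, (wirt W z).re = 0 := by
    have := integral_re iW
    rw [key] at this
    simpa using this
  rw [hre, integral_sub (ir.const_mul _) (integrableOn_const hfin.ne), integral_const_mul,
    setIntegral_const, smul_eq_mul] at hmono
  rw [le_div_iff₀ (by positivity)]
  have e3 : volume.real (disk S) * (M ^ 2 / (8 * t ^ 2 * R₁)) * (8 * t ^ 2 * R₁)
    = M ^ 2 * volume.real (disk S) := by field_simp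
  have e4 := mul_le_mul_of_nonneg_right hmono (show 0 ≤ 8 * t ^ 2 * R₁ by positivity)
  rw [sub_mul, e3] at e4
  linarith

end IsDiagonalSolution

/-! ### Integrability of the densities and the exact part of their difference -/

/-- The density of the squared norm, off the origin, in terms of the upper left entry `n`. -/
def appDensity (t : ℝ) (w : ℝ → ℝ) (P n : ℂ → ℂ) (z : ℂ) : ℂ :=
  2 * t ^ 2 * Real.exp (-(Real.log ‖z‖ + 2 * w (Real.log ‖z‖))) * (P z + 2 * z * n z)
    * (starRingEnd ℂ) (P z)

/-- The density of the squared norm for the limiting metric, off the origin. -/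
def infDensity (t : ℝ) (P : ℂ → ℂ) (z : ℂ) : ℂ :=
  t ^ 2 * (‖z‖ : ℂ)⁻¹ * P z * (starRingEnd ℂ) (P z)

lemma integrableOn_infDensity {P : ℂ → ℂ} {S ρ : ℝ} (hP : DifferentiableOn ℂ P (disk ρ))
    (hS : S < ρ) (t : ℝ) : IntegrableOn (infDensity t P) (disk S) := by
  obtain ⟨A, hA, bA⟩ := exists_bound_closedBall hS hP.continuousOn
  have cP : ContinuousOn P (puncturedDisk S) := hP.continuousOn.mono
    ((puncturedDisk_subset_disk S).trans (Metric.ball_subset_ball hS.le))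
  refine integrableOn_disk_of_bound (C := t ^ 2 * A * A) ?_ fun z hz => ?_
  · refine ((continuousOn_const.mul (ContinuousOn.inv₀
      (Complex.continuous_ofReal.comp continuous_norm).continuousOn fun z hz => ?_)).mul cP).mul
      (Complex.continuous_conj.comp_continuousOn cP)
    exact norm_ne_zero_of_ne (mem_puncturedDisk.mp hz).2
  · have h1 := bA z (mem_puncturedDisk.mp hz).1.le
    simp only [infDensity, norm_mul, norm_pow, norm_inv, Complex.norm_real, RCLike.norm_conj,
      Real.norm_eq_abs, sq_abs, abs_norm]
    calc t ^ 2 * ‖z‖⁻¹ * ‖P z‖ * ‖P z‖ ≤ t ^ 2 * ‖z‖⁻¹ * A * A := by gcongr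
      _ = _ := by ring

namespace IsDiagonalSolution

variable {t S ρ : ℝ} {w w₁ w₂ w₃ : ℝ → ℝ} {P ξ n : ℂ → ℂ}
  (h : IsDiagonalSolution t S ρ w w₁ w₂ w₃ P ξ n)

include h

lemma integrableOn_appDensity : IntegrableOn (appDensity t w P n) (disk S) := by
  obtain ⟨A, hA, bA⟩ := exists_bound_closedBall h.S_lt h.holP.continuousOn
  obtain ⟨N, hN, bN⟩ := exists_bound_of_contDiffOn_closedBall h.S_pos h.contDiffOn
  have hS := h.S_pos
  have cP : ContinuousOn P (puncturedDisk S) := h.holP.continuousOn.mono h.punctured_subset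
  have cn : ContinuousOn n (puncturedDisk S) := h.contDiffOn.continuousOn.mono
    ((puncturedDisk_subset_disk S).trans (disk_subset_closedBall S))
  have clog : ContinuousOn (fun z : ℂ => Real.log ‖z‖) (puncturedDisk S) :=
    continuousOn_log_norm fun z hz => (mem_puncturedDisk.mp hz).2
  have cw : Continuous fun s => Real.exp (-(s + 2 * w s)) :=
    (continuous_id.add (continuous_const.mul h.profile.contDiff.continuous)).neg.rexp
  refine integrableOn_disk_of_bound (C := 2 * t ^ 2 * (A + 2 * S * N) * A) ?_ fun z hz => ?_
  · exact ((continuousOn_const.mul (Complex.continuous_ofReal.comp_continuousOn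
      (cw.comp_continuousOn clog))).mul (cP.add
      ((continuousOn_const.mul continuousOn_id).mul cn))).mul (Complex.continuous_conj.comp_continuousOn cP)
  · obtain ⟨hzS, hz0⟩ := mem_puncturedDisk.mp hz
    have h1 := bA z hzS.le
    have h2 := (bN z (puncturedDisk_subset_disk S hz)).1
    have h3 : Real.exp (-(2 * w (Real.log ‖z‖))) ≤ 1 :=
      Real.exp_le_one_iff.2 (by linarith [h.profile.nonneg (Real.log ‖z‖)])
    have h4 : ‖P z + 2 * z * n z‖ ≤ A + 2 * S * N := by
      refine (norm_add_le _ _).trans ?_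
      rw [norm_mul, norm_mul, Complex.norm_ofNat]
      gcongr
    rw [appDensity, exp_neg_log_add hz0]
    simp only [norm_mul, norm_pow, Complex.norm_real, RCLike.norm_conj, Complex.norm_ofNat,
      Real.norm_eq_abs, sq_abs, Real.abs_exp, abs_inv, abs_norm]
    calc 2 * t ^ 2 * (‖z‖⁻¹ * Real.exp (-(2 * w (Real.log ‖z‖)))) * ‖P z + 2 * z * n z‖ * ‖P z‖
        ≤ 2 * t ^ 2 * (‖z‖⁻¹ * 1) * (A + 2 * S * N) * A := by gcongr
      _ = _ := by ring

/-- The part of the difference of the densities that comes from the ansatz is exact. -/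
lemma exists_primitive : ∃ V : ℂ → ℂ, (∫ z in disk S, wirt V z = 0) ∧
    IntegrableOn (wirt V) (disk S) ∧ ∀ z ∈ puncturedDisk S,
      appDensity t w P n z - infDensity t P z = 2 * t ^ 2 * wirt V z
        + 4 * t ^ 2 * (Real.exp (-(2 * w (Real.log ‖z‖))) * (z * (‖z‖ : ℂ)⁻¹))
          * (n z - ansatz w₁ P ξ z) * (starRingEnd ℂ) (P z) := by
  obtain ⟨A, hA, bA⟩ := h.exists_bounds
  obtain ⟨K, hK, bK⟩ := h.profile.bound
  have ho := isOpen_puncturedDisk S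
  have hS := h.S_pos
  set ψ : ℝ → ℝ := fun s => (Real.exp (-(2 * w s)) - 1) * Real.exp (-s) with hψ
  have dψ : ∀ s, HasDerivAt ψ ((-(2 * w₁ s) * Real.exp (-(2 * w s))
      - (Real.exp (-(2 * w s)) - 1)) * Real.exp (-s)) s := fun s =>
    (((((h.profile.hasDerivAt s).const_mul 2).neg.exp).sub_const 1).mul
      ((hasDerivAt_id s).neg.exp)).congr_deriv (by simp; ring)
  have cψ : ContDiff ℝ 1 ψ :=
    ((contDiff_const.mul h.profile.contDiff).neg.exp.sub contDiff_const).mul contDiff_id.neg.exp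
  have hP := (contDiffOn_of_holomorphic (m := 1) h.holP (isOpen_disk ρ)).mono h.punctured_subset
  have hξ := (contDiffOn_of_holomorphic (m := 1) h.holξ (isOpen_disk ρ)).mono h.punctured_subset
  -- By the equation for `ξ`, `∂(zξ/|z|) = P/(2|z|)`. The factor `e^{-2w} - 1` then reproduces the
  -- difference of the weights, and its derivative the `w₁ξ` term of the ansatz. It vanishes on the
  -- boundary circle because `w` does, and `V` is bounded at the origin.
  set V : ℂ → ℂ := fun z => (ψ (Real.log ‖z‖) : ℂ) * (z * (ξ z * (starRingEnd ℂ) (P z))) with hV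
  have cV : ContDiffOn ℝ 1 V (puncturedDisk S) :=
    (contDiffOn_logNorm cψ S).mul (contDiffOn_id.mul (hξ.mul (ContDiffOn.conj hP)))
  have expneg : ∀ z : ℂ, z ≠ 0 → Real.exp (-Real.log ‖z‖) = ‖z‖⁻¹ := fun z hz => by
    rw [Real.exp_neg, Real.exp_log (norm_pos_iff.mpr hz)]
  have wV : ∀ z ∈ puncturedDisk S, wirt V z = (‖z‖ : ℂ)⁻¹ * (starRingEnd ℂ) (P z) / 2 *
      ((Real.exp (-(2 * w (Real.log ‖z‖))) - 1) * P z
        - 2 * w₁ (Real.log ‖z‖) * Real.exp (-(2 * w (Real.log ‖z‖))) * ξ z) := fun z hz => by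
    have hz0 := (mem_puncturedDisk.mp hz).2
    have hr := norm_ne_zero_of_ne hz0
    have hzρ := h.punctured_subset hz
    have h1 := (h.holP.hasDerivAt_of_isOpen (isOpen_disk ρ) hzρ).hasWirtAt
    have h2 := (h.holξ.hasDerivAt_of_isOpen (isOpen_disk ρ) hzρ).hasWirtAt
    refine ((hasWirtAt_logNorm hz0 (dψ _)).mul
      ((hasWirtAt_id z).mul (h2.mul h1.conj))).wirt.trans ?_
    have e := h.euler z hzρ
    simp only [hψ, expneg z hz0, map_zero]
    rw [← e]
    push_cast
    field_simp
    ring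
  have q0 : ∀ s, 0 ≤ Real.exp (-(2 * w s)) ∧ Real.exp (-(2 * w s)) ≤ 1 := fun s =>
    ⟨(Real.exp_pos _).le, Real.exp_le_one_iff.2 (by linarith [h.profile.nonneg s])⟩
  have iV : IntegrableOn (wirt V) (disk S) := by
    refine integrableOn_disk_of_bound
      (C := A * (A + 2 * (1 / 2 + K * S ^ 2) * A))
      (ContDiffOn.wirt cV ho (m := 0) (by norm_num)).continuousOn fun z hz => ?_
    obtain ⟨hzS, hz0⟩ := mem_puncturedDisk.mp hz
    have hr : 0 < ‖z‖ := norm_pos_iff.mpr hz0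
    obtain ⟨-, k1, -⟩ := bK (Real.log ‖z‖) (Real.log_le_log hr hzS.le)
    obtain ⟨a1, a2, -⟩ := bA z hzS.le
    have e2 : Real.exp (2 * Real.log ‖z‖) = ‖z‖ ^ 2 := by
      rw [two_mul, Real.exp_add, Real.exp_log hr, sq]
    have k2 : |w₁ (Real.log ‖z‖)| ≤ 1 / 2 + K * S ^ 2 := by
      have k3 : K * ‖z‖ ^ 2 ≤ K * S ^ 2 := by gcongr
      rw [e2] at k1
      have := abs_le.1 k1
      exact abs_le.2 ⟨by linarith, by linarith⟩
    obtain ⟨q1, q2⟩ := q0 (Real.log ‖z‖)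
    have q3 : ‖(Real.exp (-(2 * w (Real.log ‖z‖))) : ℂ) - 1‖ ≤ 1 := by
      rw [← Complex.ofReal_one, ← Complex.ofReal_sub, Complex.norm_real, Real.norm_eq_abs]
      exact abs_le.2 ⟨by linarith, by linarith⟩
    rw [wV z hz]
    have b1 : ‖((Real.exp (-(2 * w (Real.log ‖z‖))) : ℂ) - 1) * P z
        - 2 * w₁ (Real.log ‖z‖) * Real.exp (-(2 * w (Real.log ‖z‖))) * ξ z‖ ≤
        1 * A + 2 * (1 / 2 + K * S ^ 2) * 1 * A := by
      refine (norm_sub_le _ _).trans ?_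
      simp only [norm_mul, Complex.norm_real, Complex.norm_ofNat, Real.norm_eq_abs, Real.abs_exp]
      gcongr
    rw [norm_mul, norm_div, norm_mul, norm_inv, Complex.norm_real, norm_norm, RCLike.norm_conj,
      Complex.norm_ofNat]
    calc ‖z‖⁻¹ * ‖P z‖ / 2 * ‖((Real.exp (-(2 * w (Real.log ‖z‖))) : ℂ) - 1) * P z
        - 2 * w₁ (Real.log ‖z‖) * Real.exp (-(2 * w (Real.log ‖z‖))) * ξ z‖
        ≤ ‖z‖⁻¹ * A / 1 * (1 * A + 2 * (1 / 2 + K * S ^ 2) * 1 * A) := by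
          gcongr
          norm_num
      _ = _ := by ring
  refine ⟨V, ?_, iV, fun z hz => ?_⟩
  · set G : ℂ → ℝ := fun z => 1 - Real.exp (-(2 * w (Real.log ‖z‖))) with hG
    have nV : ∀ z ∈ puncturedDisk S, ‖V z‖ ≤ A * A * G z := fun z hz => by
      obtain ⟨hzS, hz0⟩ := mem_puncturedDisk.mp hz
      have hr : 0 < ‖z‖ := norm_pos_iff.mpr hz0
      obtain ⟨a1, a2, -⟩ := bA z hzS.le
      obtain ⟨q1, q2⟩ := q0 (Real.log ‖z‖)
      have : |Real.exp (-(2 * w (Real.log ‖z‖))) - 1| = G z := by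
        rw [abs_of_nonpos (by linarith)]; ring
      have hG0 : 0 ≤ G z := this ▸ abs_nonneg _
      simp only [hV, hψ, norm_mul, Complex.norm_real, RCLike.norm_conj, Real.norm_eq_abs,
        abs_inv, abs_norm, expneg z hz0, this]
      calc G z * ‖z‖⁻¹ * (‖z‖ * (‖ξ z‖ * ‖P z‖)) = ‖ξ z‖ * ‖P z‖ * G z := by field_simp
        _ ≤ _ := by gcongr
    refine integral_disk_wirt_eq_zero (C := A * A) (G := G) hS (by positivity) cV iV
      (fun z hz => ?_) nV ?_ ?_
    · refine (nV z hz).trans (mul_le_of_le_one_right (by positivity) ?_)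
      linarith [(q0 (Real.log ‖z‖)).1]
    · exact continuousOn_const.sub (((continuous_const.mul
        h.profile.contDiff.continuous).neg.rexp).comp_continuousOn
          (continuousOn_log_norm fun z hz => hz.2))
    · intro z hz
      simp only [hG, hz, h.profile.eq_zero _ le_rfl]
      simp
  · have hz0 := (mem_puncturedDisk.mp hz).2
    have hr := norm_ne_zero_of_ne hz0
    rw [wV z hz, appDensity, infDensity, ansatz, exp_neg_log_add hz0]
    push_cast
    field_simp
    ring

/-- The exact part integrates to zero, leaving a term linear in the error. Young's inequality with
the weight `|z|` and a free parameter `κ` bounds it by the energy integral and the integral of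
`1/|z|`. -/
theorem norm_integral_density_sub_le {M R₁ A κ : ℝ} (hR₁ : 0 < R₁) (hA : 0 ≤ A) (hκ : 0 < κ)
    (bA : ∀ z ∈ puncturedDisk S, ‖P z‖ ≤ A)
    (hM : ∀ z ∈ puncturedDisk S, ‖defect t w w₁ w₂ w₃ P ξ z‖ ≤ M)
    (h0 : ∀ z ∈ puncturedDisk S, ‖z‖ < R₁ → defect t w w₁ w₂ w₃ P ξ z = 0) :
    ‖∫ z in disk S, (appDensity t w P n z - infDensity t P z)‖ ≤
      4 * t ^ 2 * A * (κ / 2 * (M ^ 2 * volume.real (disk S) / (16 * t ^ 4 * R₁))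
        + (∫ z in disk S, ‖z‖⁻¹) / (2 * κ)) := by
  have ho := isOpen_puncturedDisk S
  obtain ⟨V, hV, iV, eV⟩ := h.exists_primitive
  obtain ⟨i1, e1⟩ := h.energy_estimate hR₁ hM h0
  set Q : ℂ → ℂ := fun z => 4 * t ^ 2 * (Real.exp (-(2 * w (Real.log ‖z‖)))
    * (z * (‖z‖ : ℂ)⁻¹)) * (n z - ansatz w₁ P ξ z) * (starRingEnd ℂ) (P z) with hQ
  have i2 := integrableOn_norm_inv S
  have ibound : IntegrableOn (fun z : ℂ => 4 * t ^ 2 * A *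
      (κ / 2 * (‖z‖ * ‖n z - ansatz w₁ P ξ z‖ ^ 2) + ‖z‖⁻¹ / (2 * κ))) (disk S) :=
    ((i1.const_mul _).add (i2.div_const _)).const_mul _
  have split : ∫ z in disk S, (appDensity t w P n z - infDensity t P z) = ∫ z in disk S, Q z := by
    have hi : IntegrableOn (fun z => appDensity t w P n z - infDensity t P z) (disk S) :=
      h.integrableOn_appDensity.sub (integrableOn_infDensity h.holP h.S_lt t)
    have e2 : ∀ᵐ z ∂(volume.restrict (disk S)), Q z =
        (appDensity t w P n z - infDensity t P z) - 2 * t ^ 2 * wirt V z := by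
      rw [← Measure.restrict_congr_set (disk_ae_eq_puncturedDisk S)]
      refine (ae_restrict_iff' ho.measurableSet).2 (Eventually.of_forall fun z hz => ?_)
      rw [eV z hz]; simp only [hQ]; ring
    rw [integral_congr_ae e2, integral_sub hi (iV.const_mul _), integral_const_mul, hV]
    simp
  rw [split]
  have pw : ∀ᵐ z ∂(volume.restrict (disk S)), ‖Q z‖ ≤ 4 * t ^ 2 * A *
      (κ / 2 * (‖z‖ * ‖n z - ansatz w₁ P ξ z‖ ^ 2) + ‖z‖⁻¹ / (2 * κ)) := by
    rw [← Measure.restrict_congr_set (disk_ae_eq_puncturedDisk S)]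
    refine (ae_restrict_iff' ho.measurableSet).2 (Eventually.of_forall fun z hz => ?_)
    have hz0 := (mem_puncturedDisk.mp hz).2
    have hr : 0 < ‖z‖ := norm_pos_iff.mpr hz0
    have q : Real.exp (-(2 * w (Real.log ‖z‖))) ≤ 1 :=
      Real.exp_le_one_iff.2 (by linarith [h.profile.nonneg (Real.log ‖z‖)])
    set x := ‖n z - ansatz w₁ P ξ z‖ with hx
    have young : x ≤ κ / 2 * (‖z‖ * x ^ 2) + ‖z‖⁻¹ / (2 * κ) := by
      have h7 : 0 ≤ (κ * ‖z‖ * x - 1) ^ 2 / (2 * κ * ‖z‖) := by positivity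
      have h8 : (κ * ‖z‖ * x - 1) ^ 2 / (2 * κ * ‖z‖) =
        κ / 2 * (‖z‖ * x ^ 2) + ‖z‖⁻¹ / (2 * κ) - x := by field_simp; ring
      linarith
    simp only [hQ, norm_mul, norm_pow, norm_inv, Complex.norm_real, RCLike.norm_conj,
      Complex.norm_ofNat, Real.norm_eq_abs, sq_abs, Real.abs_exp, abs_norm, ← hx]
    rw [mul_inv_cancel₀ hr.ne']
    calc 4 * t ^ 2 * (Real.exp (-(2 * w (Real.log ‖z‖))) * 1) * x * ‖P z‖
        ≤ 4 * t ^ 2 * (1 * 1) * x * A := by gcongr; exact bA z hz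
      _ = 4 * t ^ 2 * A * x := by ring
      _ ≤ _ := by gcongr
  refine (norm_integral_le_of_norm_le ibound pw).trans ?_
  rw [integral_const_mul, integral_add (i1.const_mul _) (i2.div_const _), integral_const_mul,
    integral_div]
  gcongr

end IsDiagonalSolution

/-! ### The defect of the ansatz -/

/-- Keeps the linear factor `|y|`, through which the exponential smallness of `U` enters the defect.
-/
lemma abs_sinh_le (y : ℝ) : |Real.sinh y| ≤ |y| * Real.exp |y| := by
  have key : ∀ x : ℝ, 0 ≤ x → Real.sinh x ≤ x * Real.exp x := fun x _ => by
    have h1 := Real.add_one_le_exp (-(2 * x))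
    have h2 : Real.exp (-x) = Real.exp x * Real.exp (-(2 * x)) := by
      rw [← Real.exp_add]; ring_nf
    rw [Real.sinh_eq, h2]
    nlinarith [Real.exp_pos x]
  rw [Real.abs_sinh]
  exact key _ (abs_nonneg y)

lemma cosh_le_exp_abs (y : ℝ) : Real.cosh y ≤ Real.exp |y| := by
  rw [← Real.cosh_abs, Real.cosh_eq]
  have : Real.exp (-|y|) ≤ Real.exp |y| := Real.exp_le_exp.2 (by linarith [abs_nonneg y])
  linarith

section
variable {t : ℝ} {U U₁ : ℝ → ℝ} {δ c L T s : ℝ}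

lemma abs_modelSecond_le (hU : |U s| ≤ δ) (hδ : δ ≤ c) (hT : Real.exp (3 * s) ≤ T)
    (hL : Real.exp (2 * c) ≤ L) : |modelSecond t U s| ≤ 16 * T * L * t ^ 2 * δ := by
  have hδ0 : 0 ≤ δ := (abs_nonneg _).trans hU
  have hT0 : 0 ≤ T := (Real.exp_pos _).le.trans hT
  have h2 : |2 * U s| ≤ 2 * δ := by rw [abs_mul, abs_two]; linarith
  have h3 : Real.exp |2 * U s| ≤ L := (Real.exp_le_exp.2 (by linarith)).trans hL
  have h1 : |Real.sinh (2 * U s)| ≤ 2 * δ * L :=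
    (abs_sinh_le _).trans (mul_le_mul h2 h3 (Real.exp_pos _).le (by linarith))
  rw [modelSecond, abs_mul, abs_mul, abs_mul, Real.abs_exp, abs_pow, sq_abs,
    abs_of_nonneg (by norm_num : (0 : ℝ) ≤ 8)]
  calc 8 * t ^ 2 * Real.exp (3 * s) * |Real.sinh (2 * U s)| ≤ 8 * t ^ 2 * T * (2 * δ * L) := by
        gcongr
    _ = _ := by ring

lemma abs_modelThird_le (hU : |U s| ≤ δ) (hU₁ : |U₁ s| ≤ δ) (hδ : δ ≤ c)
    (hT : Real.exp (3 * s) ≤ T) (hL : Real.exp (2 * c) ≤ L) :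
    |modelThird t U U₁ s| ≤ 64 * T * L * t ^ 2 * δ := by
  have hδ0 : 0 ≤ δ := (abs_nonneg _).trans hU
  have hT0 : 0 ≤ T := (Real.exp_pos _).le.trans hT
  have h2 : |2 * U s| ≤ 2 * δ := by rw [abs_mul, abs_two]; linarith
  have h3 : Real.exp |2 * U s| ≤ L := (Real.exp_le_exp.2 (by linarith)).trans hL
  have h1 : |Real.sinh (2 * U s)| ≤ 2 * δ * L :=
    (abs_sinh_le _).trans (mul_le_mul h2 h3 (Real.exp_pos _).le (by linarith))
  have h4 : |Real.cosh (2 * U s)| ≤ L := by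
    rw [abs_of_pos (Real.cosh_pos _)]; exact (cosh_le_exp_abs _).trans h3
  have h5 : |3 * Real.sinh (2 * U s) + 2 * U₁ s * Real.cosh (2 * U s)| ≤
      3 * (2 * δ * L) + 2 * δ * L := by
    refine (abs_add_le _ _).trans ?_
    rw [abs_mul, abs_mul, abs_mul, abs_two, abs_of_nonneg (by norm_num : (0 : ℝ) ≤ 3)]
    gcongr
  rw [modelThird, abs_mul, abs_mul, abs_mul, Real.abs_exp, abs_pow, sq_abs,
    abs_of_nonneg (by norm_num : (0 : ℝ) ≤ 8)]
  calc 8 * t ^ 2 * Real.exp (3 * s) * |3 * Real.sinh (2 * U s) + 2 * U₁ s * Real.cosh (2 * U s)|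
      ≤ 8 * t ^ 2 * T * (3 * (2 * δ * L) + 2 * δ * L) := by gcongr
    _ = _ := by ring

end

/-- Termwise estimate; the negative powers of `|z|` are controlled by `|z| ≥ R₁`. -/
lemma norm_defect_le {t : ℝ} {w w₁ w₂ w₃ : ℝ → ℝ} {P ξ : ℂ → ℂ} {z : ℂ} {A a b c d L R₁ : ℝ}
    (hR₁ : 0 < R₁) (hz : R₁ ≤ ‖z‖) (hP : ‖P z‖ ≤ A) (hξ : ‖ξ z‖ ≤ A) (hξ' : ‖deriv ξ z‖ ≤ A)
    (ha : |Real.sinh (2 * w (Real.log ‖z‖))| ≤ a) (hb : |w₁ (Real.log ‖z‖)| ≤ b)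
    (hL : Real.cosh (2 * w (Real.log ‖z‖)) ≤ L) (hc : |w₂ (Real.log ‖z‖)| ≤ c)
    (hd : |w₃ (Real.log ‖z‖)| ≤ d) :
    ‖defect t w w₁ w₂ w₃ P ξ z‖ ≤ t ^ 2 * (A * a + 2 * A * b * L) + A / 4 * (c * (R₁ ^ 2)⁻¹)
      + A * R₁⁻¹ * ((d + 2 * c) * (R₁ ^ 2)⁻¹) / 8 := by
  have hr : 0 < ‖z‖ := hR₁.trans_le hz
  have hz0 : z ≠ 0 := norm_pos_iff.1 hr
  have hA : 0 ≤ A := (norm_nonneg _).trans hP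
  have hb0 : 0 ≤ b := (abs_nonneg _).trans hb
  have hc0 : 0 ≤ c := (abs_nonneg _).trans hc
  have hd0 : 0 ≤ d := (abs_nonneg _).trans hd
  have hi : ‖z‖⁻¹ ≤ R₁⁻¹ := by gcongr
  have hi2 : (‖z‖ ^ 2)⁻¹ ≤ (R₁ ^ 2)⁻¹ := by gcongr
  rw [defect, exp_neg_two_log hz0]
  refine (norm_add_le _ _).trans (add_le_add ((norm_add_le _ _).trans (add_le_add ?_ ?_)) ?_)
  · have h1 : ‖-(P z * Real.sinh (2 * w (Real.log ‖z‖)))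
        - 2 * ξ z * w₁ (Real.log ‖z‖) * Real.cosh (2 * w (Real.log ‖z‖))‖
        ≤ A * a + 2 * A * b * L := by
      refine (norm_sub_le _ _).trans ?_
      simp only [norm_neg, norm_mul, Complex.norm_real, Real.norm_eq_abs, Complex.norm_ofNat,
        abs_of_pos (Real.cosh_pos _)]
      have := Real.cosh_pos (2 * w (Real.log ‖z‖))
      gcongr
    simp only [norm_mul, norm_pow, norm_inv, Complex.norm_real, Real.norm_eq_abs, sq_abs, abs_norm]
      at h1 ⊢
    rw [mul_inv_cancel₀ hr.ne', mul_one]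
    gcongr
  · simp only [norm_mul, norm_div, norm_inv, norm_pow, Complex.norm_real, Real.norm_eq_abs,
      Complex.norm_ofNat, abs_norm]
    gcongr
  · rw [norm_div, norm_mul, norm_mul, norm_mul, norm_inv, Complex.norm_ofNat]
    have h1 : ‖(w₃ (Real.log ‖z‖) : ℂ) - 2 * w₂ (Real.log ‖z‖)‖ ≤ d + 2 * c := by
      refine (norm_sub_le _ _).trans ?_
      simp only [norm_mul, Complex.norm_real, Real.norm_eq_abs, Complex.norm_ofNat]
      gcongr
    have h2 : ‖(((‖z‖ ^ 2)⁻¹ : ℝ) : ℂ)‖ ≤ (R₁ ^ 2)⁻¹ := by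
      rw [Complex.norm_real, Real.norm_of_nonneg (by positivity)]; exact hi2
    gcongr

section
variable {χ : ℝ → ℝ} {R₁ R₂ : ℝ}

/-- Where the cutoff is `1`, the ansatz is exact. -/
lemma IsCutoff.defect_eq_zero (hχ : IsCutoff χ R₁ R₂) (hR₁ : 0 < R₁) {t : ℝ} {U U₁ : ℝ → ℝ}
    {P ξ : ℂ → ℂ} {z : ℂ} (hz0 : z ≠ 0) (hz : ‖z‖ < R₁) (euler : 2 * z * deriv ξ z + ξ z = P z) :
    let X := fun s => χ (Real.exp s)
    defect t (fun s => U s * X s) (prof₁ U U₁ X) (prof₂ t U U₁ X) (prof₃ t U U₁ X) P ξ z = 0 := by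
  intro X
  have hr : 0 < ‖z‖ := norm_pos_iff.mpr hz0
  have hr' := norm_ne_zero_of_ne hz0
  obtain ⟨x0, x1, x2, x3⟩ := hχ.deriv_eq_zero hR₁ (Real.log_lt_log hr hz)
  have e3 : Real.exp (3 * Real.log ‖z‖) = ‖z‖ ^ 3 := by
    rw [show (3 : ℝ) * Real.log ‖z‖ = ((3 : ℕ) : ℝ) * Real.log ‖z‖ by norm_num, Real.exp_nat_mul,
      Real.exp_log hr]
  rw [defect, exp_neg_two_log hz0]
  simp only [prof₁, prof₂, prof₃, X, x0, x1, x2, x3, modelSecond, modelThird, e3, mul_one, mul_zero,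
    add_zero]
  rw [← euler]
  push_cast
  field_simp
  ring

/-- On the annulus `U` and `U₁` are bounded by `δ = c e^{-κt}`. The model equation gives bounds of
order `t²δ` for the next two derivatives, and every term of the defect carries one of these small
factors. -/
lemma IsCutoff.exists_defect_bound (hχ : IsCutoff χ R₁ R₂) (hR₁ : 0 < R₁)
    {U U₁ : ℝ → ℝ → ℝ} (h : ∀ t > 0, IsCylSolution t (U t) (U₁ t)) {P ξ : ℂ → ℂ} {A : ℝ}
    (hA : 0 ≤ A) (bA : ∀ z ∈ puncturedDisk R₂, ‖P z‖ ≤ A ∧ ‖ξ z‖ ≤ A ∧ ‖deriv ξ z‖ ≤ A) :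
    let X := fun s => χ (Real.exp s)
    ∃ C κ, 0 ≤ C ∧ 0 < κ ∧ ∀ t ≥ 1, ∀ z ∈ puncturedDisk R₂, R₁ ≤ ‖z‖ →
      ‖defect t (fun s => U t s * X s) (prof₁ (U t) (U₁ t) X) (prof₂ t (U t) (U₁ t) X)
        (prof₃ t (U t) (U₁ t) X) P ξ z‖ ≤ C * t ^ 2 * Real.exp (-(κ * t)) := by
  intro X
  obtain ⟨c, κ, hc, hκ, dec⟩ := exists_exp_decay h (Real.log R₁)
  obtain ⟨hX, hX1, hX2, hX3⟩ := hχ.hasDerivAt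
  have cX1 : Continuous (deriv X) := continuous_iff_continuousAt.2 fun s => (hX1 s).continuousAt
  have cX2 : Continuous (deriv (deriv X)) :=
    continuous_iff_continuousAt.2 fun s => (hX2 s).continuousAt
  obtain ⟨D₁, hD₁, bD₁⟩ := exists_mul_exp_bound cX1 (Real.log R₁) (Real.log R₂)
  obtain ⟨D₂, hD₂, bD₂⟩ := exists_mul_exp_bound cX2 (Real.log R₁) (Real.log R₂)
  obtain ⟨D₃, hD₃, bD₃⟩ := exists_mul_exp_bound hX3 (Real.log R₁) (Real.log R₂)
  set D := D₁ + D₂ + D₃ with hD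
  have hD0 : 0 ≤ D := by positivity
  set L := Real.exp (2 * c) with hL
  set T := Real.exp (3 * Real.log R₂) with hT
  have hL0 : 0 < L := Real.exp_pos _
  have hT0 : 0 < T := Real.exp_pos _
  set m := 16 * T * L + 3 * D with hm
  set k := 64 * T * L + 3 * (16 * T * L) * D + 4 * D with hk
  have hm0 : 0 ≤ m := by positivity
  have hk0 : 0 ≤ k := by positivity
  refine ⟨((A * (2 * L) + 2 * A * (1 + D) * L) + A / 4 * (m * (R₁ ^ 2)⁻¹)
      + A * R₁⁻¹ * ((k + 2 * m) * (R₁ ^ 2)⁻¹) / 8) * c, κ, by positivity, hκ,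
    fun t ht z hz hzR => ?_⟩
  obtain ⟨hzS, hz0⟩ := mem_puncturedDisk.mp hz
  have hr : 0 < ‖z‖ := norm_pos_iff.mpr hz0
  obtain ⟨a1, a2, a3⟩ := bA z hz
  set s := Real.log ‖z‖ with hs
  have hs1 : Real.log R₁ ≤ s := Real.log_le_log hR₁ hzR
  have hs2 : s ≤ Real.log R₂ := Real.log_le_log hr hzS.le
  set δ := c * Real.exp (-(κ * t)) with hδ
  obtain ⟨u0, u1⟩ := dec t ht s hs1
  have hδ0 : 0 ≤ δ := by positivity
  have hκt : 0 < κ * t := by positivity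
  have hδc : δ ≤ c := mul_le_of_le_one_right hc (Real.exp_le_one_iff.2 (by linarith))
  have hTs : Real.exp (3 * s) ≤ T := Real.exp_le_exp.2 (by linarith)
  have ht2 : 1 ≤ t ^ 2 := one_le_pow₀ ht
  -- Terms without a power of `t` are absorbed into those of order `t²δ`, using `t ≥ 1`.
  have hδt : δ ≤ t ^ 2 * δ := le_mul_of_one_le_left hδ0 ht2
  have x0 : |X s| ≤ 1 := by
    have := hχ.mem_Icc (Real.exp s)
    rw [abs_of_nonneg this.1]; exact this.2
  have x1 : |deriv X s| ≤ D := by linarith [(bD₁ s ⟨hs1, hs2⟩).1]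
  have x2 : |deriv (deriv X) s| ≤ D := by linarith [(bD₂ s ⟨hs1, hs2⟩).1]
  have x3 : |deriv (deriv (deriv X)) s| ≤ D := by linarith [(bD₃ s ⟨hs1, hs2⟩).1]
  have w0 : |U t s * X s| ≤ δ := by
    rw [abs_mul]
    calc |U t s| * |X s| ≤ δ * 1 := by gcongr
      _ = δ := mul_one _
  have w02 : |2 * (U t s * X s)| ≤ 2 * δ := by rw [abs_mul, abs_two]; linarith
  have wexp : Real.exp |2 * (U t s * X s)| ≤ L := Real.exp_le_exp.2 (by linarith)
  have wsinh : |Real.sinh (2 * (U t s * X s))| ≤ 2 * δ * L :=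
    (abs_sinh_le _).trans (mul_le_mul w02 wexp (Real.exp_pos _).le (by linarith))
  have wcosh : Real.cosh (2 * (U t s * X s)) ≤ L := (cosh_le_exp_abs _).trans wexp
  have p1 : |prof₁ (U t) (U₁ t) X s| ≤ (1 + D) * δ := by
    refine (abs_add_le _ _).trans ?_
    rw [abs_mul, abs_mul]
    calc |U₁ t s| * |X s| + |U t s| * |deriv X s| ≤ δ * 1 + δ * D := by gcongr
      _ = _ := by ring
  have m2 := abs_modelSecond_le (t := t) u0 hδc hTs le_rfl
  have m3 := abs_modelThird_le (t := t) u0 u1 hδc hTs le_rfl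
  have p2 : |prof₂ t (U t) (U₁ t) X s| ≤ m * (t ^ 2 * δ) := by
    refine (abs_add_le _ _).trans ?_
    refine (add_le_add_left (abs_add_le _ _) _).trans ?_
    rw [abs_mul, abs_mul, abs_mul, abs_mul, abs_two]
    calc |modelSecond t (U t) s| * |X s| + 2 * |U₁ t s| * |deriv X s|
          + |U t s| * |deriv (deriv X) s|
        ≤ 16 * T * L * t ^ 2 * δ * 1 + 2 * δ * D + δ * D := by gcongr
      _ = 16 * T * L * (t ^ 2 * δ) + 3 * D * δ := by ring
      _ ≤ 16 * T * L * (t ^ 2 * δ) + 3 * D * (t ^ 2 * δ) := by gcongr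
      _ = _ := by ring
  have p3 : |prof₃ t (U t) (U₁ t) X s| ≤ k * (t ^ 2 * δ) := by
    refine (abs_add_le _ _).trans ?_
    refine (add_le_add_left (abs_add_le _ _) _).trans ?_
    refine (add_le_add_left (add_le_add_left (abs_add_le _ _) _) _).trans ?_
    rw [abs_mul, abs_mul, abs_mul, abs_mul, abs_mul, abs_mul,
      abs_of_nonneg (by norm_num : (0 : ℝ) ≤ 3)]
    calc |modelThird t (U t) (U₁ t) s| * |X s| + 3 * |modelSecond t (U t) s| * |deriv X s|
          + 3 * |U₁ t s| * |deriv (deriv X) s| + |U t s| * |deriv (deriv (deriv X)) s|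
        ≤ 64 * T * L * t ^ 2 * δ * 1 + 3 * (16 * T * L * t ^ 2 * δ) * D + 3 * δ * D + δ * D := by
          gcongr
      _ = (64 * T * L + 3 * (16 * T * L) * D) * (t ^ 2 * δ) + 4 * D * δ := by ring
      _ ≤ (64 * T * L + 3 * (16 * T * L) * D) * (t ^ 2 * δ) + 4 * D * (t ^ 2 * δ) := by gcongr
      _ = _ := by ring
  refine (norm_defect_le hR₁ hzR a1 a2 a3 wsinh p1 wcosh p2 p3).trans (le_of_eq ?_)
  rw [hδ]
  ring

end

/-! ### Comparison of the norms -/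

section
variable {t R S ρ : ℝ} {u χ w w₁ w₂ w₃ : ℝ → ℝ} {P ξ : ℂ → ℂ} {ν : ℂ → Mat}

lemma IsAppVariation.isDiagonalSolution (h : IsAppVariation t R S u χ P ν) (ht : 0 < t)
    (hS : 0 < S) (hSR : S < R) (hRρ : R < ρ)
    (hw : ∀ s, w s = u (Real.exp s) * χ (Real.exp s)) (hp : IsProfile (Real.log S) w w₁ w₂ w₃)
    (hP : DifferentiableOn ℂ P (disk ρ)) (hξ : DifferentiableOn ℂ ξ (disk ρ))
    (euler : ∀ z ∈ disk ρ, 2 * z * deriv ξ z + ξ z = P z) :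
    IsDiagonalSolution t S ρ w w₁ w₂ w₃ P ξ fun z => ν z 0 0 where
  t_pos := ht
  S_pos := hS
  S_lt := hSR.trans hRρ
  profile := hp
  holP := hP
  holξ := hξ
  euler := euler
  contDiffOn := h.contDiffOn 0 0
  eqn z hz := (h.coulomb.entries hw hp.hasDerivAt hz
    (h.traceless z (mem_disk.mpr ((mem_puncturedDisk.mp hz).1.trans hSR)))).1
  sphere z hz := by
    rw [h.outer z (mem_disk.mpr (hz.trans_lt hSR)) hz.ge]
    simp [nuInf]

lemma IsAppVariation.rayDensity_eq_inner (h : IsAppVariation t R S u χ P ν) (hSR : S < R)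
    (hw : ∀ s, w s = u (Real.exp s) * χ (Real.exp s)) {z : ℂ} (hz : z ∈ puncturedDisk S) :
    rayDensity t (hApp u χ) P ν z = appDensity t w P (fun z => ν z 0 0) z :=
  rayDensity_hApp hw (mem_puncturedDisk.mp hz).2
    (h.traceless z (mem_disk.mpr ((mem_puncturedDisk.mp hz).1.trans hSR)))

lemma IsAppVariation.rayDensity_eq_outer (h : IsAppVariation t R S u χ P ν) (hS : 0 < S)
    (hw : ∀ s, w s = u (Real.exp s) * χ (Real.exp s)) (hp : IsProfile (Real.log S) w w₁ w₂ w₃)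
    {z : ℂ} (hz : z ∈ disk R) (hzS : S ≤ ‖z‖) :
    rayDensity t (hApp u χ) P ν z = infDensity t P z := by
  have hr : 0 < ‖z‖ := hS.trans_le hzS
  have hz0 : z ≠ 0 := norm_pos_iff.1 hr
  rw [rayDensity_hApp hw hz0 (h.traceless z hz), hp.eq_zero _ (Real.log_le_log hS hzS),
    h.outer z hz hzS, exp_neg_log_add hz0, infDensity]
  have h1 : P z + 2 * z * nuInf P z 0 0 = P z / 2 := by
    simp [nuInf]
    field_simp
    ring
  rw [h1, mul_zero, neg_zero, Real.exp_zero, mul_one]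
  push_cast
  ring

lemma IsAppVariation.integrableOn_rayDensity (h : IsAppVariation t R S u χ P ν)
    (hw : ∀ s, w s = u (Real.exp s) * χ (Real.exp s)) (hSR : S < R) (hRρ : R < ρ)
    (hd : IsDiagonalSolution t S ρ w w₁ w₂ w₃ P ξ fun z => ν z 0 0) :
    IntegrableOn (rayDensity t (hApp u χ) P ν) (disk R) := by
  have hsub : disk S ⊆ disk R := Metric.ball_subset_ball hSR.le
  have hm : MeasurableSet (disk R \ disk S) := (isOpen_disk R).measurableSet.diff
    (isOpen_disk S).measurableSet
  rw [← union_sdiff_cancel hsub]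
  refine IntegrableOn.union ?_ ?_
  · have i1 := hd.integrableOn_appDensity
    rw [← integrableOn_congr_set_ae (disk_ae_eq_puncturedDisk S)] at i1 ⊢
    exact i1.congr_fun (fun z hz => (h.rayDensity_eq_inner hSR hw hz).symm)
      (isOpen_puncturedDisk S).measurableSet
  · refine ((integrableOn_infDensity hd.holP hRρ t).mono_set sdiff_subset).congr_fun
      (fun z hz => (h.rayDensity_eq_outer hd.S_pos hw hd.profile hz.1 ?_).symm) hm
    simpa [mem_disk] using hz.2

lemma integrableOn_rayDensity_nuInf (hP : DifferentiableOn ℂ P (disk ρ)) (hRρ : R < ρ) (t : ℝ) :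
    IntegrableOn (rayDensity t hInf P (nuInf P)) (disk R) := by
  have i1 := integrableOn_infDensity hP hRρ t
  rw [← integrableOn_congr_set_ae (disk_ae_eq_puncturedDisk R)] at i1 ⊢
  exact i1.congr_fun (fun z hz => (rayDensity_nuInf (mem_puncturedDisk.mp hz).2).symm)
    (isOpen_puncturedDisk R).measurableSet

/-- Beyond radius `S` the profile is zero and `ν = ν_∞`, so the two densities agree there and only
the inner disk contributes. -/
lemma IsAppVariation.rayNormSq_sub (h : IsAppVariation t R S u χ P ν)
    (hw : ∀ s, w s = u (Real.exp s) * χ (Real.exp s)) (hSR : S < R) (hRρ : R < ρ)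
    (hd : IsDiagonalSolution t S ρ w w₁ w₂ w₃ P ξ fun z => ν z 0 0) :
    rayNormSq R t (hApp u χ) P ν - rayNormSq R t hInf P (nuInf P) =
      2 * ∫ z in disk S, (appDensity t w P (fun z => ν z 0 0) z - infDensity t P z) := by
  have hsub : disk S ⊆ disk R := Metric.ball_subset_ball hSR.le
  have e : rayNormSq R t (hApp u χ) P ν - rayNormSq R t hInf P (nuInf P) =
      2 * ∫ z in disk R, (rayDensity t (hApp u χ) P ν z - rayDensity t hInf P (nuInf P) z) := by
    rw [integral_sub (h.integrableOn_rayDensity hw hSR hRρ hd)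
      (integrableOn_rayDensity_nuInf hd.holP hRρ t), mul_sub]
    rfl
  rw [e, setIntegral_eq_of_subset_of_forall_sdiff_eq_zero (s := disk S)
    (isOpen_disk R).measurableSet hsub, ← setIntegral_congr_set (disk_ae_eq_puncturedDisk S),
    ← setIntegral_congr_set (f := fun z => appDensity t w P (fun z => ν z 0 0) z - infDensity t P z)
      (disk_ae_eq_puncturedDisk S)]
  · congr 1
    refine setIntegral_congr_fun (isOpen_puncturedDisk S).measurableSet fun z hz => ?_
    simp only [h.rayDensity_eq_inner hSR hw hz, rayDensity_nuInf (mem_puncturedDisk.mp hz).2,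
      infDensity]
  · intro z hz
    have hzS : S ≤ ‖z‖ := by simpa [mem_disk] using hz.2
    have hz0 : z ≠ 0 := norm_pos_iff.1 (hd.S_pos.trans_le hzS)
    rw [h.rayDensity_eq_outer hd.S_pos hw hd.profile hz.1 hzS, rayDensity_nuInf hz0, infDensity,
      sub_self]

end

/-- Half of the exponential rate absorbs `t²`, by `x²/2 ≤ e^x` at `x = κt/2`. -/
lemma sq_mul_exp_le {κ t : ℝ} (hκ : 0 < κ) (ht : 0 ≤ t) :
    t ^ 2 * Real.exp (-(κ * t)) ≤ 8 / κ ^ 2 * Real.exp (-(κ / 2) * t) := by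
  have h1 := Real.quadratic_le_exp_of_nonneg (show 0 ≤ κ / 2 * t by positivity)
  have h2 : t ^ 2 ≤ 8 / κ ^ 2 * Real.exp (κ / 2 * t) := by
    have h3 : t ^ 2 = 8 / κ ^ 2 * ((κ / 2 * t) ^ 2 / 2) := by field_simp; norm_num
    rw [h3]
    have : 0 ≤ κ / 2 * t := by positivity
    gcongr
    linarith
  calc t ^ 2 * Real.exp (-(κ * t)) ≤ 8 / κ ^ 2 * Real.exp (κ / 2 * t) * Real.exp (-(κ * t)) := by
        gcongr
    _ = _ := by rw [mul_assoc, ← Real.exp_add]; ring_nf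

theorem exists_rayNormSq_sub_isBigO {R₁ R₂ R ρ : ℝ} (hR₁ : 0 < R₁) (hR₁₂ : R₁ < R₂) (hR₂ : R₂ < R)
    (hR : R < ρ) {χ : ℝ → ℝ} (hχ : IsCutoff χ R₁ R₂) {u : ℝ → ℝ → ℝ}
    (hu : ∀ t > 0, IsModelSolution t (u t)) {P : ℂ → ℂ} (hP : DifferentiableOn ℂ P (disk ρ))
    {ν : ℝ → ℂ → Mat} (hν : ∀ t > 0, IsAppVariation t R R₂ (u t) χ P (ν t)) :
    (∀ t > 0, IntegrableOn (rayDensity t (hApp (u t) χ) P (ν t)) (disk R)) ∧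
    ∃ γ : ℝ, 0 < γ ∧ (fun t : ℝ => rayNormSq R t (hApp (u t) χ) P (ν t)
      - rayNormSq R t hInf P (nuInf P)) =O[atTop] fun t : ℝ => Real.exp (-γ * t) := by
  have hR₂0 := hR₁.trans hR₁₂
  obtain ⟨ξ, hξ, euler⟩ := exists_euler_solution hP
  set U : ℝ → ℝ → ℝ := fun t s => u t (Real.exp s) with hU
  set U₁ : ℝ → ℝ → ℝ := fun t s => deriv (u t) (Real.exp s) * Real.exp s with hU₁
  have hcyl : ∀ t > 0, IsCylSolution t (U t) (U₁ t) := fun t ht => (hu t ht).isCylSolution ht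
  set X : ℝ → ℝ := fun s => χ (Real.exp s) with hX
  have hd : ∀ t > 0, IsDiagonalSolution t R₂ ρ (fun s => U t s * X s) (prof₁ (U t) (U₁ t) X)
      (prof₂ t (U t) (U₁ t) X) (prof₃ t (U t) (U₁ t) X) P ξ fun z => ν t z 0 0 := fun t ht =>
    (hν t ht).isDiagonalSolution ht hR₂0 hR₂ hR (fun _ => rfl)
      (hχ.isProfile hR₁ hR₁₂ ht (hcyl t ht)) hP hξ euler
  refine ⟨fun t ht => (hν t ht).integrableOn_rayDensity (fun _ => rfl) hR₂ hR (hd t ht), ?_⟩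
  -- These bounds concern only `P` and `ξ`, so taking them at `t = 1` makes `A` independent of `t`.
  obtain ⟨A, hA, bA⟩ := (hd 1 one_pos).exists_bounds
  have bA' : ∀ z ∈ puncturedDisk R₂, ‖P z‖ ≤ A ∧ ‖ξ z‖ ≤ A ∧ ‖deriv ξ z‖ ≤ A := fun z hz =>
    bA z (mem_puncturedDisk.mp hz).1.le
  obtain ⟨C, κ, hC, hκ, bC⟩ := hχ.exists_defect_bound hR₁ hcyl hA bA'
  set I := ∫ z in disk R₂, ‖z‖⁻¹ with hI
  set v := volume.real (disk R₂) with hv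
  refine ⟨κ / 2, by positivity,
    IsBigO.of_bound (8 * A * (C ^ 2 * v / (32 * R₁) + I / 2) * (8 / κ ^ 2)) ?_⟩
  filter_upwards [eventually_ge_atTop 1] with t ht
  have ht0 : 0 < t := by linarith
  have hI0 : 0 ≤ I := integral_nonneg fun z => by positivity
  have hv0 : 0 ≤ v := measureReal_nonneg
  have hzero : ∀ z ∈ puncturedDisk R₂, ‖z‖ < R₁ → defect t (fun s => U t s * X s)
      (prof₁ (U t) (U₁ t) X) (prof₂ t (U t) (U₁ t) X) (prof₃ t (U t) (U₁ t) X) P ξ z = 0 :=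
    fun z hz hlt => hχ.defect_eq_zero hR₁ (mem_puncturedDisk.mp hz).2 hlt
      (euler z ((hd t ht0).punctured_subset hz))
  have hM : ∀ z ∈ puncturedDisk R₂, ‖defect t (fun s => U t s * X s)
      (prof₁ (U t) (U₁ t) X) (prof₂ t (U t) (U₁ t) X) (prof₃ t (U t) (U₁ t) X) P ξ z‖ ≤
        C * t ^ 2 * Real.exp (-(κ * t)) := fun z hz => by
    rcases lt_or_ge ‖z‖ R₁ with hlt | hge
    · rw [hzero z hz hlt, norm_zero]; positivity
    · exact bC t ht z hz hge
  -- The Young parameter `e^{κt}` balances the two terms: with `M² ~ t⁴ e^{-2κt}` the energy term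
  -- and the `1/|z|` term are both of order `e^{-κt}`, before the prefactor `t²`.
  have key := (hd t ht0).norm_integral_density_sub_le hR₁ hA (Real.exp_pos (κ * t))
    (fun z hz => (bA' z hz).1) hM hzero
  rw [(hν t ht0).rayNormSq_sub (fun _ => rfl) hR₂ hR (hd t ht0), norm_mul, Complex.norm_ofNat,
    Real.norm_of_nonneg (Real.exp_pos _).le]
  have e1 : 2 * (4 * t ^ 2 * A * (Real.exp (κ * t) / 2 *
      ((C * t ^ 2 * Real.exp (-(κ * t))) ^ 2 * v / (16 * t ^ 4 * R₁))
        + I / (2 * Real.exp (κ * t)))) =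
      8 * A * (C ^ 2 * v / (32 * R₁) + I / 2) * (t ^ 2 * Real.exp (-(κ * t))) := by
    rw [Real.exp_neg]
    field_simp
    ring
  calc _ ≤ 2 * (4 * t ^ 2 * A * (Real.exp (κ * t) / 2 *
      ((C * t ^ 2 * Real.exp (-(κ * t))) ^ 2 * v / (16 * t ^ 4 * R₁))
        + I / (2 * Real.exp (κ * t)))) := by gcongr
    _ = 8 * A * (C ^ 2 * v / (32 * R₁) + I / 2) * (t ^ 2 * Real.exp (-(κ * t))) := e1
    _ ≤ 8 * A * (C ^ 2 * v / (32 * R₁) + I / 2) * (8 / κ ^ 2 * Real.exp (-(κ / 2) * t)) := by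
        exact mul_le_mul_of_nonneg_left (sq_mul_exp_le hκ ht0.le) (by positivity)
    _ = _ := by ring

end HiggsDisk

end

/-! ### The main theorem -/

theorem mainTheorem4
    (R₁ R₂ R ρ : ℝ) (hR₁ : 0 < R₁) (hR₁₂ : R₁ < R₂) (hR₂ : R₂ < R) (hR : R < ρ)
    (χ : ℝ → ℝ) (hχ : HiggsDisk.IsCutoff χ R₁ R₂)
    (u : ℝ → ℝ → ℝ) (hu : ∀ t > 0, HiggsDisk.IsModelSolution t (u t))
    (η f : ℂ → HiggsDisk.Mat)
    (hdef : HiggsDisk.IsHiggsDeformation (HiggsDisk.disk ρ) HiggsDisk.higgs η f) :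
    ∃ P : ℂ → ℂ,
      -- the class has a representative with `η̇ = 0` and `φ̇` strictly upper triangular
      DifferentiableOn ℂ P (HiggsDisk.disk R) ∧
      HiggsDisk.GaugeEquiv (HiggsDisk.disk R) HiggsDisk.higgs η f
        (fun _ => 0) (HiggsDisk.upper P) ∧
      -- which is unique
      (∀ η' f' : ℂ → HiggsDisk.Mat,
        HiggsDisk.GaugeEquiv (HiggsDisk.disk R) HiggsDisk.higgs η f η' f' →
        (∀ z ∈ HiggsDisk.disk R, η' z = 0) →
        (∀ z ∈ HiggsDisk.disk R, f' z 0 0 = 0 ∧ f' z 1 0 = 0 ∧ f' z 1 1 = 0) →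
        ∀ z ∈ HiggsDisk.disk R, f' z = HiggsDisk.upper P z) ∧
      -- with `ν_∞ = -(P / 4z) σ₃` it is in formal Coulomb gauge, along the whole ray, and solves
      -- the linearized decoupled equation
      (∀ t : ℝ, 0 < t →
        HiggsDisk.FormalCoulomb (HiggsDisk.puncturedDisk R) HiggsDisk.hInf
          (fun z => (t : ℂ) • HiggsDisk.higgs z) (fun _ => 0)
          (fun z => (t : ℂ) • HiggsDisk.upper P z) (HiggsDisk.nuInf P) ∧
        HiggsDisk.LinearizedNormal (HiggsDisk.puncturedDisk R) HiggsDisk.hInf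
          (fun z => (t : ℂ) • HiggsDisk.higgs z)
          (fun z => (t : ℂ) • HiggsDisk.upper P z) (HiggsDisk.nuInf P)) ∧
      -- every solution `ν` of the two equations defining the variation of `h_∞` is carried by a
      -- unique infinitesimal gauge transformation to one that varies `h_∞` as `ν_∞` does, and to
      -- `ν_∞` itself if `η̇ - ∂̄ν = 0`
      (∀ ν : ℂ → HiggsDisk.Mat,
        HiggsDisk.MatContDiffOn (⊤ : ℕ∞) ν (HiggsDisk.puncturedDisk R) →
        HiggsDisk.TracelessOn ν (HiggsDisk.puncturedDisk R) →
        HiggsDisk.FormalCoulomb (HiggsDisk.puncturedDisk R) HiggsDisk.hInf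
          HiggsDisk.higgs η f ν →
        HiggsDisk.LinearizedNormal (HiggsDisk.puncturedDisk R) HiggsDisk.hInf
          HiggsDisk.higgs f ν →
        ∃ γ : ℂ → HiggsDisk.Mat,
          (HiggsDisk.IsGauge (HiggsDisk.puncturedDisk R) HiggsDisk.higgs γ η f
              (fun _ => 0) (HiggsDisk.upper P) ∧
            ∀ z ∈ HiggsDisk.puncturedDisk R,
              (ν z + γ z) + HiggsDisk.adj (HiggsDisk.hInf z) (ν z + γ z) =
                HiggsDisk.nuInf P z
                  + HiggsDisk.adj (HiggsDisk.hInf z) (HiggsDisk.nuInf P z)) ∧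
          (∀ γ' : ℂ → HiggsDisk.Mat,
            HiggsDisk.IsGauge (HiggsDisk.puncturedDisk R) HiggsDisk.higgs γ' η f
              (fun _ => 0) (HiggsDisk.upper P) →
            (∀ z ∈ HiggsDisk.puncturedDisk R,
              (ν z + γ' z) + HiggsDisk.adj (HiggsDisk.hInf z) (ν z + γ' z) =
                HiggsDisk.nuInf P z
                  + HiggsDisk.adj (HiggsDisk.hInf z) (HiggsDisk.nuInf P z)) →
            ∀ z ∈ HiggsDisk.puncturedDisk R, γ' z = γ z) ∧
          ((∀ z ∈ HiggsDisk.puncturedDisk R, η z - HiggsDisk.matDzBar ν z = 0) →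
            ∀ z ∈ HiggsDisk.puncturedDisk R, ν z + γ z = HiggsDisk.nuInf P z)) ∧
      -- `ν_t^app` is diagonal
      (∀ t : ℝ, 0 < t → ∀ ν : ℂ → HiggsDisk.Mat,
        HiggsDisk.IsAppVariation t R R₂ (u t) χ P ν →
        ∀ z ∈ HiggsDisk.disk R, (ν z).IsDiag) ∧
      -- the two contributions of the disk are finite, and they are exponentially close
      (∀ ν : ℝ → ℂ → HiggsDisk.Mat,
        (∀ t > 0, HiggsDisk.IsAppVariation t R R₂ (u t) χ P (ν t)) →
        (∀ t : ℝ, 0 < t →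
          MeasureTheory.IntegrableOn
            (HiggsDisk.rayDensity t (HiggsDisk.hApp (u t) χ) P (ν t)) (HiggsDisk.disk R) ∧
          MeasureTheory.IntegrableOn
            (HiggsDisk.rayDensity t HiggsDisk.hInf P (HiggsDisk.nuInf P))
            (HiggsDisk.disk R)) ∧
        ∃ γ : ℝ, 0 < γ ∧
          (fun t : ℝ => HiggsDisk.rayNormSq R t (HiggsDisk.hApp (u t) χ) P (ν t)
              - HiggsDisk.rayNormSq R t HiggsDisk.hInf P (HiggsDisk.nuInf P))
            =O[Filter.atTop] fun t : ℝ => Real.exp (-γ * t)) := by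
  have hsub : HiggsDisk.disk R ⊆ HiggsDisk.disk ρ := Metric.ball_subset_ball hR.le
  have hpsub : HiggsDisk.puncturedDisk R ⊆ HiggsDisk.disk R := sdiff_subset
  have hR₂0 : 0 < R₂ := hR₁.trans hR₁₂
  -- Holomorphy on the larger disk is kept because integrability on the disk of radius `R` uses
  -- bounds on `P` up to `|z| = R`.
  have hPρ := hdef.differentiableOn_upperCoeff
  have hPR := hPρ.mono hsub
  have hequiv := hdef.gaugeEquiv_upper (hR₂0.trans hR₂) hR
  refine ⟨HiggsDisk.upperCoeff f, hPR, hequiv, ?_, ?_, ?_, ?_, ?_⟩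
  · rintro η' f' ⟨γ, hγ⟩ - hf' z hz
    exact hγ.eq_upper hz (hf' z hz)
  · exact fun t _ => ⟨HiggsDisk.formalCoulomb_nuInf hPR t, HiggsDisk.linearizedNormal_nuInf t⟩
  · intro ν hs ht hcoul hlin
    obtain ⟨γ₀, hγ₀⟩ := hequiv
    obtain ⟨γ, hγ, hγν⟩ := HiggsDisk.exists_gauge_to_nuInf (hγ₀.mono hpsub) hs ht
      (fun i j => (hdef.smooth_eta i j).mono (hpsub.trans hsub)) hcoul hlin
    exact ⟨γ, ⟨hγ, hγν⟩, fun γ' hγ' hγν' => HiggsDisk.gauge_unique hγ hγ' hγν hγν',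
      HiggsDisk.eq_nuInf_of_eta_eq hγ hs ht hcoul hγν⟩
  · intro t ht ν hν
    exact hν.isDiag hR₂0 hR₂ ht (fun _ => rfl)
      (hχ.isProfile hR₁ hR₁₂ ht ((hu t ht).isCylSolution ht))
  · intro ν hν
    obtain ⟨hint, hbig⟩ :=
      HiggsDisk.exists_rayNormSq_sub_isBigO hR₁ hR₁₂ hR₂ hR hχ hu hPρ hν
    exact ⟨fun t ht => ⟨hint t ht, HiggsDisk.integrableOn_rayDensity_nuInf hPρ hR t⟩, hbig⟩
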